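/- For an integer $k\ge 2$ and real numbers $a,b\ge 0$, let $\mathrm{SBM}(n,k,a,b)$ be the law of the pair $(\sigma,G)$ in which the communities $\sigma_v$ of the vertices $v\in[n]$ are independent and uniform on $[k]$ and, given $\sigma$, the graph $G$ on $[n]$ contains each pair $\{u,v\}$, $u\neq v$, independently, with probability $a/n$ if $\sigma_u=\sigma_v$ and $b/n$ otherwise (values above $1$ being replaced by $1$). Put $$\mathrm{SNR}=\frac{(a-b)^2}{k\,(a+(k-1)b)} .$$ **Lemma.** There is a single estimator, which takes as input a graph $G$ on $[n]$ only (and none of the parameters $a,b,k$) and outputs rational numbers $\hat a_n(G),\hat b_n(G)$ and an integer $\hat k_n(G)$, such that the following hold. 1. (Efficiency.) The estimator is computed by one deterministic algorithm which, on every $n$-vertex graph given by its adjacency matrix, halts in time polynomial in $n$; here time is the logarithmic cost on a random access machine. 2. (Form.) There is a function $M$ with $M(n)\to\infty$ and $M(n)=o((\log n)^{1/4})$ such that $(\hat a_n,\hat b_n,\hat k_n)(G)$ depends only on $n$, on the number of edges of $G$, and on the numbers of closed nonbacktracking walks in $G$ of the lengths $m\le M(n)$. (A closed nonbacktracking walk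 of length $m$ is a cyclic sequence of $m$ vertices, with a marked starting point, in which consecutive vertices are adjacent and any two vertices at distance two along the sequence are different.) 3. (Consistency.) For all $k\ge 2$ and $a,b\ge 0$ (not depending on $n$) with $\mathrm{SNR}>1$ and all $\varepsilon>0$, if $(\sigma,G)\sim\mathrm{SBM}(n,k,a,b)$, then $$\mathbb P\big(|\hat a_n(G)-a|<\varepsilon,\ |\hat b_n(G)-b|<\varepsilon,\ \hat k_n(G)=k\big)\longrightarrow 1\qquad(n\to\infty).$$ -/

import Mathlib

noncomputable section

open Filter Topology Asymptotics
open scoped Classical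

namespace SBM

/-! ### The symmetric stochastic block model -/

/-- The probability that `u` and `v` are joined, given the communities `σ`: `a / n` if the two
communities agree and `b / n` otherwise. (The truncation to `[0, 1]` only matters when
`n < max a b`, where the quotient is not a probability.) -/
def edgeProb {n k : ℕ} (a b : ℝ) (σ : Fin n → Fin k) (u v : Fin n) : ℝ :=
  max 0 (min 1 ((if σ u = σ v then a else b) / n))

/-- The unordered pairs of distinct vertices, each listed once. -/
def pairs (n : ℕ) : Finset (Fin n × Fin n) := Finset.univ.filter fun e => e.1 < e.2

/-- The conditional probability of the graph `G` given the communities `σ`: the pairs of vertices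
are joined independently. -/
def graphWeight {n k : ℕ} (a b : ℝ) (σ : Fin n → Fin k) (G : SimpleGraph (Fin n)) : ℝ :=
  ∏ e ∈ pairs n, if G.Adj e.1 e.2 then edgeProb a b σ e.1 e.2 else 1 - edgeProb a b σ e.1 e.2

/-- The probability of `(σ, G)`: the communities are independent and uniform on `k` labels. -/
def weight {n k : ℕ} (a b : ℝ) (x : (Fin n → Fin k) × SimpleGraph (Fin n)) : ℝ :=
  (1 / (k : ℝ)) ^ n * graphWeight a b x.1 x.2

theorem edgeProb_nonneg {n k : ℕ} (a b : ℝ) (σ : Fin n → Fin k) (u v : Fin n) :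
    0 ≤ edgeProb a b σ u v := le_max_left _ _

theorem edgeProb_le_one {n k : ℕ} (a b : ℝ) (σ : Fin n → Fin k) (u v : Fin n) :
    edgeProb a b σ u v ≤ 1 := max_le zero_le_one (min_le_left _ _)

theorem graphWeight_nonneg {n k : ℕ} (a b : ℝ) (σ : Fin n → Fin k) (G : SimpleGraph (Fin n)) :
    0 ≤ graphWeight a b σ G := by
  refine Finset.prod_nonneg fun e _ => ?_
  split_ifs
  · exact edgeProb_nonneg _ _ _ _ _
  · exact sub_nonneg.2 (edgeProb_le_one _ _ _ _ _)

theorem weight_nonneg {n k : ℕ} (a b : ℝ) (x : (Fin n → Fin k) × SimpleGraph (Fin n)) :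
    0 ≤ weight a b x := mul_nonneg (by positivity) (graphWeight_nonneg _ _ _ _)

theorem sum_graphWeight {n k : ℕ} (a b : ℝ) (σ : Fin n → Fin k) :
    ∑ G : SimpleGraph (Fin n), graphWeight a b σ G = 1 := by
  have h1 : ∏ e ∈ pairs n, (edgeProb a b σ e.1 e.2 + (1 - edgeProb a b σ e.1 e.2)) = 1 := by
    simp
  rw [Finset.prod_add] at h1
  rw [← h1]
  refine Finset.sum_bij' (fun G _ => (pairs n).filter fun e => G.Adj e.1 e.2)
    (fun t _ => SimpleGraph.fromRel fun u v => (u, v) ∈ t) ?_ ?_ ?_ ?_ ?_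
  · intro G _
    simp
  · intro t _
    simp
  · intro G _
    ext u v
    simp only [SimpleGraph.fromRel_adj, Finset.mem_filter, pairs, Finset.mem_univ, true_and]
    constructor
    · rintro ⟨_, h | h⟩
      · exact h.2
      · exact h.2.symm
    · intro h
      refine ⟨h.ne, ?_⟩
      rcases lt_or_gt_of_ne h.ne with h' | h'
      · exact Or.inl ⟨h', h⟩
      · exact Or.inr ⟨h', h.symm⟩
  · intro t ht
    rw [Finset.mem_powerset] at ht
    have hlt : ∀ u v, (u, v) ∈ t → u < v := fun u v h => by
      have := ht h
      simpa [pairs] using this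
    ext ⟨u, v⟩
    simp only [SimpleGraph.fromRel_adj, Finset.mem_filter, pairs, Finset.mem_univ, true_and]
    constructor
    · rintro ⟨h, _, h' | h'⟩
      · exact h'
      · exact absurd (hlt _ _ h') (not_lt.2 h.le)
    · intro h
      exact ⟨hlt _ _ h, (hlt _ _ h).ne, Or.inl h⟩
  · intro G _
    rw [graphWeight, Finset.prod_ite, ← Finset.filter_not]

theorem sum_weight {n k : ℕ} [NeZero k] (a b : ℝ) :
    ∑ x : (Fin n → Fin k) × SimpleGraph (Fin n), weight a b x = 1 := by
  have hk : (k : ℝ) ≠ 0 := by exact_mod_cast NeZero.ne k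
  rw [Fintype.sum_prod_type]
  simp only [weight, ← Finset.mul_sum, sum_graphWeight, Finset.sum_const, Finset.card_univ,
    Fintype.card_fun, Fintype.card_fin, nsmul_eq_mul, Nat.cast_pow, mul_one]
  rw [← mul_pow, mul_one_div_cancel hk, one_pow]

/-- The symmetric stochastic block model `SBM(n, k, a, b)`, as the law of the pair `(σ, G)`. -/
def sbm (n k : ℕ) [NeZero k] (a b : ℝ) : PMF ((Fin n → Fin k) × SimpleGraph (Fin n)) :=
  PMF.ofFintype (fun x => ENNReal.ofReal (weight a b x)) (by
    rw [← ENNReal.ofReal_sum_of_nonneg fun x _ => weight_nonneg a b x, sum_weight,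
      ENNReal.ofReal_one])

/-- The signal-to-noise ratio of the symmetric model. -/
def snr (k : ℕ) (a b : ℝ) : ℝ := (a - b) ^ 2 / (k * (a + (k - 1) * b))

/-! ### Random access machines with logarithmic cost -/

/-- Arithmetic on natural numbers (`sub` is truncated, `div` is the floor of the quotient). -/
inductive ArithOp where
  | add | sub | mul | div

def ArithOp.eval : ArithOp → ℕ → ℕ → ℕ
  | .add, x, y => x + y
  | .sub, x, y => x - y
  | .mul, x, y => x * y
  | .div, x, y => x / y

/-- Structured programs of a random access machine. A program mentions finitely many registers by
fixed names, and reaches the unbounded memory by indirect addressing.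
* `const i c` : `rᵢ := c`
* `arith o i j l` : `rᵢ := rⱼ o rₗ`
* `load i j` : `rᵢ := mem[rⱼ]`
* `store i j` : `mem[rᵢ] := rⱼ`
* `seq P Q` : `P`, then `Q`
* `cond i P Q` : `P` if `rᵢ ≠ 0`, otherwise `Q`
* `loop i P` : repeat `P` as long as `rᵢ ≠ 0`. -/
inductive Prog where
  | const (i c : ℕ)
  | arith (o : ArithOp) (i j l : ℕ)
  | load (i j : ℕ)
  | store (i j : ℕ)
  | seq (P Q : Prog)
  | cond (i : ℕ) (P Q : Prog)
  | loop (i : ℕ) (P : Prog)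

/-- The contents of the registers and of the memory. -/
structure State where
  reg : ℕ → ℕ
  mem : ℕ → ℕ

def State.setReg (s : State) (i x : ℕ) : State := { s with reg := Function.update s.reg i x }

def State.setMem (s : State) (i x : ℕ) : State := { s with mem := Function.update s.mem i x }

/-- `Exec P s s' t`: started in `s`, the program `P` halts in `s'` after time `t`. Each step costs
one more than the total number of binary digits (`Nat.size`) of its operands, addresses
included. -/
inductive Exec : Prog → State → State → ℕ → Prop where
  | const (s : State) (i c : ℕ) :
      Exec (.const i c) s (s.setReg i c) (1 + c.size)
  | arith (s : State) (o : ArithOp) (i j l : ℕ) :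
      Exec (.arith o i j l) s (s.setReg i (o.eval (s.reg j) (s.reg l)))
        (1 + (s.reg j).size + (s.reg l).size)
  | load (s : State) (i j : ℕ) :
      Exec (.load i j) s (s.setReg i (s.mem (s.reg j)))
        (1 + (s.reg j).size + (s.mem (s.reg j)).size)
  | store (s : State) (i j : ℕ) :
      Exec (.store i j) s (s.setMem (s.reg i) (s.reg j))
        (1 + (s.reg i).size + (s.reg j).size)
  | seq {P Q : Prog} {s s₁ s₂ : State} {t₁ t₂ : ℕ} :
      Exec P s s₁ t₁ → Exec Q s₁ s₂ t₂ → Exec (.seq P Q) s s₂ (t₁ + t₂)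
  | cond_true {i : ℕ} {P Q : Prog} {s s' : State} {t : ℕ} :
      s.reg i ≠ 0 → Exec P s s' t → Exec (.cond i P Q) s s' (1 + (s.reg i).size + t)
  | cond_false {i : ℕ} {P Q : Prog} {s s' : State} {t : ℕ} :
      s.reg i = 0 → Exec Q s s' t → Exec (.cond i P Q) s s' (1 + (s.reg i).size + t)
  | loop_done {i : ℕ} {P : Prog} {s : State} :
      s.reg i = 0 → Exec (.loop i P) s s (1 + (s.reg i).size)
  | loop_step {i : ℕ} {P : Prog} {s s₁ s₂ : State} {t₁ t₂ : ℕ} :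
      s.reg i ≠ 0 → Exec P s s₁ t₁ → Exec (.loop i P) s₁ s₂ t₂ →
        Exec (.loop i P) s s₂ (1 + (s.reg i).size + t₁ + t₂)

/-- The machine is deterministic: the final state and the running time are unique. -/
theorem Exec.unique {P : Prog} {s s₁ s₂ : State} {t₁ t₂ : ℕ} (h₁ : Exec P s s₁ t₁)
    (h₂ : Exec P s s₂ t₂) : s₁ = s₂ ∧ t₁ = t₂ := by
  induction h₁ generalizing s₂ t₂ with
  | const | arith | load | store => cases h₂; exact ⟨rfl, rfl⟩
  | seq _ _ ih₁ ih₂ =>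
    cases h₂ with
    | seq h h' =>
      obtain ⟨rfl, rfl⟩ := ih₁ h
      obtain ⟨rfl, rfl⟩ := ih₂ h'
      exact ⟨rfl, rfl⟩
  | cond_true h0 _ ih =>
    cases h₂ with
    | cond_true _ h => obtain ⟨rfl, rfl⟩ := ih h; exact ⟨rfl, rfl⟩
    | cond_false h0' _ => exact absurd h0' h0
  | cond_false h0 _ ih =>
    cases h₂ with
    | cond_true h0' _ => exact absurd h0 h0'
    | cond_false _ h => obtain ⟨rfl, rfl⟩ := ih h; exact ⟨rfl, rfl⟩
  | loop_done h0 =>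
    cases h₂ with
    | loop_done _ => exact ⟨rfl, rfl⟩
    | loop_step h0' _ _ => exact absurd h0 h0'
  | loop_step h0 _ _ ih₁ ih₂ =>
    cases h₂ with
    | loop_done h0' => exact absurd h0' h0
    | loop_step _ h h' =>
      obtain ⟨rfl, rfl⟩ := ih₁ h
      obtain ⟨rfl, rfl⟩ := ih₂ h'
      exact ⟨rfl, rfl⟩

/-! ### Estimators -/

/-- The value of an estimator of the parameters `a`, `b`, `k`. -/
structure Estimate where
  a : ℚ
  b : ℚ
  k : ℕ

/-- An estimator: it sees the number of vertices and the graph (not the communities). -/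
abbrev Estimator : Type := (n : ℕ) → SimpleGraph (Fin n) → Estimate

/-- The input of the machine: `r₀ = n`, the other registers are `0`, and the memory holds the
adjacency matrix of `G` row by row, followed by zeros. -/
def inputState {n : ℕ} (G : SimpleGraph (Fin n)) : State where
  reg := fun i => if i = 0 then n else 0
  mem := fun x => if ∃ u v : Fin n, x = u.val * n + v.val ∧ G.Adj u v then 1 else 0

/-- The output of the machine: `k` is read from `r₀`, and `a`, `b` are the fractions `r₁ / r₂`,
`r₃ / r₄`. -/
def State.output (s : State) : Estimate where
  a := (s.reg 1 : ℚ) / (s.reg 2 : ℚ)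
  b := (s.reg 3 : ℚ) / (s.reg 4 : ℚ)
  k := s.reg 0

/-- The estimator is computed by one program, in time polynomial in the number `n` of vertices,
on every graph. -/
def IsEfficient (est : Estimator) : Prop :=
  ∃ (P : Prog) (c : ℕ), ∀ (n : ℕ) (G : SimpleGraph (Fin n)), ∃ (s : State) (t : ℕ),
    Exec P (inputState G) s t ∧ t ≤ c * (n + 1) ^ c ∧ s.output = est n G

/-- Consistency at `(k, a, b)`: when `G` is drawn from `SBM(n, k, a, b)`, the estimates of `a` and
`b` are arbitrarily close to `a` and `b`, and that of `k` is equal to `k`, with probability tending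
to `1` as `n → ∞`. -/
def IsConsistentAt (est : Estimator) (k : ℕ) [NeZero k] (a b : ℝ) : Prop :=
  ∀ ε : ℝ, 0 < ε →
    Tendsto (fun n : ℕ => (sbm n k a b).toOuterMeasure
      {x | |((est n x.2).a : ℝ) - a| < ε ∧ |((est n x.2).b : ℝ) - b| < ε ∧ (est n x.2).k = k})
      atTop (𝓝 1)

/-- The number of closed nonbacktracking walks `w₀, w₁, …, wₘ = w₀` of length `m` in `G`: cyclic
sequences of vertices in which consecutive vertices are adjacent and no edge is followed by its
reversal, where the first edge is taken to follow the last one. In particular every cycle of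
length `m ≥ 3` is counted `2 m` times. -/
def closedNonbacktrackingCount {n : ℕ} (G : SimpleGraph (Fin n)) (m : ℕ) : ℕ :=
  Nat.card {w : Fin m → Fin n // ∀ i, G.Adj (w i) (w (finRotate m i)) ∧
    w i ≠ w (finRotate m (finRotate m i))}

/-- The estimator uses only the number of vertices, the number of edges, and the numbers of closed
nonbacktracking walks of length at most `M n`, where `M n → ∞` and `M n = o((log n) ^ (1 / 4))`. -/
def UsesShortClosedWalks (est : Estimator) : Prop :=
  ∃ M : ℕ → ℕ, Tendsto M atTop atTop ∧
    (fun n : ℕ => (M n : ℝ)) =o[atTop] (fun n : ℕ => Real.log n ^ (1 / 4 : ℝ)) ∧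
    ∀ (n : ℕ) (G H : SimpleGraph (Fin n)), G.edgeSet.ncard = H.edgeSet.ncard →
      (∀ m ≤ M n, closedNonbacktrackingCount G m = closedNonbacktrackingCount H m) →
      est n G = est n H

end SBM

end

noncomputable section

open Filter Topology Asymptotics
open scoped Classical

namespace SBM

/-! ### Expectations in the block model -/

section Expectation

variable {n k : ℕ}

/-! Put d = (a + (k - 1) b) / k (`avgDegree`) and s = (a - b) / k (`secondEigenvalue`). These are
the eigenvalues of `commMatrix k a b` divided by k, with multiplicities 1 and k - 1, and SNR > 1
says that s² > d. The number N_m of closed nonbacktracking walks of length m is close to d^m + (k -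
1) s^m (`meanCycles_eq`), and above the threshold its fluctuations are o(|s|^m). So the walk counts
reveal s and k as soon as d is known, and d is read off from the number of edges.

Concentration of N_m: every vertex visited by a closed nonbacktracking walk has degree at least two
in the graph traced out. Hence either this graph has more edges than vertices, or all its degrees
are two and the walk goes once or several times around a cycle. The expected number of walks of the
first kind is at most (C m)^m / n (`expect_sum_excessWalks_le`). Repeated cycles have length at most
m / 2, and their expected number is at most m k d^(m/2) = o(|s|^m). For genuine cycles the same
dichotomy, applied to pairs of cycles (`pair_trichotomy`), bounds the second moment around the
limiting mean by about 2 m k d^m = o(s^(2m)). Chebyshev and Markov then give `expect_deviation_le'`.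

Distinct edges are uncorrelated, so 2|E| / n differs from d by O(n^(-1/2)) in mean square
(`expect_edge_sub_sq_le`). The lengths are multiples of `scale n`, about log log n. This is so short
that d^m is also known up to o(1) and that (B m)^(2m) / n tends to 0. Thus E_m = N_m - (2|E| / n)^m
is (k - 1) s^m (1 + o(1)). With m = 2j one has k - 1 ≈ E_m² / E_(2m) and s ≈ E_(m+1) / E_m, and
finally b = d - s and a = k d - (k - 1) b. The length m is even so that E_m is positive whatever the
sign of s; multiplication by powers of n turns all quantities into natural numbers. The
deterministic part of this argument is `estimateOf_close`, and `estimator_isConsistentAt` combines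
it with the deviation bounds.

Efficiency: N_m is the trace of the m-th power of a matrix indexed by the n² pairs of vertices, and
the program tabulates these powers by a recursion on the last step. For the logarithmic cost,
multiplications inside loops have a right factor with few digits, so that the number of digits grows
additively (`Runs`, `Reach`); the final formulas, where large numbers are multiplied, contain no
loop (`Prog.LoopFree.exec`). -/

/-- The expectation of `f (σ, G)`. -/
def expect (n k : ℕ) (a b : ℝ) (f : (Fin n → Fin k) × SimpleGraph (Fin n) → ℝ) : ℝ :=
  ∑ x, weight a b x * f x

/-- Graphs correspond to subsets of `pairs n`, so this is the expansion of a product of binomials.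
-/
theorem sum_graph_prod (f g : Fin n × Fin n → ℝ) :
    ∑ G : SimpleGraph (Fin n), ∏ e ∈ pairs n, (if G.Adj e.1 e.2 then f e else g e) =
      ∏ e ∈ pairs n, (f e + g e) := by
  rw [Finset.prod_add]
  refine Finset.sum_bij' (fun G _ => (pairs n).filter fun e => G.Adj e.1 e.2)
    (fun t _ => SimpleGraph.fromRel fun u v => (u, v) ∈ t) ?_ ?_ ?_ ?_ ?_
  · intro G _
    simp
  · intro t _
    simp
  · intro G _
    ext u v
    simp only [SimpleGraph.fromRel_adj, Finset.mem_filter, pairs, Finset.mem_univ, true_and]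
    constructor
    · rintro ⟨_, h | h⟩
      · exact h.2
      · exact h.2.symm
    · intro h
      refine ⟨h.ne, ?_⟩
      rcases lt_or_gt_of_ne h.ne with h' | h'
      · exact Or.inl ⟨h', h⟩
      · exact Or.inr ⟨h', h.symm⟩
  · intro t ht
    rw [Finset.mem_powerset] at ht
    have hlt : ∀ u v, (u, v) ∈ t → u < v := fun u v h => by
      have := ht h
      simpa [pairs] using this
    ext ⟨u, v⟩
    simp only [SimpleGraph.fromRel_adj, Finset.mem_filter, pairs, Finset.mem_univ, true_and]
    constructor
    · rintro ⟨h, _, h' | h'⟩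
      · exact h'
      · exact absurd (hlt _ _ h') (not_lt.2 h.le)
    · intro h
      exact ⟨hlt _ _ h, (hlt _ _ h).ne, Or.inl h⟩
  · intro G _
    rw [Finset.prod_ite, ← Finset.filter_not]

theorem le_iff_forall_pairs (H G : SimpleGraph (Fin n)) :
    H ≤ G ↔ ∀ e ∈ pairs n, H.Adj e.1 e.2 → G.Adj e.1 e.2 := by
  refine ⟨fun h e _ he => h he, fun h u v huv => ?_⟩
  rcases lt_or_gt_of_ne huv.ne with h' | h'
  · exact h (u, v) (by simpa [pairs] using h') huv
  · exact (h (v, u) (by simpa [pairs] using h') huv.symm).symm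

/-- The number of edges of a graph on `Fin n`. -/
def edgeCount (H : SimpleGraph (Fin n)) : ℕ := H.edgeFinset.card

theorem prod_pairs_eq_prod_edgeFinset (H : SimpleGraph (Fin n)) (q : Sym2 (Fin n) → ℝ) :
    ∏ e ∈ pairs n, (if H.Adj e.1 e.2 then q s(e.1, e.2) else 1) = ∏ e ∈ H.edgeFinset, q e := by
  rw [← Finset.prod_filter]
  refine Finset.prod_bij (fun e _ => s(e.1, e.2)) ?_ ?_ ?_ ?_
  · intro e he
    simpa using (Finset.mem_filter.1 he).2
  · rintro ⟨u, v⟩ h ⟨u', v'⟩ h' he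
    simp only [pairs, Finset.mem_filter, Finset.mem_univ, true_and] at h h'
    rcases Sym2.eq_iff.1 he with ⟨h1, h2⟩ | ⟨h1, h2⟩
    · exact Prod.ext h1 h2
    · have h3 := h.1
      have h4 := h'.1
      simp only at h1 h2 h3 h4
      rw [h1, h2] at h3
      exact absurd h3 (not_lt.2 h4.le)
  · intro e he
    induction e with | _ u v
    have he : H.Adj u v := by simpa using he
    rcases lt_or_gt_of_ne he.ne with h' | h'
    · exact ⟨(u, v), by simp [pairs, h', he], rfl⟩
    · exact ⟨(v, u), by simp [pairs, h', he.symm], Sym2.eq_swap⟩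
  · intro e _
    rfl

theorem edgeProb_comm (a b : ℝ) (σ : Fin n → Fin k) (u v : Fin n) :
    edgeProb a b σ u v = edgeProb a b σ v u := by
  simp only [edgeProb, eq_comm]

/-- The edge probability as a function on unordered pairs. -/
def symEdgeProb (a b : ℝ) (σ : Fin n → Fin k) : Sym2 (Fin n) → ℝ :=
  Sym2.lift ⟨edgeProb a b σ, edgeProb_comm a b σ⟩

theorem sum_graphWeight_le (a b : ℝ) (σ : Fin n → Fin k) (H : SimpleGraph (Fin n)) :
    ∑ G : SimpleGraph (Fin n), graphWeight a b σ G * (if H ≤ G then 1 else 0) =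
      ∏ e ∈ H.edgeFinset, symEdgeProb a b σ e := by
  rw [← prod_pairs_eq_prod_edgeFinset]
  -- The indicator is absorbed into the product by giving weight zero to the absence of an edge of
  -- `H`. The sum over `G` then factorizes.
  have h1 : ∀ G : SimpleGraph (Fin n), graphWeight a b σ G * (if H ≤ G then 1 else 0) =
      ∏ e ∈ pairs n, (if G.Adj e.1 e.2 then edgeProb a b σ e.1 e.2 else
        (if H.Adj e.1 e.2 then 0 else 1 - edgeProb a b σ e.1 e.2)) := by
    intro G
    split_ifs with h
    · rw [mul_one, graphWeight]
      refine Finset.prod_congr rfl fun e he => ?_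
      have := (le_iff_forall_pairs H G).1 h e he
      split_ifs <;> tauto
    · rw [le_iff_forall_pairs] at h
      push Not at h
      obtain ⟨e, he, h1, h2⟩ := h
      rw [mul_zero, Finset.prod_eq_zero he]
      rw [if_neg h2, if_pos h1]
  simp_rw [h1]
  rw [sum_graph_prod (fun e => edgeProb a b σ e.1 e.2)
    (fun e => if H.Adj e.1 e.2 then 0 else 1 - edgeProb a b σ e.1 e.2)]
  refine Finset.prod_congr rfl fun e _ => ?_
  split_ifs
  · simp [symEdgeProb]
  · ring

/-- The probability that a fixed graph is contained in the random graph. -/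
theorem expect_le_graph (a b : ℝ) (H : SimpleGraph (Fin n)) :
    expect n k a b (fun x => if H ≤ x.2 then 1 else 0) =
      (1 / (k : ℝ)) ^ n * ∑ σ : Fin n → Fin k, ∏ e ∈ H.edgeFinset, symEdgeProb a b σ e := by
  rw [expect, Fintype.sum_prod_type, Finset.mul_sum]
  refine Finset.sum_congr rfl fun σ _ => ?_
  rw [← sum_graphWeight_le, Finset.mul_sum]
  refine Finset.sum_congr rfl fun G _ => ?_
  rw [weight, mul_assoc]

theorem uniform_sum_const [NeZero k] (n : ℕ) (c : ℝ) :
    (1 / (k : ℝ)) ^ n * ∑ _σ : Fin n → Fin k, c = c := by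
  have hk : (k : ℝ) ≠ 0 := by exact_mod_cast NeZero.ne k
  simp [hk]

theorem edgeProb_le_div {a b C : ℝ} (ha : a ≤ C) (hb : b ≤ C) (hC : 0 ≤ C)
    (σ : Fin n → Fin k) (u v : Fin n) : edgeProb a b σ u v ≤ C / n := by
  refine max_le (by positivity) ((min_le_right _ _).trans ?_)
  gcongr
  split_ifs <;> assumption

/-- A crude bound that ignores the communities; it suffices for the subgraphs with more edges than
vertices. -/
theorem expect_le_graph_le [NeZero k] {a b C : ℝ} (ha : a ≤ C) (hb : b ≤ C) (hC : 0 ≤ C)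
    (H : SimpleGraph (Fin n)) :
    expect n k a b (fun x => if H ≤ x.2 then 1 else 0) ≤ (C / n) ^ edgeCount H := by
  rw [expect_le_graph, ← uniform_sum_const (k := k) n ((C / n) ^ edgeCount H)]
  gcongr with σ
  rw [edgeCount, ← Finset.prod_const]
  refine Finset.prod_le_prod (fun e _ => ?_) (fun e _ => ?_)
  · induction e with | _ u v
    exact edgeProb_nonneg _ _ _ _ _
  · induction e with | _ u v
    exact edgeProb_le_div ha hb hC _ _ _

theorem expect_add (a b : ℝ) (f g : (Fin n → Fin k) × SimpleGraph (Fin n) → ℝ) :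
    expect n k a b (fun x => f x + g x) = expect n k a b f + expect n k a b g := by
  simp only [expect, mul_add, Finset.sum_add_distrib]

theorem expect_const_mul (a b c : ℝ) (f : (Fin n → Fin k) × SimpleGraph (Fin n) → ℝ) :
    expect n k a b (fun x => c * f x) = c * expect n k a b f := by
  simp only [expect, Finset.mul_sum]
  exact Finset.sum_congr rfl fun x _ => by ring

theorem expect_const [NeZero k] (a b c : ℝ) :
    expect n k a b (fun _ => c) = c := by
  simp only [expect]
  rw [← Finset.sum_mul, sum_weight, one_mul]

theorem expect_sum {ι : Type*} (s : Finset ι) (a b : ℝ)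
    (f : ι → (Fin n → Fin k) × SimpleGraph (Fin n) → ℝ) :
    expect n k a b (fun x => ∑ i ∈ s, f i x) = ∑ i ∈ s, expect n k a b (f i) := by
  simp only [expect, Finset.mul_sum]
  exact Finset.sum_comm

theorem expect_mono (a b : ℝ) {f g : (Fin n → Fin k) × SimpleGraph (Fin n) → ℝ}
    (h : ∀ x, f x ≤ g x) : expect n k a b f ≤ expect n k a b g :=
  Finset.sum_le_sum fun x _ => mul_le_mul_of_nonneg_left (h x) (weight_nonneg _ _ _)

theorem expect_sq_sub [NeZero k] (a b c : ℝ)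
    (f : (Fin n → Fin k) × SimpleGraph (Fin n) → ℝ) :
    expect n k a b (fun x => (f x - c) ^ 2) =
      expect n k a b (fun x => f x ^ 2) - 2 * c * expect n k a b f + c ^ 2 := by
  have h : (fun x => (f x - c) ^ 2) = fun x => (f x ^ 2 + (-(2 * c)) * f x) + c ^ 2 := by
    funext x; ring
  rw [h, expect_add, expect_add, expect_const_mul, expect_const]
  ring

/-- Markov's inequality. -/
theorem expect_indicator_le {a b t : ℝ} (ht : 0 < t)
    {f : (Fin n → Fin k) × SimpleGraph (Fin n) → ℝ} (h : ∀ x, 0 ≤ f x) :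
    expect n k a b (fun x => if t ≤ f x then 1 else 0) ≤ expect n k a b f / t := by
  rw [le_div_iff₀ ht, mul_comm, ← expect_const_mul]
  refine expect_mono a b fun x => ?_
  split_ifs with h1
  · simpa using h1
  · simpa using h x

theorem toOuterMeasure_eq [NeZero k] (a b : ℝ)
    (S : Set ((Fin n → Fin k) × SimpleGraph (Fin n))) :
    (sbm n k a b).toOuterMeasure S =
      ENNReal.ofReal (expect n k a b (fun x => if x ∈ S then 1 else 0)) := by
  rw [PMF.toOuterMeasure_apply_fintype, expect, ENNReal.ofReal_sum_of_nonneg]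
  · refine Finset.sum_congr rfl fun x _ => ?_
    by_cases h : x ∈ S
    · simp [h, sbm]
    · simp [h]
  · intro x _
    have := weight_nonneg a b x
    split_ifs <;> simp [this]

/-- Restricting uniform labels to distinct vertices gives uniform labels. -/
theorem uniform_sum_comp [NeZero k] {ι : Type*} [Fintype ι] [DecidableEq ι] {w : ι → Fin n}
    (hw : Function.Injective w) (g : (ι → Fin k) → ℝ) :
    (1 / (k : ℝ)) ^ n * ∑ σ : Fin n → Fin k, g (σ ∘ w) =
      (1 / (k : ℝ)) ^ Fintype.card ι * ∑ τ : ι → Fin k, g τ := by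
  have hk : (k : ℝ) ≠ 0 := by exact_mod_cast NeZero.ne k
  -- The labels outside the range of `w` are free and are summed out.
  let κ := ((Set.range w)ᶜ : Set (Fin n))
  let e : ι ⊕ κ ≃ Fin n :=
    ((Equiv.ofInjective w hw).sumCongr (Equiv.refl κ)).trans (Equiv.Set.sumCompl (Set.range w))
  have he : ∀ i, e (Sum.inl i) = w i := fun i =>
    Equiv.Set.sumCompl_apply_inl (Set.range w) ⟨w i, i, rfl⟩
  have hcard : n = Fintype.card ι + Fintype.card κ := by
    have := Fintype.card_congr e
    rw [Fintype.card_sum, Fintype.card_fin] at this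
    exact this.symm
  have h1 : ∑ σ : Fin n → Fin k, g (σ ∘ w) =
      ∑ p : (ι → Fin k) × (κ → Fin k), g p.1 := by
    refine Fintype.sum_equiv ((Equiv.arrowCongr e.symm (Equiv.refl _)).trans
      (Equiv.sumArrowEquivProdArrow ι κ (Fin k))) _ _ fun σ => ?_
    refine congrArg g (funext fun i => ?_)
    simp [← he, Equiv.sumArrowEquivProdArrow]
  rw [h1, Fintype.sum_prod_type]
  simp only [Finset.sum_const, Finset.card_univ, Fintype.card_fun, Fintype.card_fin, nsmul_eq_mul,
    ← Finset.mul_sum]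
  rw [show (1 / (k : ℝ)) ^ n = (1 / (k : ℝ)) ^ Fintype.card ι * (1 / (k : ℝ)) ^ Fintype.card κ by
    rw [← pow_add, ← hcard], Nat.cast_pow]
  have : (1 / (k : ℝ)) ^ Fintype.card κ * (k : ℝ) ^ Fintype.card κ = 1 := by
    rw [← mul_pow, one_div_mul_cancel hk, one_pow]
  linear_combination ((1 / (k : ℝ)) ^ Fintype.card ι * ∑ τ : ι → Fin k, g τ) * this

end Expectation

/-! ### The graph traced out by closed walks -/

section ClosedWalks

variable {V ι : Type*}

/-- The graph whose edges are `w i — w (nx i)`. -/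
def walkGraph (nx : Equiv.Perm ι) (w : ι → V) : SimpleGraph V :=
  SimpleGraph.fromRel fun u v => ∃ i, u = w i ∧ v = w (nx i)

/-- The cyclic sequences with successor function `nx` are loopless and nonbacktracking. -/
def IsNonbacktracking (nx : Equiv.Perm ι) (w : ι → V) : Prop :=
  ∀ i, w i ≠ w (nx i) ∧ w i ≠ w (nx (nx i))

variable {nx : Equiv.Perm ι} {w : ι → V}

theorem walkGraph_le_iff (hw : ∀ i, w i ≠ w (nx i)) (G : SimpleGraph V) :
    walkGraph nx w ≤ G ↔ ∀ i, G.Adj (w i) (w (nx i)) := by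
  constructor
  · exact fun h i => h ((SimpleGraph.fromRel_adj _ _ _).2 ⟨hw i, Or.inl ⟨i, rfl, rfl⟩⟩)
  · intro h u v huv
    obtain ⟨_, ⟨i, rfl, rfl⟩ | ⟨i, rfl, rfl⟩⟩ := (SimpleGraph.fromRel_adj _ _ _).1 huv
    · exact h i
    · exact (h i).symm

theorem walkGraph_adj (hw : ∀ i, w i ≠ w (nx i)) (i : ι) :
    (walkGraph nx w).Adj (w i) (w (nx i)) :=
  (walkGraph_le_iff hw _).1 le_rfl i

theorem walkGraph_adj_symm (hw : ∀ i, w i ≠ w (nx i)) (i : ι) :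
    (walkGraph nx w).Adj (w i) (w (nx.symm i)) := by
  have := (walkGraph_adj hw (nx.symm i)).symm
  rwa [Equiv.apply_symm_apply] at this

variable [Fintype V]

/-- The predecessor and the successor of `w i` are neighbours of it, and they differ because the
walk does not backtrack. Since `nx` may have several orbits, this applies to pairs of closed walks
as well. -/
theorem IsNonbacktracking.two_le_degree (hw : IsNonbacktracking nx w) (i : ι) :
    2 ≤ (walkGraph nx w).degree (w i) := by
  have h1 : ∀ i, w i ≠ w (nx i) := fun i => (hw i).1
  have hne : w (nx i) ≠ w (nx.symm i) := by
    have := (hw (nx.symm i)).2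
    rw [Equiv.apply_symm_apply] at this
    exact this.symm
  rw [← SimpleGraph.card_neighborFinset_eq_degree, ← Finset.card_pair hne]
  refine Finset.card_le_card fun v hv => ?_
  rw [SimpleGraph.mem_neighborFinset]
  rcases Finset.mem_insert.1 hv with rfl | hv
  · exact walkGraph_adj h1 i
  · rw [Finset.mem_singleton.1 hv]
    exact walkGraph_adj_symm h1 i

variable [DecidableEq V] [Fintype ι]

theorem edgeFinset_walkGraph (hw : ∀ i, w i ≠ w (nx i)) :
    (walkGraph nx w).edgeFinset = Finset.univ.image fun i => s(w i, w (nx i)) := by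
  ext e
  induction e with | _ u v
  simp only [SimpleGraph.mem_edgeFinset, SimpleGraph.mem_edgeSet, Finset.mem_image,
    Finset.mem_univ, true_and, Sym2.eq_iff]
  constructor
  · intro h
    obtain ⟨_, ⟨i, rfl, rfl⟩ | ⟨i, rfl, rfl⟩⟩ := (SimpleGraph.fromRel_adj _ _ _).1 h
    · exact ⟨i, Or.inl ⟨rfl, rfl⟩⟩
    · exact ⟨i, Or.inr ⟨rfl, rfl⟩⟩
  · rintro ⟨i, ⟨rfl, rfl⟩ | ⟨rfl, rfl⟩⟩
    · exact walkGraph_adj hw i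
    · exact (walkGraph_adj hw i).symm

theorem card_edgeFinset_walkGraph_le (hw : ∀ i, w i ≠ w (nx i)) :
    (walkGraph nx w).edgeFinset.card ≤ Fintype.card ι := by
  rw [edgeFinset_walkGraph hw]
  exact Finset.card_image_le

theorem degree_walkGraph_eq_zero {v : V} (hv : v ∉ Finset.univ.image w) :
    (walkGraph nx w).degree v = 0 := by
  rw [← SimpleGraph.card_neighborFinset_eq_degree, Finset.card_eq_zero,
    Finset.eq_empty_iff_forall_notMem]
  intro u hu
  rw [SimpleGraph.mem_neighborFinset] at hu
  obtain ⟨_, ⟨i, rfl, _⟩ | ⟨i, _, rfl⟩⟩ := (SimpleGraph.fromRel_adj _ _ _).1 hu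
  · exact hv (by simp)
  · exact hv (by simp)

theorem sum_degree_walkGraph (nx : Equiv.Perm ι) (w : ι → V) :
    ∑ v ∈ Finset.univ.image w, (walkGraph nx w).degree v =
      2 * (walkGraph nx w).edgeFinset.card := by
  rw [← SimpleGraph.sum_degrees_eq_twice_card_edges]
  refine Finset.sum_subset (Finset.subset_univ _) fun v _ hv => degree_walkGraph_eq_zero hv

/-- If a union of closed nonbacktracking walks has no more edges than vertices, then all degrees
are at most two. -/
theorem IsNonbacktracking.degree_le_two (hw : IsNonbacktracking nx w)
    (h : (walkGraph nx w).edgeFinset.card ≤ (Finset.univ.image w).card) (v : V) :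
    (walkGraph nx w).degree v ≤ 2 := by
  by_contra! hv
  have hmem : v ∈ Finset.univ.image w := by
    by_contra hv'
    rw [degree_walkGraph_eq_zero hv'] at hv
    omega
  -- The degrees of the visited vertices are at least two and add up to twice the number of edges,
  -- hence to at most twice the number of vertices. There is no room for a degree above two.
  have hlt : ∑ _v ∈ Finset.univ.image w, 2 < ∑ v ∈ Finset.univ.image w,
      (walkGraph nx w).degree v := by
    refine Finset.sum_lt_sum (fun u hu => ?_) ⟨v, hmem, hv⟩
    obtain ⟨i, _, rfl⟩ := Finset.mem_image.1 hu
    exact hw.two_le_degree i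
  rw [sum_degree_walkGraph, Finset.sum_const, smul_eq_mul] at hlt
  omega

/-- In a graph of maximal degree two a nonbacktracking walk is determined by its first step. -/
theorem eq_of_degree_le_two {H : SimpleGraph V} (hH : ∀ v, H.degree v ≤ 2) {x y : ℕ → V}
    (hx : ∀ t, H.Adj (x t) (x (t + 1))) (hx' : ∀ t, x t ≠ x (t + 2))
    (hy : ∀ t, H.Adj (y t) (y (t + 1))) (hy' : ∀ t, y t ≠ y (t + 2))
    (h0 : x 0 = y 0) (h1 : x 1 = y 1) (t : ℕ) : x t = y t ∧ x (t + 1) = y (t + 1) := by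
  induction t with
  | zero => exact ⟨h0, h1⟩
  | succ t ih =>
    refine ⟨ih.2, ?_⟩
    by_contra hne
    -- If the walks parted here, `x (t + 1)` would have three different neighbours.
    have hsub : ({x t, x (t + 2), y (t + 2)} : Finset V) ⊆ H.neighborFinset (x (t + 1)) := by
      intro v hv
      rw [SimpleGraph.mem_neighborFinset]
      simp only [Finset.mem_insert, Finset.mem_singleton] at hv
      rcases hv with rfl | rfl | rfl
      · exact (hx t).symm
      · exact hx (t + 1)
      · rw [ih.2]
        exact hy (t + 1)
    have hcard := Finset.card_le_card hsub
    rw [SimpleGraph.card_neighborFinset_eq_degree, Finset.card_eq_three.2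
      ⟨_, _, _, hx' t, by rw [ih.1]; exact hy' t, hne, rfl⟩] at hcard
    have := hH (x (t + 1))
    omega

/-- In a graph of maximal degree two every neighbour of a vertex of a closed nonbacktracking walk
is its predecessor or its successor. -/
theorem eq_or_eq_of_degree_le_two {H : SimpleGraph V} (hH : ∀ v, H.degree v ≤ 2) {u v₁ v₂ v : V}
    (h1 : H.Adj u v₁) (h2 : H.Adj u v₂) (hne : v₁ ≠ v₂) (hv : H.Adj u v) : v = v₁ ∨ v = v₂ := by
  by_contra! h
  have hsub : ({v, v₁, v₂} : Finset V) ⊆ H.neighborFinset u := by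
    intro x hx
    rw [SimpleGraph.mem_neighborFinset]
    simp only [Finset.mem_insert, Finset.mem_singleton] at hx
    rcases hx with rfl | rfl | rfl <;> assumption
  have hcard := Finset.card_le_card hsub
  rw [SimpleGraph.card_neighborFinset_eq_degree, Finset.card_eq_three.2
    ⟨_, _, _, h.1, h.2, hne, rfl⟩] at hcard
  have := hH u
  omega

end ClosedWalks

/-! ### Cyclic sequences -/

section Cyclic

/-- The successor permutation of `ZMod m`. -/
def cyc (m : ℕ) : Equiv.Perm (ZMod m) := Equiv.addRight 1

@[simp] theorem cyc_apply {m : ℕ} (i : ZMod m) : cyc m i = i + 1 := rfl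

variable {V : Type*} [Fintype V] {m : ℕ} [NeZero m]

/-- Two closed nonbacktracking walks in a graph of maximal degree two that meet agree up to
rotation and reflection. -/
theorem eq_shift_or_eq_reflect {H : SimpleGraph V} (hH : ∀ v, H.degree v ≤ 2) {x y : ZMod m → V}
    (hx : ∀ i, H.Adj (x i) (x (i + 1))) (hx' : ∀ i, x i ≠ x (i + 1 + 1))
    (hy : ∀ i, H.Adj (y i) (y (i + 1))) (hy' : ∀ i, y i ≠ y (i + 1 + 1))
    {i j : ZMod m} (hij : x i = y j) :
    (∀ t, y (j + t) = x (i + t)) ∨ (∀ t, y (j + t) = x (i - t)) := by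
  have hcast : ∀ t : ZMod m, ((t.val : ℕ) : ZMod m) = t := ZMod.natCast_zmod_val
  -- From the common vertex `y` moves to the successor or to the predecessor in `x`. This choice
  -- fixes the direction, and `eq_of_degree_le_two` does the rest.
  have h1 : y (j + 1) = x (i + 1) ∨ y (j + 1) = x (i - 1) := by
    have hb := hx (i - 1)
    have hc := hx' (i - 1)
    rw [sub_add_cancel] at hb hc
    exact eq_or_eq_of_degree_le_two hH (hx i) hb.symm hc.symm (hij ▸ hy j)
  rcases h1 with h1 | h1
  · left
    intro t
    have := (eq_of_degree_le_two hH (x := fun t : ℕ => y (j + t)) (y := fun t : ℕ => x (i + t))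
      (fun t => by simpa [add_assoc] using hy (j + t))
      (fun t => by
        have := hy' (j + t)
        rw [add_assoc, add_assoc, one_add_one_eq_two] at this
        simpa using this)
      (fun t => by simpa [add_assoc] using hx (i + t))
      (fun t => by
        have := hx' (i + t)
        rw [add_assoc, add_assoc, one_add_one_eq_two] at this
        simpa using this)
      (by simpa using hij.symm) (by simpa using h1) t.val).1
    simpa [hcast] using this
  · right
    intro t
    have := (eq_of_degree_le_two hH (x := fun t : ℕ => y (j + t)) (y := fun t : ℕ => x (i - t))
      (fun t => by simpa [add_assoc] using hy (j + t))
      (fun t => by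
        have := hy' (j + t)
        rw [add_assoc, add_assoc, one_add_one_eq_two] at this
        simpa using this)
      (fun t => by
        have := (hx (i - (t + 1))).symm
        rw [show i - ((t : ZMod m) + 1) + 1 = i - t by ring] at this
        simpa using this)
      (fun t => by
        have := (hx' (i - (t + 2))).symm
        rw [show i - ((t : ZMod m) + 2) + 1 + 1 = i - t by ring] at this
        simpa using this)
      (by simpa using hij.symm) (by simpa using h1) t.val).1
    simpa [hcast] using this

/-- A closed nonbacktracking walk in a graph of maximal degree two that visits a vertex twice is
periodic. -/
theorem periodic_of_eq {H : SimpleGraph V} (hH : ∀ v, H.degree v ≤ 2) {x : ZMod m → V}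
    (hx : ∀ i, H.Adj (x i) (x (i + 1))) (hx' : ∀ i, x i ≠ x (i + 1 + 1))
    {i j : ZMod m} (hij : x i = x j) (t : ZMod m) : x (t + (j - i)) = x t := by
  rcases eq_shift_or_eq_reflect hH hx hx' hx hx' hij with h | h
  · have := h (t - i)
    rw [add_sub_cancel] at this
    rw [← this]
    congr 1
    ring
  · exfalso
    have h' : ∀ t, x t = x (i + j - t) := fun t => by
      have := h (t - j)
      rw [add_sub_cancel] at this
      rw [this]
      congr 1
      ring
    obtain ⟨c, hc⟩ : ∃ c : ℕ, (c : ZMod m) = i + j :=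
      ⟨(i + j).val, ZMod.natCast_zmod_val _⟩
    rcases Nat.even_or_odd' c with ⟨r, hr | hr⟩
    · have := h' ((r : ZMod m) - 1)
      rw [← hc, hr] at this
      apply hx' ((r : ZMod m) - 1)
      rw [this]
      congr 1
      push_cast
      ring
    · have := h' (r : ZMod m)
      rw [← hc, hr] at this
      apply (hx (r : ZMod m)).ne
      rw [this]
      congr 1
      push_cast
      ring

end Cyclic

/-! ### Counting sequences by the size of their image -/

section Counting

variable {ι : Type*} [Fintype ι] [DecidableEq ι]

theorem card_fun_le_of_rep {n : ℕ} (g : ι → ι) (S : Finset (ι → Fin n))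
    (hS : ∀ w ∈ S, ∀ i, w (g i) = w i) : S.card ≤ n ^ (Finset.univ.image g).card := by
  have h := Finset.card_le_card_of_injOn (s := S)
    (t := (Finset.univ : Finset (↥(Finset.univ.image g) → Fin n)))
    (fun w j => w j) (fun _ _ => Finset.mem_coe.2 (Finset.mem_univ _)) ?_
  · rwa [Finset.card_univ, Fintype.card_fun, Fintype.card_fin, Fintype.card_coe] at h
  · intro w hw w' hw' he
    funext i
    rw [← hS w hw, ← hS w' hw']
    exact congrFun he ⟨g i, Finset.mem_image_of_mem g (Finset.mem_univ i)⟩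

theorem exists_rep [Nonempty ι] {V : Type*} [DecidableEq V] (w : ι → V) : ∃ g : ι → ι, (∀ i, w (g i) = w i) ∧
    (Finset.univ.image g).card = (Finset.univ.image w).card := by
  have hex : ∀ v ∈ Set.range w, ∃ j, w j = v := fun v hv => hv
  choose! r hr using hex
  have hg : ∀ i, w (r (w i)) = w i := fun i => hr _ ⟨i, rfl⟩
  refine ⟨fun i => r (w i), hg, ?_⟩
  have h1 : (Finset.univ.image w) = (Finset.univ.image fun i => r (w i)).image w := by
    rw [Finset.image_image]
    refine Finset.image_congr fun i _ => (hg i).symm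
  rw [h1]
  refine (Finset.card_image_of_injOn ?_).symm
  intro x hx y hy hxy
  simp only [Finset.coe_image, Finset.coe_univ, Set.image_univ, Set.mem_range] at hx hy
  obtain ⟨i, rfl⟩ := hx
  obtain ⟨j, rfl⟩ := hy
  rw [hg, hg] at hxy
  rw [hxy]

/-- Sort the sequences by the map `g` that sends each index to a chosen index with the same value.
If `g` has q values, at most n^q sequences belong to it, each of weight n^(-q). So every `g`
contributes at most 1, and the right-hand side is the number of maps `ι → ι`. -/
theorem sum_inv_pow_card_image_le {n : ℕ} (hn : n ≠ 0) :
    ∑ w : ι → Fin n, (1 / (n : ℝ)) ^ (Finset.univ.image w).card ≤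
      (Fintype.card ι : ℝ) ^ Fintype.card ι := by
  rcases isEmpty_or_nonempty ι with h | h
  · simp
  choose g hg hcard using fun w : ι → Fin n => exists_rep w
  have hn' : (n : ℝ) ≠ 0 := by exact_mod_cast hn
  rw [← Finset.sum_fiberwise_of_maps_to (t := (Finset.univ : Finset (ι → ι)))
    (g := g) (fun _ _ => Finset.mem_univ _)]
  calc _ ≤ ∑ _h : ι → ι, (1 : ℝ) := by
        refine Finset.sum_le_sum fun h _ => ?_
        have h1 : ∀ w ∈ Finset.univ.filter fun w => g w = h,
            (1 / (n : ℝ)) ^ (Finset.univ.image w).card =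
              (1 / (n : ℝ)) ^ (Finset.univ.image h).card := by
          intro w hw
          rw [← hcard w, (Finset.mem_filter.1 hw).2]
        rw [Finset.sum_congr rfl h1, Finset.sum_const, nsmul_eq_mul]
        have h2 := card_fun_le_of_rep h (Finset.univ.filter fun w : ι → Fin n => g w = h) (by
          intro w hw i
          rw [← (Finset.mem_filter.1 hw).2]
          exact hg w i)
        calc _ ≤ ((n ^ (Finset.univ.image h).card : ℕ) : ℝ) *
              (1 / (n : ℝ)) ^ (Finset.univ.image h).card := by gcongr
          _ = 1 := by
              rw [Nat.cast_pow, ← mul_pow, mul_one_div_cancel hn', one_pow]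
    _ = _ := by simp

end Counting

/-! ### Cyclic products and traces -/

section Trace

variable {α R : Type*} [Fintype α] [DecidableEq α] [CommSemiring R]

/-- `Fin.cons x w` lists the sources and `Fin.snoc w y` the targets of the successive steps of a
path. -/
theorem sum_path_prod (K : Matrix α α R) (t : ℕ) (x y : α) :
    ∑ w : Fin t → α, ∏ i : Fin (t + 1), K ((Fin.cons x w : Fin (t + 1) → α) i)
      ((Fin.snoc w y : Fin (t + 1) → α) i) = (K ^ (t + 1)) x y := by
  induction t generalizing x with
  | zero => simp [Fin.snoc]
  | succ t ih =>
    rw [← (Fin.consEquiv fun _ : Fin (t + 1) => α).sum_comp, Fintype.sum_prod_type, pow_succ',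
      Matrix.mul_apply]
    refine Finset.sum_congr rfl fun z _ => ?_
    rw [← ih z, Finset.mul_sum]
    refine Finset.sum_congr rfl fun w _ => ?_
    rw [Fin.prod_univ_succ]
    simp only [Fin.consEquiv, Equiv.coe_fn_mk, Fin.cons_zero, Fin.cons_succ]
    rw [← Fin.cons_snoc_eq_snoc_cons]
    simp

theorem sum_cyclic_prod_fin (K : Matrix α α R) (t : ℕ) :
    ∑ w : Fin (t + 1) → α, ∏ i, K (w i) (w (i + 1)) = (K ^ (t + 1)).trace := by
  rw [← (Fin.consEquiv fun _ : Fin (t + 1) => α).sum_comp, Fintype.sum_prod_type, Matrix.trace]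
  refine Finset.sum_congr rfl fun x _ => ?_
  rw [Matrix.diag_apply, ← sum_path_prod]
  refine Finset.sum_congr rfl fun w _ => Finset.prod_congr rfl fun i _ => ?_
  simp only [Fin.consEquiv, Equiv.coe_fn_mk]
  congr 1
  induction i using Fin.lastCases with
  | last => simp
  | cast i => simp

theorem sum_cyclic_prod (K : Matrix α α R) (m : ℕ) [NeZero m] :
    ∑ w : ZMod m → α, ∏ i, K (w i) (w (i + 1)) = (K ^ m).trace := by
  -- `ZMod (t + 1)` is `Fin (t + 1)` by definition.
  obtain ⟨t, rfl⟩ := Nat.exists_eq_succ_of_ne_zero (NeZero.ne m)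
  exact sum_cyclic_prod_fin K t

/-- The matrix of relative connection probabilities of the communities. -/
def commMatrix (k : ℕ) (a b : ℝ) : Matrix (Fin k) (Fin k) ℝ := fun x y => if x = y then a else b

/-- The matrix is (a - b) I + b J with J the all-ones matrix. Its eigenvalue is a + (k - 1) b on
constant vectors and a - b on their orthogonal complement. -/
theorem commMatrix_pow_apply {k : ℕ} [NeZero k] (a b : ℝ) (m : ℕ) (x y : Fin k) :
    (commMatrix k a b ^ m) x y = (if x = y then (a - b) ^ m else 0) +
      ((a + (k - 1) * b) ^ m - (a - b) ^ m) / k := by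
  have hk : (k : ℝ) ≠ 0 := by exact_mod_cast NeZero.ne k
  induction m generalizing y with
  | zero => simp [Matrix.one_apply]
  | succ m ih =>
    rw [pow_succ, Matrix.mul_apply]
    have h1 : ∀ z, commMatrix k a b z y = (if z = y then a - b else 0) + b := fun z => by
      rw [commMatrix]; split_ifs <;> ring
    simp only [ih, h1, add_mul, mul_add, Finset.sum_add_distrib, ite_mul, zero_mul, mul_ite,
      mul_zero, Finset.sum_ite_eq, Finset.sum_ite_eq', Finset.mem_univ, if_true, Finset.sum_const,
      Finset.card_univ, Fintype.card_fin, nsmul_eq_mul]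
    split_ifs with h
    · field_simp
      ring
    · field_simp
      ring

theorem trace_commMatrix_pow {k : ℕ} [NeZero k] (a b : ℝ) (m : ℕ) :
    (commMatrix k a b ^ m).trace = (a + (k - 1) * b) ^ m + (k - 1) * (a - b) ^ m := by
  have hk : (k : ℝ) ≠ 0 := by exact_mod_cast NeZero.ne k
  simp only [Matrix.trace, Matrix.diag_apply, commMatrix_pow_apply, if_true, Finset.sum_const,
    Finset.card_univ, Fintype.card_fin, nsmul_eq_mul]
  field_simp
  ring

end Trace

/-! ### The number of closed nonbacktracking walks -/

section ClosedCount

variable {n : ℕ}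

/-- `w` is a closed nonbacktracking walk in `G`. -/
def IsClosedWalk (G : SimpleGraph (Fin n)) {m : ℕ} (w : ZMod m → Fin n) : Prop :=
  ∀ i, G.Adj (w i) (w (i + 1)) ∧ w i ≠ w (i + 1 + 1)

theorem closedNonbacktrackingCount_eq (G : SimpleGraph (Fin n)) (m : ℕ) [NeZero m] :
    closedNonbacktrackingCount G m =
      (Finset.univ.filter fun w : ZMod m → Fin n => IsClosedWalk G w).card := by
  obtain ⟨t, rfl⟩ := Nat.exists_eq_succ_of_ne_zero (NeZero.ne m)
  rw [closedNonbacktrackingCount, ← Fintype.card_subtype, ← Nat.card_eq_fintype_card]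
  refine Nat.card_congr (Equiv.subtypeEquivRight fun w => forall_congr' fun i => ?_)
  simp only [finRotate_apply]
  rfl

/-- The nonbacktracking matrix, indexed by pairs of vertices. -/
def nbMatrix (G : SimpleGraph (Fin n)) : Matrix (Fin n × Fin n) (Fin n × Fin n) ℕ :=
  fun e f => if e.2 = f.1 ∧ G.Adj f.1 f.2 ∧ e.1 ≠ f.2 then 1 else 0

/-- `nbMatrix` requires only the second pair to be an edge. Around a cyclic sequence every pair is
the second one once, so nothing is lost. -/
theorem closedNonbacktrackingCount_eq_trace (G : SimpleGraph (Fin n)) (m : ℕ) [NeZero m] :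
    closedNonbacktrackingCount G m = (nbMatrix G ^ m).trace := by
  rw [closedNonbacktrackingCount_eq, ← sum_cyclic_prod (nbMatrix G) m]
  simp only [nbMatrix, Finset.prod_boole, Finset.mem_univ, true_imp_iff]
  rw [Finset.sum_boole, Nat.cast_id]
  refine Finset.card_bij (fun w _ i => (w i, w (i + 1))) ?_ ?_ ?_
  · intro w hw
    rw [Finset.mem_filter] at hw ⊢
    exact ⟨Finset.mem_univ _, fun i => ⟨rfl, (hw.2 (i + 1)).1, (hw.2 i).2⟩⟩
  · intro w _ w' _ h
    funext i
    exact congrArg Prod.fst (congrFun h i)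
  · intro e he
    have he := (Finset.mem_filter.1 he).2
    refine ⟨fun i => (e i).1, ?_, ?_⟩
    · refine Finset.mem_filter.2 ⟨Finset.mem_univ _, fun i => ⟨?_, ?_⟩⟩
      · have h1 := (he (i - 1)).2.1
        have h2 := (he i).1
        rw [sub_add_cancel] at h1
        rwa [h2] at h1
      · have h1 := (he i).2.2
        have h2 := (he (i + 1)).1
        rwa [h2] at h1
    · funext i
      exact Prod.ext rfl (he i).1.symm

end ClosedCount

/-! ### Moments of the number of cycles -/

section Moments

variable {n k : ℕ}

/-- The indicator of the event that the walks `w` are contained in the graph. -/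
def walkInd {ι : Type*} (nx : Equiv.Perm ι) (w : ι → Fin n) (G : SimpleGraph (Fin n)) : ℝ :=
  if walkGraph nx w ≤ G then 1 else 0

theorem walkInd_nonneg {ι : Type*} (nx : Equiv.Perm ι) (w : ι → Fin n)
    (G : SimpleGraph (Fin n)) : 0 ≤ walkInd nx w G := by
  rw [walkInd]; split_ifs <;> norm_num

theorem walkInd_le_one {ι : Type*} (nx : Equiv.Perm ι) (w : ι → Fin n)
    (G : SimpleGraph (Fin n)) : walkInd nx w G ≤ 1 := by
  rw [walkInd]; split_ifs <;> norm_num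

/-- The loopless sequences that trace out more edges than vertices. -/
def excessWalks {ι : Type*} [Fintype ι] [DecidableEq ι] (nx : Equiv.Perm ι) (n : ℕ) : Finset (ι → Fin n) :=
  Finset.univ.filter fun w => (∀ i, w i ≠ w (nx i)) ∧
    (Finset.univ.image w).card + 1 ≤ (walkGraph nx w).edgeFinset.card

/-- With v vertices and e edges, where v + 1 ≤ e ≤ |ι|, the probability is at most (C / n)^e ≤ C^|ι|
n^(-1) n^(-v). The sum of n^(-v) over all sequences is bounded by `sum_inv_pow_card_image_le`. -/
theorem expect_sum_excessWalks_le [NeZero k] {ι : Type*} [Fintype ι] [DecidableEq ι] (nx : Equiv.Perm ι)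
    {a b C : ℝ} (ha : a ≤ C) (hb : b ≤ C) (hC : 1 ≤ C) (hn : n ≠ 0) :
    expect n k a b (fun x => ∑ w ∈ excessWalks nx n, walkInd nx w x.2) ≤
      (C * Fintype.card ι) ^ Fintype.card ι / n := by
  have hn1 : (1 : ℝ) ≤ n := by exact_mod_cast Nat.one_le_iff_ne_zero.2 hn
  rw [expect_sum]
  calc _ ≤ ∑ w ∈ excessWalks nx n,
        C ^ Fintype.card ι * (1 / (n : ℝ)) * (1 / (n : ℝ)) ^ (Finset.univ.image w).card := by
        refine Finset.sum_le_sum fun w hw => ?_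
        obtain ⟨_, h1, h2⟩ := Finset.mem_filter.1 hw
        refine (expect_le_graph_le ha hb (by linarith) _).trans ?_
        rw [edgeCount, div_eq_mul_one_div, mul_pow, mul_assoc, ← pow_succ']
        have h3 := card_edgeFinset_walkGraph_le h1
        have h4 : (1 : ℝ) / n ≤ 1 := (div_le_one (by linarith)).2 hn1
        exact mul_le_mul (pow_le_pow_right₀ hC h3)
          (pow_le_pow_of_le_one (by positivity) h4 h2) (by positivity) (by positivity)
    _ ≤ ∑ w : ι → Fin n,
        C ^ Fintype.card ι * (1 / (n : ℝ)) * (1 / (n : ℝ)) ^ (Finset.univ.image w).card :=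
        Finset.sum_le_sum_of_subset_of_nonneg (Finset.subset_univ _)
          fun _ _ _ => by positivity
    _ ≤ C ^ Fintype.card ι * (1 / (n : ℝ)) * (Fintype.card ι : ℝ) ^ Fintype.card ι := by
        rw [← Finset.mul_sum]
        exact mul_le_mul_of_nonneg_left (sum_inv_pow_card_image_le hn) (by positivity)
    _ = _ := by rw [mul_pow]; ring

theorem edgeProb_eq {a b C : ℝ} (ha0 : 0 ≤ a) (hb0 : 0 ≤ b) (ha : a ≤ C) (hb : b ≤ C)
    (hn : C ≤ n) (σ : Fin n → Fin k) (u v : Fin n) :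
    edgeProb a b σ u v = commMatrix k a b (σ u) (σ v) / n := by
  have h0 : 0 ≤ commMatrix k a b (σ u) (σ v) := by
    rw [commMatrix]; split_ifs <;> assumption
  have h1 : commMatrix k a b (σ u) (σ v) ≤ n := by
    rw [commMatrix]; split_ifs <;> linarith
  rw [edgeProb]
  change max 0 (min 1 (commMatrix k a b (σ u) (σ v) / n)) = _
  rw [min_eq_right (div_le_one_of_le₀ h1 (h0.trans h1)), max_eq_right]
  exact div_nonneg h0 (h0.trans h1)

/-- The probability that given vertex-disjoint cycles are contained in the graph. -/
theorem expect_walkInd_of_injective [NeZero k] {ι : Type*} [Fintype ι] [DecidableEq ι] {nx : Equiv.Perm ι}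
    (h1 : ∀ i, nx i ≠ i) (h2 : ∀ i, nx (nx i) ≠ i) {a b C : ℝ} (ha0 : 0 ≤ a) (hb0 : 0 ≤ b)
    (ha : a ≤ C) (hb : b ≤ C) (hn : C ≤ n) {w : ι → Fin n} (hw : Function.Injective w) :
    expect n k a b (fun x => walkInd nx w x.2) = (1 / (k : ℝ)) ^ Fintype.card ι *
      ∑ τ : ι → Fin k, ∏ i, (commMatrix k a b (τ i) (τ (nx i)) / n) := by
  -- The steps use different edges, because the same edge in opposite directions would mean `nx (nx
  -- j) = j`. So the product over edges is a product over indices.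
  have hinj : Function.Injective fun i => s(w i, w (nx i)) := by
    intro i j hij
    rcases Sym2.eq_iff.1 hij with ⟨h, _⟩ | ⟨h, h'⟩
    · exact hw h
    · exact absurd (by rw [← hw h]; exact hw h') (h2 j)
  rw [← uniform_sum_comp hw]
  simp only [walkInd]
  rw [expect_le_graph]
  congr 1
  refine Finset.sum_congr rfl fun σ _ => ?_
  rw [edgeFinset_walkGraph fun i h => h1 i (hw h).symm, Finset.prod_image hinj.injOn]
  refine Finset.prod_congr rfl fun i _ => ?_
  simp [symEdgeProb, edgeProb_eq ha0 hb0 ha hb hn]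

/-- The expected number of closed walks of length `m`, in the limit. -/
def meanCycles (k : ℕ) (a b : ℝ) (m : ℕ) : ℝ := (1 / (k : ℝ)) ^ m * (commMatrix k a b ^ m).trace

theorem meanCycles_eq_sum (a b : ℝ) (m : ℕ) [NeZero m] :
    (1 / (k : ℝ)) ^ m * ∑ τ : ZMod m → Fin k, ∏ i, (commMatrix k a b (τ i) (τ (i + 1)) / n) =
      meanCycles k a b m / (n : ℝ) ^ m := by
  have h : ∀ τ : ZMod m → Fin k, ∏ i, (commMatrix k a b (τ i) (τ (i + 1)) / n) =
      (∏ i, commMatrix k a b (τ i) (τ (i + 1))) / (n : ℝ) ^ m := fun τ => by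
    rw [Finset.prod_div_distrib, Finset.prod_const, Finset.card_univ, ZMod.card]
  simp only [h]
  rw [← Finset.sum_div, sum_cyclic_prod, meanCycles, mul_div_assoc]

theorem meanCycles_nonneg {a b : ℝ} (ha0 : 0 ≤ a) (hb0 : 0 ≤ b) (m : ℕ) [NeZero m] :
    0 ≤ meanCycles k a b m := by
  rw [meanCycles, ← sum_cyclic_prod]
  refine mul_nonneg (by positivity) (Finset.sum_nonneg fun τ _ => Finset.prod_nonneg fun i _ => ?_)
  rw [commMatrix]; split_ifs <;> assumption

theorem ZMod_add_one_ne {m : ℕ} (hm : 3 ≤ m) (i : ZMod m) : i + 1 ≠ i := by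
  have : Fact (1 < m) := ⟨by omega⟩
  simp

theorem ZMod_add_two_ne {m : ℕ} (hm : 3 ≤ m) (i : ZMod m) : i + 1 + 1 ≠ i := by
  rw [add_assoc, one_add_one_eq_two]
  intro h
  have h2 : ((2 : ℕ) : ZMod m) = 0 := by simpa using h
  rw [ZMod.natCast_eq_zero_iff] at h2
  exact absurd (Nat.le_of_dvd (by norm_num) h2) (by omega)

theorem isNonbacktracking_of_injective {m : ℕ} (hm : 3 ≤ m) {w : ZMod m → Fin n}
    (hw : Function.Injective w) : IsNonbacktracking (cyc m) w :=
  fun i => ⟨fun h => ZMod_add_one_ne hm i (hw h).symm, fun h => ZMod_add_two_ne hm i (hw h).symm⟩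

/-- The cyclic sequences of `m` distinct vertices. -/
def injWalks (n m : ℕ) [NeZero m] : Finset (ZMod m → Fin n) :=
  Finset.univ.filter Function.Injective

theorem card_injWalks (n m : ℕ) [NeZero m] : (injWalks n m).card = n.descFactorial m := by
  rw [injWalks, ← Fintype.card_subtype,
    ← Fintype.card_congr (Equiv.subtypeInjectiveEquivEmbedding (ZMod m) (Fin n)).symm,
    Fintype.card_embedding_eq, ZMod.card, Fintype.card_fin]

theorem card_injWalks_le (n m : ℕ) [NeZero m] : ((injWalks n m).card : ℝ) ≤ (n : ℝ) ^ m := by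
  rw [card_injWalks]
  exact_mod_cast Nat.descFactorial_le_pow n m

/-- For m ≤ n, the falling factorial is at least (n - m)^m and Bernoulli's inequality applies. For m
> n the left-hand side is not positive. -/
theorem le_card_injWalks (hn : n ≠ 0) (m : ℕ) [NeZero m] :
    (n : ℝ) ^ m * (1 - (m : ℝ) ^ 2 / n) ≤ (injWalks n m).card := by
  have hn0 : (0 : ℝ) < n := by exact_mod_cast Nat.pos_of_ne_zero hn
  rw [card_injWalks]
  rcases le_or_gt m n with h | h
  · have h1 : ((n + 1 - m : ℕ) : ℝ) ^ m ≤ (n.descFactorial m : ℝ) := by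
      exact_mod_cast Nat.pow_sub_le_descFactorial n m
    refine le_trans ?_ h1
    have hle : (m : ℝ) / n ≤ 1 := (div_le_one hn0).2 (by exact_mod_cast h)
    have h2 := one_add_mul_le_pow (a := -((m : ℝ) / n)) (by linarith) m
    calc (n : ℝ) ^ m * (1 - (m : ℝ) ^ 2 / n) = (n : ℝ) ^ m * (1 + m * -((m : ℝ) / n)) := by ring
      _ ≤ (n : ℝ) ^ m * (1 + -((m : ℝ) / n)) ^ m := by gcongr
      _ = (n - m : ℝ) ^ m := by
          rw [← mul_pow]
          congr 1
          field_simp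
          ring
      _ ≤ ((n + 1 - m : ℕ) : ℝ) ^ m := by
          have : (m : ℝ) ≤ n := by exact_mod_cast h
          refine pow_le_pow_left₀ (by linarith) ?_ m
          rw [Nat.cast_sub (by omega)]
          push_cast
          linarith
  · refine le_trans ?_ (Nat.cast_nonneg _)
    refine mul_nonpos_of_nonneg_of_nonpos (by positivity) ?_
    rw [sub_nonpos, le_div_iff₀ hn0]
    have h1 : (n : ℝ) < m := by exact_mod_cast h
    have h2 : (1 : ℝ) ≤ m := by exact_mod_cast NeZero.one_le
    nlinarith

/-- The number of cycles of length `m`, with a marked starting point and direction. -/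
def cycleCount (m : ℕ) [NeZero m] (G : SimpleGraph (Fin n)) : ℝ :=
  ∑ w ∈ injWalks n m, walkInd (cyc m) w G

section

variable [NeZero k] {m : ℕ} [NeZero m] (hm : 3 ≤ m) {a b C : ℝ} (ha0 : 0 ≤ a) (hb0 : 0 ≤ b)
  (ha : a ≤ C) (hb : b ≤ C) (hC : 1 ≤ C) (hn : C ≤ n)

include hm ha0 hb0 ha hb hn

theorem expect_walkInd_cyc {w : ZMod m → Fin n} (hw : Function.Injective w) :
    expect n k a b (fun x => walkInd (cyc m) w x.2) = meanCycles k a b m / (n : ℝ) ^ m := by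
  rw [expect_walkInd_of_injective (ZMod_add_one_ne hm) (ZMod_add_two_ne hm) ha0 hb0 ha hb hn hw,
    ZMod.card]
  exact meanCycles_eq_sum a b m

theorem expect_cycleCount : expect n k a b (fun x => cycleCount m x.2) =
    (injWalks n m).card * (meanCycles k a b m / (n : ℝ) ^ m) := by
  simp only [cycleCount]
  rw [expect_sum, Finset.sum_congr rfl fun (w : ZMod m → Fin n) (hw : w ∈ injWalks n m) =>
    expect_walkInd_cyc hm ha0 hb0 ha hb hn (Finset.mem_filter.1 hw).2, Finset.sum_const,
    nsmul_eq_mul]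

/-- Two disjoint cycles are one injective sequence for a permutation with two orbits, and the sum
over its labels factorizes. So disjoint cycles are uncorrelated. -/
theorem expect_walkInd_pair {w w' : ZMod m → Fin n}
    (hw : Function.Injective (Sum.elim w w')) :
    expect n k a b (fun x => walkInd ((cyc m).sumCongr (cyc m)) (Sum.elim w w') x.2) =
      (meanCycles k a b m / (n : ℝ) ^ m) ^ 2 := by
  rw [expect_walkInd_of_injective (C := C) ?_ ?_ ha0 hb0 ha hb hn hw]
  · rw [← (Equiv.sumArrowEquivProdArrow (ZMod m) (ZMod m) (Fin k)).symm.sum_comp]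
    simp only [Fintype.prod_sum_type, Fintype.card_sum, ZMod.card, Equiv.sumCongr_apply,
      Sum.map_inl, Sum.map_inr, cyc_apply, Equiv.sumArrowEquivProdArrow, Equiv.coe_fn_symm_mk,
      Sum.elim_inl, Sum.elim_inr]
    rw [Fintype.sum_prod_type]
    dsimp only
    rw [← Finset.sum_mul_sum, sq, ← meanCycles_eq_sum (k := k), pow_add]
    ring
  · rintro (i | i) h
    · exact ZMod_add_one_ne hm i (Sum.inl_injective h)
    · exact ZMod_add_one_ne hm i (Sum.inr_injective h)
  · rintro (i | i) h
    · exact ZMod_add_two_ne hm i (Sum.inl_injective h)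
    · exact ZMod_add_two_ne hm i (Sum.inr_injective h)

end

theorem walkInd_mul_walkInd {m : ℕ} (hm : 3 ≤ m) {w w' : ZMod m → Fin n}
    (hw : Function.Injective w) (hw' : Function.Injective w') (G : SimpleGraph (Fin n)) :
    walkInd (cyc m) w G * walkInd (cyc m) w' G =
      walkInd ((cyc m).sumCongr (cyc m)) (Sum.elim w w') G := by
  have h1 := isNonbacktracking_of_injective hm hw
  have h2 := isNonbacktracking_of_injective hm hw'
  simp only [walkInd]
  rw [walkGraph_le_iff fun i => (h1 i).1, walkGraph_le_iff fun i => (h2 i).1, walkGraph_le_iff]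
  · simp only [Sum.forall, Equiv.sumCongr_apply, Sum.map_inl, Sum.map_inr, Sum.elim_inl,
      Sum.elim_inr, ite_and, mul_ite, mul_one, mul_zero]
    split_ifs <;> rfl
  · rintro (i | i)
    · exact (h1 i).1
    · exact (h2 i).1

/-- Two cycles are disjoint, or they trace out more edges than vertices, or they agree up to
rotation and reflection. -/
theorem pair_trichotomy {m : ℕ} [NeZero m] (hm : 3 ≤ m) {w w' : ZMod m → Fin n}
    (hw : Function.Injective w) (hw' : Function.Injective w') :
    Function.Injective (Sum.elim w w') ∨
      Sum.elim w w' ∈ excessWalks ((cyc m).sumCongr (cyc m)) n ∨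
      ∃ c, (w' = fun t => w (c + t)) ∨ (w' = fun t => w (c - t)) := by
  have h1 := isNonbacktracking_of_injective hm hw
  have h2 := isNonbacktracking_of_injective hm hw'
  have hnb : IsNonbacktracking ((cyc m).sumCongr (cyc m)) (Sum.elim w w') := by
    rintro (i | i)
    · exact h1 i
    · exact h2 i
  by_cases hdisj : ∃ i j, w i = w' j
  · right
    obtain ⟨i, j, hij⟩ := hdisj
    by_cases hex : Sum.elim w w' ∈ excessWalks ((cyc m).sumCongr (cyc m)) n
    · exact Or.inl hex
    · right
      -- Without excess edges the union has maximal degree two, and two cycles that meet in such a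
      -- graph coincide.
      have hle : (walkGraph ((cyc m).sumCongr (cyc m)) (Sum.elim w w')).edgeFinset.card ≤
          (Finset.univ.image (Sum.elim w w')).card := by
        by_contra! hlt
        exact hex (Finset.mem_filter.2 ⟨Finset.mem_univ _, fun i => (hnb i).1, hlt⟩)
      have hadj := walkGraph_adj fun i => (hnb i).1
      rcases eq_shift_or_eq_reflect (hnb.degree_le_two hle) (fun i => hadj (Sum.inl i))
        (fun i => (h1 i).2) (fun i => hadj (Sum.inr i)) (fun i => (h2 i).2) hij with h | h
      · refine ⟨i - j, Or.inl (funext fun t => ?_)⟩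
        have := h (t - j)
        rw [add_sub_cancel] at this
        refine this.trans (congrArg w ?_)
        ring
      · refine ⟨i + j, Or.inr (funext fun t => ?_)⟩
        have := h (t - j)
        rw [add_sub_cancel] at this
        refine this.trans (congrArg w ?_)
        ring
  · left
    push Not at hdisj
    exact hw.sumElim hw' hdisj

theorem sum_sumElim {α β γ : Type*} [Fintype α] [Fintype β] [Fintype γ] [DecidableEq α]
    [DecidableEq β] (S : Finset (α ⊕ β → γ)) [DecidablePred (· ∈ S)]
    (f : (α ⊕ β → γ) → ℝ) :
    ∑ W ∈ S, f W = ∑ w : α → γ, ∑ w' : β → γ,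
      if Sum.elim w w' ∈ S then f (Sum.elim w w') else 0 := by
  have h : ∑ W ∈ S, f W = ∑ W, if W ∈ S then f W else 0 := by
    rw [← Finset.sum_filter]
    congr 1
    ext
    simp
  rw [h, ← (Equiv.sumArrowEquivProdArrow α β γ).symm.sum_comp, Fintype.sum_prod_type]
  rfl

theorem sum_sum_le_univ {α : Type*} [Fintype α] (s : Finset α) (f : α → α → ℝ)
    (h : ∀ w w', 0 ≤ f w w') : ∑ w ∈ s, ∑ w' ∈ s, f w w' ≤ ∑ w, ∑ w', f w w' :=
  (Finset.sum_le_sum fun w _ => Finset.sum_le_univ_sum_of_nonneg fun w' => h w w').trans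
    (Finset.sum_le_univ_sum_of_nonneg fun w => Finset.sum_nonneg fun w' _ => h w w')

/-- The pointwise form of `pair_trichotomy`: all summands are nonnegative, and in each of the three
cases one of them dominates the product. -/
theorem walkInd_mul_walkInd_le {m : ℕ} [NeZero m] (hm : 3 ≤ m) (G : SimpleGraph (Fin n))
    {w w' : ZMod m → Fin n} (hi : Function.Injective w) (hi' : Function.Injective w') :
    walkInd (cyc m) w G * walkInd (cyc m) w' G ≤
      (if Function.Injective (Sum.elim w w') then
        walkInd ((cyc m).sumCongr (cyc m)) (Sum.elim w w') G else 0) +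
      (if Sum.elim w w' ∈ excessWalks ((cyc m).sumCongr (cyc m)) n then
        walkInd ((cyc m).sumCongr (cyc m)) (Sum.elim w w') G else 0) +
      ∑ c : ZMod m, ((if w' = fun t => w (c + t) then walkInd (cyc m) w G else 0) +
          (if w' = fun t => w (c - t) then walkInd (cyc m) w G else 0)) := by
  have hmul := walkInd_mul_walkInd hm hi hi' G
  have htri := pair_trichotomy hm hi hi'
  have e1 := walkInd_nonneg ((cyc m).sumCongr (cyc m)) (Sum.elim w w') G
  generalize (cyc m).sumCongr (cyc m) = nx at *
  have e2 := walkInd_nonneg (cyc m) w G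
  have e9 : walkInd (cyc m) w G * walkInd (cyc m) w' G ≤ walkInd (cyc m) w G :=
    mul_le_of_le_one_right e2 (walkInd_le_one _ _ _)
  generalize walkInd (cyc m) w G * walkInd (cyc m) w' G = p at *
  generalize walkInd (cyc m) w G = q at *
  have e3 : ∀ c : ZMod m, 0 ≤ (if w' = fun t => w (c + t) then q else 0) +
      (if w' = fun t => w (c - t) then q else 0) := fun c => by
    split_ifs <;> linarith
  have e6 := Finset.sum_nonneg fun c (_ : c ∈ Finset.univ) => e3 c
  rcases htri with h | h | ⟨c, h⟩
  · rw [hmul, if_pos h]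
    split_ifs <;> linarith
  · rw [hmul, if_pos h]
    split_ifs <;> linarith
  · have e7 := Finset.single_le_sum (fun c _ => e3 c) (Finset.mem_univ c)
    have e8 : q ≤ (if w' = fun t => w (c + t) then q else 0) +
        (if w' = fun t => w (c - t) then q else 0) := by
      rcases h with h | h
      · rw [if_pos h]
        split_ifs <;> linarith
      · rw [if_pos h]
        split_ifs <;> linarith
    refine e9.trans (e8.trans (e7.trans (le_add_of_nonneg_left (add_nonneg ?_ ?_))))
    · split_ifs
      exacts [e1, le_rfl]
    · split_ifs
      exacts [e1, le_rfl]

/-- In expectation the disjoint pairs give at most the square of the limiting mean and the excess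
pairs O(1 / n) for fixed `m`. The last term counts the m rotations and m reflections of each cycle;
it is the main part of the variance. -/
theorem cycleCount_sq_le {m : ℕ} [NeZero m] (hm : 3 ≤ m) (G : SimpleGraph (Fin n)) :
    cycleCount m G ^ 2 ≤
      ∑ p ∈ ((Finset.univ : Finset ((ZMod m → Fin n) × (ZMod m → Fin n))).filter fun p =>
        Function.Injective (Sum.elim p.1 p.2)),
          walkInd ((cyc m).sumCongr (cyc m)) (Sum.elim p.1 p.2) G +
      ∑ W ∈ excessWalks ((cyc m).sumCongr (cyc m)) n, walkInd ((cyc m).sumCongr (cyc m)) W G +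
      2 * m * cycleCount m G := by
  have h2 : cycleCount m G ^ 2 = ∑ w ∈ injWalks n m, ∑ w' ∈ injWalks n m,
      walkInd (cyc m) w G * walkInd (cyc m) w' G := by
    rw [sq, cycleCount, Finset.sum_mul_sum]
  rw [h2]
  have hi : ∀ w ∈ injWalks n m, Function.Injective w := fun w hw => (Finset.mem_filter.1 hw).2
  refine le_trans (Finset.sum_le_sum fun w hw => Finset.sum_le_sum fun w' hw' =>
    walkInd_mul_walkInd_le hm G (hi w hw) (hi w' hw')) ?_
  have e0 : ∀ W, 0 ≤ walkInd ((cyc m).sumCongr (cyc m)) W G := fun W => walkInd_nonneg _ W G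
  generalize (cyc m).sumCongr (cyc m) = nx at *
  simp only [Finset.sum_add_distrib]
  refine add_le_add (add_le_add ?_ ?_) ?_
  · rw [Finset.sum_filter, Fintype.sum_prod_type]
    refine sum_sum_le_univ _ _ fun w w' => ?_
    split_ifs
    exacts [e0 _, le_rfl]
  · rw [sum_sumElim]
    refine sum_sum_le_univ _ _ fun w w' => ?_
    split_ifs
    exacts [e0 _, le_rfl]
  · rw [← Finset.sum_add_distrib, cycleCount, Finset.mul_sum]
    refine Finset.sum_le_sum fun w _ => ?_
    have e2 := walkInd_nonneg (cyc m) w G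
    generalize walkInd (cyc m) w G = q at *
    rw [Finset.sum_comm, Finset.sum_comm (s := injWalks n m) (t := Finset.univ),
      ← Finset.sum_add_distrib]
    calc _ ≤ ∑ _c : ZMod m, (q + q) := by
          refine Finset.sum_le_sum fun c _ => add_le_add ?_ ?_
          all_goals
            rw [Finset.sum_ite_eq']
            split_ifs <;> linarith
      _ = _ := by
          rw [Finset.sum_const, Finset.card_univ, ZMod.card, nsmul_eq_mul]
          ring

/-- The centre is the limiting mean instead of the exact one. The last error term pays for this,
that is, for replacing the falling factorial of n by n^m. -/
theorem expect_cycleCount_sub_sq_le [NeZero k] {m : ℕ} [NeZero m] (hm : 3 ≤ m) {a b C : ℝ}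
    (ha0 : 0 ≤ a) (hb0 : 0 ≤ b) (ha : a ≤ C) (hb : b ≤ C) (hC : 1 ≤ C) (hn : C ≤ n) :
    expect n k a b (fun x => (cycleCount m x.2 - meanCycles k a b m) ^ 2) ≤
      2 * m * meanCycles k a b m + (C * (2 * m)) ^ (2 * m) / n +
        2 * meanCycles k a b m ^ 2 * m ^ 2 / n := by
  have hn0 : n ≠ 0 := by
    rintro rfl
    norm_num at hn
    linarith
  have hn1 : (0 : ℝ) < n := by linarith
  set μ := meanCycles k a b m with hμ
  have hμ0 : 0 ≤ μ := meanCycles_nonneg ha0 hb0 m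
  have hE : expect n k a b (fun x => cycleCount m x.2) = (injWalks n m).card * (μ / (n : ℝ) ^ m) :=
    expect_cycleCount hm ha0 hb0 ha hb hn
  have hE1 : expect n k a b (fun x => cycleCount m x.2) ≤ μ := by
    rw [hE, mul_div_assoc', div_le_iff₀ (by positivity), mul_comm]
    exact mul_le_mul_of_nonneg_left (card_injWalks_le n m) hμ0
  have hE2 : μ * (1 - (m : ℝ) ^ 2 / n) ≤ expect n k a b (fun x => cycleCount m x.2) := by
    rw [hE, mul_div_assoc', le_div_iff₀ (by positivity)]
    have := mul_le_mul_of_nonneg_left (le_card_injWalks hn0 m) hμ0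
    linarith
  have hsq : expect n k a b (fun x => cycleCount m x.2 ^ 2) ≤
      μ ^ 2 + (C * (2 * m)) ^ (2 * m) / n + 2 * m * μ := by
    refine (expect_mono a b fun x => cycleCount_sq_le hm x.2).trans ?_
    rw [expect_add, expect_add, expect_const_mul, expect_sum]
    gcongr ?_ + ?_ + ?_
    · rw [Finset.sum_congr rfl fun p hp =>
        expect_walkInd_pair hm ha0 hb0 ha hb hn (Finset.mem_filter.1 hp).2,
        Finset.sum_const, nsmul_eq_mul]
      calc _ ≤ ((n : ℝ) ^ m) ^ 2 * (μ / (n : ℝ) ^ m) ^ 2 := by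
            refine mul_le_mul_of_nonneg_right ?_ (by positivity)
            refine (Nat.cast_le.2 (Finset.card_filter_le _ _)).trans ?_
            simp [sq]
        _ = μ ^ 2 := by
            rw [← mul_pow, mul_div_cancel₀]
            positivity
    · refine (expect_sum_excessWalks_le _ ha hb hC hn0).trans_eq ?_
      simp only [Fintype.card_sum, ZMod.card]
      push_cast
      rw [← two_mul, ← two_mul]
    · exact mul_le_mul_of_nonneg_left hE1 (by positivity)
  rw [expect_sq_sub]
  have h3 : 2 * μ * (μ * (1 - (m : ℝ) ^ 2 / n)) ≤
      2 * μ * expect n k a b (fun x => cycleCount m x.2) :=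
    mul_le_mul_of_nonneg_left hE2 (by linarith)
  have h4 : 2 * μ * (μ * (1 - (m : ℝ) ^ 2 / n)) = 2 * μ ^ 2 - 2 * μ ^ 2 * m ^ 2 / n := by ring
  linarith

end Moments

/-! ### Closed nonbacktracking walks and cycles -/

section Comparison

variable {n : ℕ}

theorem cycleCount_eq_card (m : ℕ) [NeZero m] (G : SimpleGraph (Fin n)) :
    cycleCount m G = ((injWalks n m).filter fun w => walkGraph (cyc m) w ≤ G).card := by
  simp only [cycleCount, walkInd]
  rw [Finset.sum_boole]

theorem isClosedWalk_iff {m : ℕ} (G : SimpleGraph (Fin n)) (w : ZMod m → Fin n) :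
    IsClosedWalk G w ↔ IsNonbacktracking (cyc m) w ∧ walkGraph (cyc m) w ≤ G := by
  constructor
  · intro h
    have h1 : ∀ i, w i ≠ w (cyc m i) := fun i => (h i).1.ne
    exact ⟨fun i => ⟨h1 i, (h i).2⟩, (walkGraph_le_iff h1 G).2 fun i => (h i).1⟩
  · rintro ⟨h1, h2⟩ i
    exact ⟨(walkGraph_le_iff (fun i => (h1 i).1) G).1 h2 i, (h1 i).2⟩

theorem cycleCount_le_closedNonbacktrackingCount {m : ℕ} [NeZero m] (hm : 3 ≤ m)
    (G : SimpleGraph (Fin n)) : cycleCount m G ≤ closedNonbacktrackingCount G m := by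
  rw [cycleCount_eq_card, closedNonbacktrackingCount_eq]
  refine Nat.cast_le.2 (Finset.card_le_card fun w hw => ?_)
  obtain ⟨h1, h2⟩ := Finset.mem_filter.1 hw
  exact Finset.mem_filter.2 ⟨Finset.mem_univ _, (isClosedWalk_iff G w).2
    ⟨isNonbacktracking_of_injective hm (Finset.mem_filter.1 h1).2, h2⟩⟩

/-- A closed nonbacktracking walk that does not trace out more edges than vertices is a cycle, or
goes several times around a shorter cycle. -/
theorem exists_cycle_of_not_excess {m : ℕ} [NeZero m] {G : SimpleGraph (Fin n)}
    {w : ZMod m → Fin n} (hw : IsClosedWalk G w) (hex : w ∉ excessWalks (cyc m) n)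
    (hinj : ¬ Function.Injective w) :
    ∃ t ∈ Finset.Ico 2 (m / 2), ∃ v ∈ (injWalks n (t + 1)).filter fun v =>
      walkGraph (cyc (t + 1)) v ≤ G, (fun x : ZMod m => v (x.val : ZMod (t + 1))) = w := by
  obtain ⟨hnb, hG⟩ := (isClosedWalk_iff G w).1 hw
  have hle : (walkGraph (cyc m) w).edgeFinset.card ≤ (Finset.univ.image w).card := by
    by_contra! hlt
    exact hex (Finset.mem_filter.2 ⟨Finset.mem_univ _, fun i => (hnb i).1, hlt⟩)
  have hper : ∀ i j, w i = w j → ∀ t, w (t + (j - i)) = w t := fun i j hij t =>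
    periodic_of_eq (hnb.degree_le_two hle) (fun i => walkGraph_adj (fun i => (hnb i).1) i)
      (fun i => (hnb i).2) hij t
  have hval : ∀ t : ZMod m, ((t.val : ℕ) : ZMod m) = t := ZMod.natCast_zmod_val
  have hex' : ∃ p : ℕ, 0 < p ∧ ∀ x, w (x + p) = w x := by
    refine ⟨m, NeZero.pos m, fun x => by simp⟩
  -- The least period of `w`. It divides `m`, and by `hper` any coincidence of two vertices yields a
  -- period.
  let q := Nat.find hex'
  have hq0 : 0 < q := (Nat.find_spec hex').1
  have hq : ∀ x, w (x + q) = w x := (Nat.find_spec hex').2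
  have hmin : ∀ p : ℕ, p < q → (∀ x, w (x + p) = w x) → p = 0 := fun p hp h => by
    by_contra h0
    exact Nat.find_min hex' hp ⟨Nat.pos_of_ne_zero h0, h⟩
  have hmul : ∀ c : ℕ, ∀ x, w (x + (q * c : ℕ)) = w x := by
    intro c
    induction c with
    | zero => simp
    | succ c ih =>
      intro x
      rw [Nat.mul_succ, Nat.cast_add, ← add_assoc, hq, ih]
  have hmod : ∀ c : ℕ, w ((c % q : ℕ) : ZMod m) = w (c : ZMod m) := by
    intro c
    conv_rhs => rw [← Nat.mod_add_div c q, Nat.cast_add, hmul]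
  have hdvd : q ∣ m := by
    refine Nat.dvd_of_mod_eq_zero (hmin _ (Nat.mod_lt _ hq0) fun x => ?_)
    rw [← hmul (m / q), add_assoc, ← Nat.cast_add, Nat.mod_add_div]
    simp
  have hlt : q < m := by
    simp only [Function.Injective, not_forall] at hinj
    obtain ⟨i, j, hij, hne⟩ := hinj
    refine lt_of_le_of_lt (Nat.find_min' hex' (m := (j - i).val) ⟨?_, ?_⟩) (ZMod.val_lt (j - i))
    · exact Nat.pos_of_ne_zero fun h => hne (sub_eq_zero.1 ((ZMod.val_eq_zero _).1 h)).symm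
    · rw [hval]
      exact hper i j hij
  -- Period 1 would be a loop and period 2 a backtrack.
  have hq3 : 3 ≤ q := by
    by_contra! h
    have h12 : q = 1 ∨ q = 2 := by omega
    rcases h12 with h | h
    · have := hq 0
      rw [h, Nat.cast_one] at this
      exact (hnb 0).1 this.symm
    · have := hq 0
      rw [h, Nat.cast_two, ← one_add_one_eq_two, ← add_assoc] at this
      exact (hnb 0).2 this.symm
  have hhalf : q ≤ m / 2 := by
    obtain ⟨c, hc⟩ := hdvd
    have hc2 : 2 ≤ c := by
      by_contra! h
      have h01 : c = 0 ∨ c = 1 := by omega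
      rcases h01 with rfl | rfl <;> omega
    rw [Nat.le_div_iff_mul_le (by norm_num), hc]
    exact Nat.mul_le_mul_left q hc2
  obtain ⟨t, ht⟩ : ∃ t, q = t + 1 := Nat.exists_eq_succ_of_ne_zero hq0.ne'
  have hval' : ∀ y : ZMod (t + 1), ((y.val : ℕ) : ZMod (t + 1)) = y := ZMod.natCast_zmod_val
  let v : ZMod (t + 1) → Fin n := fun y => w (y.val : ZMod m)
  have hv : ∀ c : ℕ, v (c : ZMod (t + 1)) = w (c : ZMod m) := fun c => by
    change w _ = _
    rw [ZMod.val_natCast, ← ht, hmod]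
  have hvinj : Function.Injective v := by
    -- A repeated vertex within one period would give a period smaller than `q`.
    have key : ∀ y y' : ZMod (t + 1), v y = v y' → y.val ≤ y'.val → y = y' := by
      intro y y' hy hyy
      have h1 := ZMod.val_lt y'
      have h2 := hmin (y'.val - y.val) (by omega) (by
        intro x
        rw [Nat.cast_sub hyy]
        exact hper _ _ hy x)
      exact ZMod.val_injective _ (by omega)
    intro y y' hy
    rcases le_total y.val y'.val with h | h
    · exact key y y' hy h
    · exact (key y' y hy.symm h).symm
  refine ⟨t, Finset.mem_Ico.2 ⟨by omega, by omega⟩, v, ?_, ?_⟩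
  · refine Finset.mem_filter.2 ⟨Finset.mem_filter.2 ⟨Finset.mem_univ _, hvinj⟩, ?_⟩
    have hadj : ∀ y, G.Adj (v y) (v (y + 1)) := fun y => by
      have h1 := (hw (y.val : ZMod m)).1
      have h2 := hv (y.val + 1)
      rw [Nat.cast_add, Nat.cast_one, hval', Nat.cast_add, Nat.cast_one] at h2
      rwa [h2]
    exact (walkGraph_le_iff (fun y => (hadj y).ne) G).2 hadj
  · funext x
    rw [hv, hval]

/-- The three sums are for cycles, for repeated traversals of a cycle of length t + 1 ≤ m / 2 (each
determined by that cycle), and for walks with excess edges. -/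
theorem closedNonbacktrackingCount_le {m : ℕ} [NeZero m] (G : SimpleGraph (Fin n)) :
    (closedNonbacktrackingCount G m : ℝ) ≤ cycleCount m G +
      ∑ t ∈ Finset.Ico 2 (m / 2), cycleCount (t + 1) G +
      ∑ w ∈ excessWalks (cyc m) n, walkInd (cyc m) w G := by
  have hsub : (Finset.univ.filter fun w : ZMod m → Fin n => IsClosedWalk G w) ⊆
      ((injWalks n m).filter fun w => walkGraph (cyc m) w ≤ G) ∪
      ((Finset.Ico 2 (m / 2)).biUnion fun t =>
        ((injWalks n (t + 1)).filter fun v => walkGraph (cyc (t + 1)) v ≤ G).image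
          fun v (x : ZMod m) => v (x.val : ZMod (t + 1))) ∪
      ((excessWalks (cyc m) n).filter fun w => walkGraph (cyc m) w ≤ G) := by
    intro w hw
    have hw := (Finset.mem_filter.1 hw).2
    have hG := ((isClosedWalk_iff G w).1 hw).2
    by_cases hex : w ∈ excessWalks (cyc m) n
    · exact Finset.mem_union_right _ (Finset.mem_filter.2 ⟨hex, hG⟩)
    · refine Finset.mem_union_left _ ?_
      by_cases hinj : Function.Injective w
      · exact Finset.mem_union_left _ (Finset.mem_filter.2
          ⟨Finset.mem_filter.2 ⟨Finset.mem_univ _, hinj⟩, hG⟩)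
      · refine Finset.mem_union_right _ (Finset.mem_biUnion.2 ?_)
        obtain ⟨t, ht, v, hv, rfl⟩ := exists_cycle_of_not_excess hw hex hinj
        exact ⟨t, ht, Finset.mem_image_of_mem _ hv⟩
  have hcard := (Finset.card_le_card hsub).trans ((Finset.card_union_le _ _).trans
    (add_le_add (Finset.card_union_le _ _) le_rfl))
  have hbi := (Finset.card_biUnion_le (s := Finset.Ico 2 (m / 2)) (t := fun t =>
    ((injWalks n (t + 1)).filter fun v => walkGraph (cyc (t + 1)) v ≤ G).image
      fun v (x : ZMod m) => v (x.val : ZMod (t + 1)))).trans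
    (Finset.sum_le_sum fun t _ => Finset.card_image_le)
  rw [closedNonbacktrackingCount_eq]
  simp only [cycleCount_eq_card, walkInd, Finset.sum_boole]
  exact_mod_cast hcard.trans (add_le_add (add_le_add le_rfl hbi) le_rfl)

variable {k : ℕ}

theorem expect_cycleCount_le [NeZero k] {m : ℕ} [NeZero m] (hm : 3 ≤ m) {a b C : ℝ}
    (ha0 : 0 ≤ a) (hb0 : 0 ≤ b) (ha : a ≤ C) (hb : b ≤ C) (hC : 1 ≤ C) (hn : C ≤ n) :
    expect n k a b (fun x => cycleCount m x.2) ≤ meanCycles k a b m := by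
  have hn1 : (0 : ℝ) < n := by linarith
  rw [expect_cycleCount hm ha0 hb0 ha hb hn, mul_div_assoc', div_le_iff₀ (by positivity), mul_comm]
  exact mul_le_mul_of_nonneg_left (card_injWalks_le n m) (meanCycles_nonneg ha0 hb0 m)

/-- For m ≥ 3 the difference is nonnegative, so Markov's inequality will need no second moment of
the walks that are not cycles. -/
theorem expect_closedNonbacktrackingCount_sub_le [NeZero k] {m : ℕ} [NeZero m] {a b C : ℝ}
    (ha0 : 0 ≤ a) (hb0 : 0 ≤ b) (ha : a ≤ C) (hb : b ≤ C) (hC : 1 ≤ C) (hn : C ≤ n) :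
    expect n k a b (fun x => closedNonbacktrackingCount x.2 m - cycleCount m x.2) ≤
      ∑ t ∈ Finset.Ico 2 (m / 2), meanCycles k a b (t + 1) + (C * m) ^ m / n := by
  have hn0 : n ≠ 0 := by
    rintro rfl
    norm_num at hn
    linarith
  refine (expect_mono a b fun x => (sub_le_iff_le_add'.2 ((closedNonbacktrackingCount_le x.2).trans_eq
    (add_assoc _ _ _)))).trans ?_
  rw [expect_add, expect_sum]
  refine add_le_add (Finset.sum_le_sum fun t ht => ?_) ?_
  · exact expect_cycleCount_le (by have := (Finset.mem_Ico.1 ht).1; omega) ha0 hb0 ha hb hC hn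
  · refine (expect_sum_excessWalks_le _ ha hb hC hn0).trans_eq ?_
    rw [ZMod.card]

end Comparison

/-! ### The number of edges -/

section Edges

variable {n k : ℕ}

/-- Resampling one label preserves the uniform measure: exchanging `σ v` with an additional label
`x` is an involution. -/
theorem sum_update_eq (v : Fin n) (g : (Fin n → Fin k) → ℝ) :
    ∑ σ : Fin n → Fin k, ∑ x, g (Function.update σ v x) = k * ∑ σ, g σ := by
  have h : ∑ p : (Fin n → Fin k) × Fin k, g (Function.update p.1 v p.2) =
      ∑ p : (Fin n → Fin k) × Fin k, g p.1 := by
    refine Fintype.sum_bijective (fun p => (Function.update p.1 v p.2, p.1 v))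
      (Function.Involutive.bijective ?_) _ _ fun p => rfl
    rintro ⟨σ, x⟩
    simp
  rw [Fintype.sum_prod_type, Fintype.sum_prod_type] at h
  rw [h, Finset.mul_sum]
  simp

/-- The limiting average degree. -/
def avgDegree (k : ℕ) (a b : ℝ) : ℝ := (a + (k - 1) * b) / k

theorem sum_commMatrix [NeZero k] (a b : ℝ) (x : Fin k) :
    ∑ y, commMatrix k a b x y = k * avgDegree k a b := by
  have hk : (k : ℝ) ≠ 0 := by exact_mod_cast NeZero.ne k
  have h1 : ∀ y, commMatrix k a b x y = (if x = y then a - b else 0) + b := fun y => by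
    rw [commMatrix]; split_ifs <;> ring
  simp only [h1, Finset.sum_add_distrib, Finset.sum_ite_eq, Finset.mem_univ, if_true,
    Finset.sum_const, Finset.card_univ, Fintype.card_fin, nsmul_eq_mul, avgDegree]
  field_simp
  ring

/-- Average over the label of `v` alone. All row sums of `commMatrix` agree, so the result does not
depend on the label of `u`. -/
theorem sum_commMatrix_mul [NeZero k] (a b : ℝ) {u v : Fin n} (huv : u ≠ v)
    {F : (Fin n → Fin k) → ℝ} (hF : ∀ σ x, F (Function.update σ v x) = F σ) :
    ∑ σ : Fin n → Fin k, commMatrix k a b (σ u) (σ v) * F σ = avgDegree k a b * ∑ σ, F σ := by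
  have hk : (k : ℝ) ≠ 0 := by exact_mod_cast NeZero.ne k
  have h := sum_update_eq v fun σ : Fin n → Fin k => commMatrix k a b (σ u) (σ v) * F σ
  simp only [hF, Function.update_self, Function.update_of_ne huv, ← Finset.sum_mul,
    sum_commMatrix, mul_assoc, ← Finset.mul_sum] at h
  exact (mul_left_cancel₀ hk h).symm

/-- The indicator of the event that the edges `S` belong to the graph. -/
def edgesInd (S : Finset (Sym2 (Fin n))) (G : SimpleGraph (Fin n)) : ℝ :=
  if S ⊆ G.edgeFinset then 1 else 0

theorem expect_edgesInd (a b : ℝ) {S : Finset (Sym2 (Fin n))}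
    (hS : S ⊆ (⊤ : SimpleGraph (Fin n)).edgeFinset) :
    expect n k a b (fun x => edgesInd S x.2) =
      (1 / (k : ℝ)) ^ n * ∑ σ : Fin n → Fin k, ∏ e ∈ S, symEdgeProb a b σ e := by
  have hS' : ∀ _ : Fintype (SimpleGraph.fromEdgeSet (S : Set (Sym2 (Fin n)))).edgeSet,
      (SimpleGraph.fromEdgeSet (S : Set (Sym2 (Fin n)))).edgeFinset = S := by
    intro _
    ext e
    simp only [SimpleGraph.mem_edgeFinset, SimpleGraph.edgeSet_fromEdgeSet, Set.mem_sdiff,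
      Finset.mem_coe]
    refine ⟨fun h => h.1, fun h => ⟨h, ?_⟩⟩
    have := hS h
    rw [SimpleGraph.mem_edgeFinset] at this
    exact SimpleGraph.not_isDiag_of_mem_edgeSet _ this
  have h := expect_le_graph (n := n) (k := k) a b (SimpleGraph.fromEdgeSet (S : Set (Sym2 (Fin n))))
  rw [hS'] at h
  rw [← h]
  congr 1
  funext x
  rw [edgesInd]
  refine if_congr ?_ rfl rfl
  rw [← SimpleGraph.edgeFinset_subset_edgeFinset, hS']

theorem edgeFinset_card_eq_sum (G : SimpleGraph (Fin n)) :
    (G.edgeFinset.card : ℝ) = ∑ e ∈ (⊤ : SimpleGraph (Fin n)).edgeFinset, edgesInd {e} G := by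
  simp only [edgesInd, Finset.singleton_subset_iff]
  rw [Finset.sum_boole]
  congr 2
  ext e
  rw [Finset.mem_filter]
  exact ⟨fun h => ⟨SimpleGraph.edgeFinset_mono le_top h, h⟩, fun h => h.2⟩

theorem edgesInd_mul (e f : Sym2 (Fin n)) (G : SimpleGraph (Fin n)) :
    edgesInd {e} G * edgesInd {f} G = edgesInd {e, f} G := by
  simp only [edgesInd, Finset.singleton_subset_iff, Finset.insert_subset_iff, ite_and, mul_ite,
    mul_one, mul_zero]
  split_ifs <;> rfl

section

variable [NeZero k] {a b C : ℝ} (ha0 : 0 ≤ a) (hb0 : 0 ≤ b) (ha : a ≤ C) (hb : b ≤ C)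
  (hn : C ≤ n)

include ha0 hb0 ha hb hn

theorem expect_edgesInd_singleton {e : Sym2 (Fin n)}
    (he : e ∈ (⊤ : SimpleGraph (Fin n)).edgeFinset) :
    expect n k a b (fun x => edgesInd {e} x.2) = avgDegree k a b / n := by
  rw [expect_edgesInd a b (by simpa using he)]
  induction e with | _ u v
  have huv : u ≠ v := by simpa using he
  have h := sum_commMatrix_mul (k := k) (n := n) a b huv (F := fun _ => 1 / n) fun _ _ => rfl
  simp only [Finset.prod_singleton, symEdgeProb, Sym2.lift_mk,
    edgeProb_eq ha0 hb0 ha hb hn]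
  simp only [mul_one_div] at h
  rw [h, mul_left_comm, uniform_sum_const, mul_one_div]

/-- Since `v` is not an endpoint of the second edge, its label can be averaged out first. -/
theorem expect_edgesInd_pair_aux {u v u' v' : Fin n} (huv : u ≠ v) (hu : v ≠ u') (hv : v ≠ v')
    (huv' : u' ≠ v') :
    expect n k a b (fun x => edgesInd {s(u, v), s(u', v')} x.2) = (avgDegree k a b / n) ^ 2 := by
  have hne : s(u, v) ≠ s(u', v') := fun h => by
    rcases Sym2.eq_iff.1 h with h | h
    · exact hv h.2
    · exact hu h.2
  rw [expect_edgesInd a b (by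
    intro e he
    rcases Finset.mem_insert.1 he with rfl | he
    · simpa using huv
    · rw [Finset.mem_singleton.1 he]
      simpa using huv')]
  simp only [Finset.prod_pair hne, symEdgeProb, Sym2.lift_mk, edgeProb_eq ha0 hb0 ha hb hn]
  have h := sum_commMatrix_mul (k := k) (n := n) a b huv
    (F := fun σ => commMatrix k a b (σ u') (σ v') * (1 / n ^ 2)) fun σ x => by
      rw [Function.update_of_ne hu.symm, Function.update_of_ne hv.symm]
  have h' := sum_commMatrix_mul (k := k) (n := n) a b huv' (F := fun _ => 1 / n ^ 2) fun _ _ => rfl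
  rw [h'] at h
  have h2 : ∀ σ : Fin n → Fin k, commMatrix k a b (σ u) (σ v) / n *
      (commMatrix k a b (σ u') (σ v') / n) =
      commMatrix k a b (σ u) (σ v) * (commMatrix k a b (σ u') (σ v') * (1 / n ^ 2)) :=
    fun σ => by ring
  simp only [h2]
  rw [h, mul_left_comm, mul_left_comm ((1 / (k : ℝ)) ^ n), uniform_sum_const]
  ring

theorem expect_edgesInd_pair {e f : Sym2 (Fin n)}
    (he : e ∈ (⊤ : SimpleGraph (Fin n)).edgeFinset)
    (hf : f ∈ (⊤ : SimpleGraph (Fin n)).edgeFinset) (hef : e ≠ f) :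
    expect n k a b (fun x => edgesInd {e, f} x.2) = (avgDegree k a b / n) ^ 2 := by
  induction e with | _ u v
  induction f with | _ u' v'
  have huv : u ≠ v := by simpa using he
  have huv' : u' ≠ v' := by simpa using hf
  -- One of the endpoints of `e` does not belong to `f`, because the two edges differ; it takes the
  -- role of `v`.
  by_cases h : v ≠ u' ∧ v ≠ v'
  · exact expect_edgesInd_pair_aux ha0 hb0 ha hb hn huv h.1 h.2 huv'
  · rw [Sym2.eq_swap (a := u)]
    refine expect_edgesInd_pair_aux ha0 hb0 ha hb hn huv.symm ?_ ?_ huv'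
    · rintro rfl
      apply hef
      rw [Sym2.eq_iff]
      tauto
    · rintro rfl
      apply hef
      rw [Sym2.eq_iff]
      tauto

/-- The edges are pairwise uncorrelated, so the variance of their number is at most its mean. The
second term is the bias d / n, which comes from the n (n - 1) / 2 pairs instead of n² / 2. -/
theorem expect_edge_sub_sq_le :
    expect n k a b (fun x => ((2 * x.2.edgeFinset.card : ℝ) / n - avgDegree k a b) ^ 2) ≤
      4 * avgDegree k a b / n + 2 * avgDegree k a b ^ 2 / n ^ 2 := by
  have hk : (1 : ℝ) ≤ k := by exact_mod_cast NeZero.one_le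
  have hd : 0 ≤ avgDegree k a b := by
    rw [avgDegree]
    have : 0 ≤ (k - 1) * b := mul_nonneg (by linarith) hb0
    positivity
  rcases Nat.eq_zero_or_pos n with h0 | hpos
  · subst h0
    have : C ≤ 0 := by simpa using hn
    have ha' : a = 0 := by linarith
    have hb' : b = 0 := by linarith
    subst ha' hb'
    simp [avgDegree, expect_const]
  have hn1 : (0 : ℝ) < n := by exact_mod_cast hpos
  set d := avgDegree k a b with hdd
  set T := (⊤ : SimpleGraph (Fin n)).edgeFinset with hT
  have hcard : (T.card : ℝ) = n * (n - 1) / 2 := by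
    rw [hT, SimpleGraph.card_edgeFinset_top_eq_card_choose_two, Fintype.card_fin,
      Nat.cast_choose_two]
  have hE : expect n k a b (fun x => (x.2.edgeFinset.card : ℝ)) = T.card * (d / n) := by
    simp only [edgeFinset_card_eq_sum]
    rw [expect_sum, Finset.sum_congr rfl fun e he =>
      expect_edgesInd_singleton ha0 hb0 ha hb hn he, Finset.sum_const, nsmul_eq_mul]
  have hE2 : expect n k a b (fun x => (x.2.edgeFinset.card : ℝ) ^ 2) ≤
      (T.card * (d / n)) ^ 2 + T.card * (d / n) := by
    simp only [edgeFinset_card_eq_sum, sq, Finset.sum_mul_sum, edgesInd_mul]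
    rw [expect_sum]
    calc _ ≤ ∑ e ∈ T, ∑ f ∈ T, ((d / n) * (d / n) + if e = f then d / n else 0) := by
          refine Finset.sum_le_sum fun e he => ?_
          rw [expect_sum]
          refine Finset.sum_le_sum fun f hf => ?_
          split_ifs with h
          · subst h
            rw [Finset.pair_eq_singleton, expect_edgesInd_singleton ha0 hb0 ha hb hn he]
            have : 0 ≤ d / n * (d / n) := by positivity
            linarith
          · rw [expect_edgesInd_pair ha0 hb0 ha hb hn he hf h, sq, add_zero]
      _ = _ := by
          simp only [Finset.sum_add_distrib, Finset.sum_const, Finset.sum_ite_eq, nsmul_eq_mul]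
          rw [← Finset.sum_filter, Finset.filter_mem_eq_inter, Finset.inter_self,
            Finset.sum_const, nsmul_eq_mul]
          ring
  have h1 : ∀ x : (Fin n → Fin k) × SimpleGraph (Fin n),
      ((2 * x.2.edgeFinset.card : ℝ) / n - d) ^ 2 ≤
        8 / n ^ 2 * (x.2.edgeFinset.card - T.card * (d / n)) ^ 2 + 2 * d ^ 2 / n ^ 2 := by
    intro x
    have h2 : (2 * x.2.edgeFinset.card : ℝ) / n - d =
        2 / n * (x.2.edgeFinset.card - T.card * (d / n)) - d / n := by
      rw [hcard]
      field_simp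
      ring
    rw [h2]
    have h3 := sq_nonneg (2 / n * (x.2.edgeFinset.card - T.card * (d / n)) + d / n)
    have h4 : 8 / n ^ 2 * (x.2.edgeFinset.card - T.card * (d / n)) ^ 2 + 2 * d ^ 2 / n ^ 2 =
        2 * (2 / n * (x.2.edgeFinset.card - T.card * (d / n))) ^ 2 + 2 * (d / n) ^ 2 := by ring
    rw [h4]
    linarith
  refine (expect_mono a b h1).trans ?_
  rw [expect_add, expect_const_mul, expect_const, expect_sq_sub, hE]
  gcongr ?_ + _
  calc _ ≤ 8 / (n : ℝ) ^ 2 * (T.card * (d / n)) := by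
        refine mul_le_mul_of_nonneg_left ?_ (by positivity)
        linarith
    _ ≤ 4 * d / n := by
        rw [hcard]
        have : 8 / (n : ℝ) ^ 2 * (n * (n - 1) / 2 * (d / n)) = 4 * d / n - 4 * d / n ^ 2 := by
          field_simp
          ring
        rw [this]
        have : 0 ≤ 4 * d / (n : ℝ) ^ 2 := by positivity
        linarith

end

end Edges

/-! ### The estimator -/

section Estimator

/-- Half of the length of the walks that the estimator uses. -/
def scale (n : ℕ) : ℕ := Nat.size (Nat.size n) + 1

/-- The scaled excess `N n ^ l - D ^ l` of the number `N` of closed walks of length `l`. -/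
def excess (n D N l : ℕ) : ℕ := N * n ^ l - D ^ l

/-- The estimate of `k`, computed from the excesses at the lengths `m` and `2 m`. -/
def kHat (r r₂ : ℕ) : ℕ := 1 + (2 * (r * r) + r₂) / (2 * r₂)

/-- The numerator of the estimate of `b`. -/
def bNum (n D N₁ r m : ℕ) : ℕ := (D * r + D ^ (m + 1)) - N₁ * n ^ (m + 1)

/-- The numerator of the estimate of `a`. -/
def aNum (D r K B : ℕ) : ℕ := K * (D * r) - (K - 1) * B

/-- The estimate as a function of the number of vertices, the sum `D` of the degrees, half the
length `j` and the numbers of closed walks. -/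
def estimateOf (n D j : ℕ) (N : ℕ → ℕ) : Estimate where
  a := (aNum D (excess n D (N (2 * j)) (2 * j))
    (kHat (excess n D (N (2 * j)) (2 * j)) (excess n D (N (4 * j)) (4 * j)))
    (bNum n D (N (2 * j + 1)) (excess n D (N (2 * j)) (2 * j)) (2 * j)) : ℚ) /
      ((n * excess n D (N (2 * j)) (2 * j) : ℕ) : ℚ)
  b := (bNum n D (N (2 * j + 1)) (excess n D (N (2 * j)) (2 * j)) (2 * j) : ℚ) /
      ((n * excess n D (N (2 * j)) (2 * j) : ℕ) : ℚ)
  k := kHat (excess n D (N (2 * j)) (2 * j)) (excess n D (N (4 * j)) (4 * j))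

/-- The estimator. -/
def estimator : Estimator := fun n G =>
  estimateOf n (2 * G.edgeSet.ncard) (scale n) (closedNonbacktrackingCount G)

theorem cast_tsub_eq (x y : ℕ) : ((x - y : ℕ) : ℝ) = max 0 ((x : ℝ) - y) := by
  rcases le_total y x with h | h
  · rw [Nat.cast_sub h, max_eq_right]
    exact sub_nonneg.2 (Nat.cast_le.2 h)
  · rw [Nat.sub_eq_zero_of_le h, Nat.cast_zero, max_eq_left]
    exact sub_nonpos.2 (Nat.cast_le.2 h)

/-- Subtraction in ℕ truncates at zero. This does no harm, since the true `a` and `b` are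
nonnegative. -/
theorem abs_max_zero_sub_le {x y : ℝ} (hy : 0 ≤ y) : |max 0 x - y| ≤ |x - y| := by
  have := abs_max_sub_max_le_abs x y 0
  rwa [max_comm x, max_eq_left hy] at this

/-- In the application t = s^l with l even and x is close to k - 1. Positivity rules out truncation.
-/
theorem cast_excess {n D N l : ℕ} {x t : ℝ} (hn : 0 < n) (ht : 0 < t) (hx : 0 < x)
    (h : (N : ℝ) - ((D : ℝ) / n) ^ l = t * x) : (excess n D N l : ℝ) = n ^ l * (t * x) := by
  have hn0 : (0 : ℝ) < n := by exact_mod_cast hn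
  rw [excess, cast_tsub_eq]
  push_cast
  rw [max_eq_right]
  · rw [← h, div_pow]
    field_simp
  · have h2 : (N : ℝ) * n ^ l - D ^ l = n ^ l * (t * x) := by
      rw [← h, div_pow]
      field_simp
    rw [h2]
    positivity

/-- The powers of n and t cancel, and `kHat` is one plus the floor of x² / y + 1/2. This rounds x² /
y to the nearest integer, which is k - 1. -/
theorem cast_kHat {n m k : ℕ} {r r₂ : ℕ} {x y t : ℝ} (hk : 1 ≤ k) (hn : 0 < n) (ht : 0 < t)
    (hy : 0 < y) (hr : (r : ℝ) = n ^ m * (t * x))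
    (hr₂ : (r₂ : ℝ) = n ^ (2 * m) * (t ^ 2 * y)) (h : |x ^ 2 / y - (k - 1)| < 1 / 2) :
    kHat r r₂ = k := by
  have hn0 : (0 : ℝ) < n := by exact_mod_cast hn
  have h1 : ((2 * (r * r) + r₂ : ℕ) : ℝ) / ((2 * r₂ : ℕ) : ℝ) = x ^ 2 / y + 1 / 2 := by
    push_cast
    rw [hr, hr₂]
    field_simp
    ring
  rw [abs_lt] at h
  have h2 : (2 * (r * r) + r₂) / (2 * r₂) = k - 1 := by
    rw [← Nat.floor_div_eq_div (K := ℝ), h1, Nat.floor_eq_iff (by positivity), Nat.cast_sub hk]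
    push_cast
    constructor <;> linarith
  rw [kHat, h2]
  omega

/-- The excess at the odd length m + 1 has the sign of s and may be negative. `bNum` therefore adds
D^(m + 1) to D r before the only subtraction. -/
theorem cast_bNum_div {n D N r m : ℕ} {x z s t : ℝ} (hn : 0 < n) (ht : 0 < t)
    (hx : 0 < x) (hr : (r : ℝ) = n ^ m * (t * x))
    (h : (N : ℝ) - ((D : ℝ) / n) ^ (m + 1) = t * s * z) :
    (bNum n D N r m : ℝ) / (n * r : ℕ) = max 0 ((D : ℝ) / n - s * z / x) := by
  have hn0 : (0 : ℝ) < n := by exact_mod_cast hn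
  have h2 : (N : ℝ) = ((D : ℝ) / n) ^ (m + 1) + t * s * z := by linarith
  rw [bNum, cast_tsub_eq]
  push_cast
  rw [hr, h2]
  have h3 : (0 : ℝ) < n * (n ^ m * (t * x)) := by positivity
  rw [← max_div_div_right h3.le, zero_div, div_pow]
  congr 1
  field_simp
  ring

theorem cast_aNum_div {n D r m K B : ℕ} {x t β : ℝ} (hK : 1 ≤ K) (hn : 0 < n) (ht : 0 < t)
    (hx : 0 < x) (hr : (r : ℝ) = n ^ m * (t * x)) (hB : (B : ℝ) / (n * r : ℕ) = β) :
    (aNum D r K B : ℝ) / (n * r : ℕ) = max 0 (K * ((D : ℝ) / n) - (K - 1) * β) := by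
  have hn0 : (0 : ℝ) < n := by exact_mod_cast hn
  have h3 : (0 : ℝ) < (n * r : ℕ) := by
    push_cast
    rw [hr]
    positivity
  have hr0 : (r : ℝ) ≠ 0 := by
    rw [hr]
    positivity
  rw [aNum, cast_tsub_eq, ← max_div_div_right h3.le, zero_div, ← hB]
  congr 1
  push_cast
  rw [Nat.cast_sub hK, Nat.cast_one]
  field_simp

/-- The estimate is good whenever the numbers of walks and edges are close to their means. -/
theorem estimateOf_close {k : ℕ} (hk : 2 ≤ k) {a b d s : ℝ} (ha0 : 0 ≤ a) (hb0 : 0 ≤ b)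
    (had : a = d + (k - 1) * s) (hbd : b = d - s) (hs : 1 ≤ |s|) {ε : ℝ} (hε : 0 < ε) :
    ∃ δ : ℝ, 0 < δ ∧ ∀ (n D j : ℕ) (N : ℕ → ℕ), 0 < n →
      |(D : ℝ) / n - d| < δ →
      (∀ l, l = 2 * j ∨ l = 2 * j + 1 ∨ l = 4 * j →
        |(N l : ℝ) - (d ^ l + (k - 1) * s ^ l)| < δ * |s| ^ l ∧
          |((D : ℝ) / n) ^ l - d ^ l| < δ) →
      |((estimateOf n D j N).a : ℝ) - a| < ε ∧ |((estimateOf n D j N).b : ℝ) - b| < ε ∧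
        (estimateOf n D j N).k = k := by
  have hk2 : (2 : ℝ) ≤ k := by exact_mod_cast hk
  have hκ : (0 : ℝ) < k - 1 := by linarith
  have hs0 : s ≠ 0 := by
    rintro rfl
    norm_num at hs
  set κ : ℝ := k - 1 with hκd
  have hc1 : ContinuousAt (fun p : ℝ × ℝ => p.1 ^ 2 / p.2) (κ, κ) := by
    refine ContinuousAt.div (by fun_prop) (by fun_prop) hκ.ne'
  have hc2 : ContinuousAt (fun p : ℝ × ℝ × ℝ => p.1 - s * p.2.1 / p.2.2) (d, κ, κ) := by
    refine ContinuousAt.sub (by fun_prop) (ContinuousAt.div (by fun_prop) (by fun_prop) hκ.ne')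
  obtain ⟨δ₁, hδ₁, h1⟩ := Metric.continuousAt_iff.1 hc1 (1 / 2) (by norm_num)
  obtain ⟨δ₂, hδ₂, h2⟩ := Metric.continuousAt_iff.1 hc2 (ε / (2 * k)) (by positivity)
  -- The normalized excesses will be within 2 δ of κ: hence the halves of δ₁ and δ₂ for continuity,
  -- and κ / 2 to keep them positive. The last entry bounds the contribution of D / n to the error
  -- of `a`.
  refine ⟨min (min (δ₁ / 2) (δ₂ / 2)) (min (κ / 2) (ε / (2 * k))), by positivity, ?_⟩
  intro n D j N hn hD hN
  set δ := min (min (δ₁ / 2) (δ₂ / 2)) (min (κ / 2) (ε / (2 * k))) with hδ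
  have e1 : δ ≤ δ₁ / 2 := (min_le_left _ _).trans (min_le_left _ _)
  have e2 : δ ≤ δ₂ / 2 := (min_le_left _ _).trans (min_le_right _ _)
  have e3 : δ ≤ κ / 2 := (min_le_right _ _).trans (min_le_left _ _)
  have e4 : δ ≤ ε / (2 * k) := (min_le_right _ _).trans (min_le_right _ _)
  have hδ0 : 0 < δ := by positivity
  -- The excess divided by s^l is close to κ. The errors δ |s|^l of the walks and δ of the power of
  -- D / n add up to at most 2 δ |s|^l, because |s| ≥ 1.
  have key : ∀ l, l = 2 * j ∨ l = 2 * j + 1 ∨ l = 4 * j →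
      ∃ x : ℝ, |x - κ| < 2 * δ ∧ (N l : ℝ) - ((D : ℝ) / n) ^ l = s ^ l * x := by
    intro l hl
    obtain ⟨h3, h4⟩ := hN l hl
    have hsl : s ^ l ≠ 0 := pow_ne_zero _ hs0
    refine ⟨((N l : ℝ) - ((D : ℝ) / n) ^ l) / s ^ l, ?_, by field_simp⟩
    have h5 : ((N l : ℝ) - ((D : ℝ) / n) ^ l) / s ^ l - κ =
        (((N l : ℝ) - (d ^ l + κ * s ^ l)) - (((D : ℝ) / n) ^ l - d ^ l)) / s ^ l := by
      field_simp
      ring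
    rw [h5, abs_div, div_lt_iff₀ (abs_pos.2 hsl), abs_pow]
    have h6 : (1 : ℝ) ≤ |s| ^ l := one_le_pow₀ hs
    calc _ ≤ |(N l : ℝ) - (d ^ l + κ * s ^ l)| + |((D : ℝ) / n) ^ l - d ^ l| := abs_sub _ _
      _ < δ * |s| ^ l + δ := add_lt_add h3 h4
      _ ≤ 2 * δ * |s| ^ l := by nlinarith
  obtain ⟨x, hx, hxN⟩ := key (2 * j) (Or.inl rfl)
  obtain ⟨z, hz, hzN⟩ := key (2 * j + 1) (Or.inr (Or.inl rfl))
  obtain ⟨y, hy, hyN⟩ := key (4 * j) (Or.inr (Or.inr rfl))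
  have hx0 : 0 < x := by rw [abs_lt] at hx; linarith
  have hy0 : 0 < y := by rw [abs_lt] at hy; linarith
  have ht : 0 < s ^ (2 * j) := by
    rw [pow_mul]
    positivity
  have ht2 : s ^ (4 * j) = (s ^ (2 * j)) ^ 2 := by ring
  have hr := cast_excess hn ht hx0 hxN
  rw [ht2] at hyN
  have hr₂ := cast_excess hn (by positivity) hy0 hyN
  have hK : kHat (excess n D (N (2 * j)) (2 * j)) (excess n D (N (4 * j)) (4 * j)) = k := by
    refine cast_kHat (m := 2 * j) (by omega) hn ht hy0 hr (by rw [hr₂]; ring_nf) ?_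
    have := h1 (x := (x, y)) (by
      rw [Prod.dist_eq, Real.dist_eq, Real.dist_eq]
      exact max_lt (by linarith) (by linarith))
    rwa [Real.dist_eq, sq κ, mul_div_cancel_left₀ _ hκ.ne'] at this
  rw [pow_succ s] at hzN
  have hB := cast_bNum_div hn ht hx0 hr hzN
  have hbb : |(D : ℝ) / n - s * z / x - b| < ε / (2 * k) := by
    have := h2 (x := ((D : ℝ) / n, z, x)) (by
      rw [Prod.dist_eq, Prod.dist_eq, Real.dist_eq, Real.dist_eq, Real.dist_eq]
      exact max_lt (by linarith) (max_lt (by linarith) (by linarith)))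
    rw [Real.dist_eq, mul_div_cancel_right₀ _ hκ.ne'] at this
    rwa [hbd]
  have hb' := (abs_max_zero_sub_le hb0).trans_lt hbb
  have hA := cast_aNum_div (D := D) (K := k) (by omega) hn ht hx0 hr hB
  set β := max 0 ((D : ℝ) / n - s * z / x) with hβ
  refine ⟨?_, ?_, hK⟩
  · simp only [estimateOf, hK]
    rw [Rat.cast_div, Rat.cast_natCast, Rat.cast_natCast, hA]
    refine (abs_max_zero_sub_le ha0).trans_lt ?_
    have h7 : (k : ℝ) * ((D : ℝ) / n) - (k - 1) * β - a =
        k * ((D : ℝ) / n - d) - (k - 1) * (β - b) := by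
      rw [had, hbd]
      ring
    have h8 : (k : ℝ) * (ε / (2 * k)) = ε / 2 := by field_simp
    rw [h7]
    calc _ ≤ |k * ((D : ℝ) / n - d)| + |(k - 1) * (β - b)| := abs_sub _ _
      _ = k * |(D : ℝ) / n - d| + (k - 1) * |β - b| := by
          rw [abs_mul, abs_mul, abs_of_pos hκ, abs_of_nonneg (by positivity : (0 : ℝ) ≤ k)]
      _ < k * (ε / (2 * k)) + k * (ε / (2 * k)) := by
          refine add_lt_add (mul_lt_mul_of_pos_left (hD.trans_le e4) (by positivity)) ?_
          refine mul_lt_mul'' (by linarith) hb' hκ.le (abs_nonneg _)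
      _ = ε := by rw [h8]; ring
  · simp only [estimateOf]
    rw [Rat.cast_div, Rat.cast_natCast, Rat.cast_natCast, hB]
    refine hb'.trans_le (div_le_self hε.le ?_)
    linarith

end Estimator

/-! ### Growth of the length of the walks -/

section Growth

theorem tendsto_size_atTop : Tendsto Nat.size atTop atTop :=
  tendsto_atTop.2 fun b => by
    filter_upwards [eventually_ge_atTop (2 ^ b)] with n hn
    exact (Nat.lt_size.2 hn).le

theorem tendsto_scale_atTop : Tendsto scale atTop atTop :=
  tendsto_atTop_mono (fun _ => Nat.le_succ _) (tendsto_size_atTop.comp tendsto_size_atTop)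

/-- A number with p digits is at least 2^(p - 1), applied to n and to its number of digits. So n is
doubly exponential in `scale n`. -/
theorem two_pow_le_of_scale {n : ℕ} (h : 2 ≤ scale n) : 2 ^ (2 ^ (scale n - 2) - 1) ≤ n := by
  have h1 : 2 ^ (scale n - 2) ≤ Nat.size n := by
    rw [← Nat.lt_size]
    simp only [scale] at h ⊢
    omega
  rw [← Nat.lt_size]
  have : 0 < 2 ^ (scale n - 2) := by positivity
  omega

/-- The left-hand side is the exponent of (2^j)^(8 j) · 2^j, which has to be at most n. -/
theorem eventually_sq_le : ∀ᶠ j : ℕ in atTop, 8 * j ^ 2 + j ≤ 2 ^ (j - 2) - 1 := by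
  have h := (tendsto_pow_const_div_const_pow_of_one_lt 2 (one_lt_two (α := ℝ))).eventually
    -- 8 j² + j + 1 ≤ 10 j² and 2^j = 4 · 2^(j - 2), whence 40.
    (gt_mem_nhds (show (0 : ℝ) < 1 / 40 by norm_num))
  filter_upwards [h, eventually_ge_atTop 2] with j hj hj2
  rw [div_lt_iff₀ (by positivity)] at hj
  have h2 : 40 * j ^ 2 < 2 ^ j := by
    have : (40 : ℝ) * (j : ℝ) ^ 2 < 2 ^ j := by linarith
    exact_mod_cast this
  have h3 : 2 ^ j = 4 * 2 ^ (j - 2) := by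
    conv_lhs => rw [← Nat.sub_add_cancel hj2]
    ring
  have h4 : j ≤ j ^ 2 := Nat.le_self_pow (by norm_num) j
  have h5 : 1 ≤ j ^ 2 := Nat.one_le_pow _ _ (by omega)
  omega

/-- Everything that the error bounds depend on is negligible compared to `n`. -/
theorem tendsto_scale_pow_div (B : ℝ) (hB : 0 ≤ B) :
    Tendsto (fun n : ℕ => (B * (4 * scale n : ℕ)) ^ (2 * (4 * scale n)) / n) atTop (𝓝 0) := by
  have hlin := (tendsto_pow_const_div_const_pow_of_one_lt 1 (one_lt_two (α := ℝ))).eventually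
    (gt_mem_nhds (show (0 : ℝ) < 1 / (4 * B + 1) by positivity))
  have hev : ∀ᶠ n : ℕ in atTop,
      (B * (4 * scale n : ℕ)) ^ (2 * (4 * scale n)) / n ≤ (1 / 2 : ℝ) ^ scale n := by
    filter_upwards [tendsto_scale_atTop.eventually hlin,
      tendsto_scale_atTop.eventually eventually_sq_le,
      tendsto_scale_atTop.eventually (eventually_ge_atTop 2), eventually_gt_atTop 0]
      with n h1 h2 h3 h4
    have hn := two_pow_le_of_scale h3
    set j := scale n with hj
    have hn0 : (0 : ℝ) < n := by exact_mod_cast h4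
    -- The base is at most 2^j and the exponent is 8 j, so the power is at most 2^(8 j²). By `h6`
    -- this is at most 2^(-j) n.
    have h5 : B * (4 * j : ℕ) ≤ 2 ^ j := by
      rw [pow_one, div_lt_div_iff₀ (by positivity) (by positivity)] at h1
      push_cast
      have : (0 : ℝ) ≤ j := by positivity
      nlinarith
    have h6 : (2 : ℝ) ^ (8 * j ^ 2 + j) ≤ n := by
      have := (Nat.pow_le_pow_right (by norm_num : 0 < 2) h2).trans hn
      exact_mod_cast this
    rw [div_le_iff₀ hn0]
    calc (B * (4 * j : ℕ)) ^ (2 * (4 * j)) ≤ ((2 : ℝ) ^ j) ^ (2 * (4 * j)) := by gcongr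
      _ = (1 / 2 : ℝ) ^ j * 2 ^ (8 * j ^ 2 + j) := by
          rw [one_div, inv_pow, pow_add, mul_comm (2 ^ (8 * j ^ 2) : ℝ),
            inv_mul_cancel_left₀ (by positivity), ← pow_mul]
          congr 1
          ring
      _ ≤ (1 / 2 : ℝ) ^ j * n := by gcongr
  refine squeeze_zero' (Eventually.of_forall fun n => by positivity) hev ?_
  exact (tendsto_pow_atTop_nhds_zero_of_lt_one (by norm_num) (by norm_num)).comp
    tendsto_scale_atTop

/-- With j = `scale n` one has log n ≥ 2^j / 16, hence (log n)^(1/4) ≥ r^j / 2 for r = 2^(1/4) > 1,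
while the left-hand side is linear in j. -/
theorem scale_isLittleO : (fun n : ℕ => ((4 * scale n : ℕ) : ℝ)) =o[atTop]
    fun n : ℕ => Real.log n ^ (1 / 4 : ℝ) := by
  set r : ℝ := 2 ^ (1 / 4 : ℝ) with hr
  have hr1 : 1 < r := Real.one_lt_rpow (by norm_num) (by norm_num)
  have h1 : (fun n : ℕ => ((4 * scale n : ℕ) : ℝ)) =o[atTop] fun n : ℕ => r ^ scale n := by
    have := ((isLittleO_coe_const_pow_of_one_lt (R := ℝ) hr1).const_mul_left 4).comp_tendsto
      tendsto_scale_atTop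
    simpa [Function.comp_def] using this
  refine h1.trans_isBigO (IsBigO.of_bound 2 ?_)
  filter_upwards [tendsto_scale_atTop.eventually (eventually_ge_atTop 3)] with n h3
  have hn := two_pow_le_of_scale (by omega : 2 ≤ scale n)
  set j := scale n with hj
  have h4 : 2 ^ (j - 3) ≤ 2 ^ (j - 2) - 1 := by
    have h5 : 2 ^ (j - 2) = 2 * 2 ^ (j - 3) := by
      rw [show j - 2 = (j - 3) + 1 by omega]
      ring
    have : 1 ≤ 2 ^ (j - 3) := Nat.one_le_two_pow
    omega
  have h5 : (2 : ℝ) ^ (2 ^ (j - 3)) ≤ n := by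
    have := (Nat.pow_le_pow_right (by norm_num : 0 < 2) h4).trans hn
    exact_mod_cast this
  have h6 : (2 : ℝ) ^ j / 16 ≤ Real.log n := by
    have h7 := Real.log_le_log (by positivity) h5
    rw [Real.log_pow] at h7
    have h8 : (2 : ℝ) ^ j = 8 * 2 ^ (j - 3) := by
      conv_lhs => rw [← Nat.sub_add_cancel h3]
      ring
    have h9 := Real.log_two_gt_d9
    have h10 : (0 : ℝ) < 2 ^ (j - 3) := by positivity
    push_cast at h7
    rw [h8]
    nlinarith
  have h7 : r ^ j = 2 * ((2 : ℝ) ^ j / 16) ^ (1 / 4 : ℝ) := by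
    rw [Real.div_rpow (by positivity) (by norm_num), hr, ← Real.rpow_natCast, ← Real.rpow_natCast,
      ← Real.rpow_mul (by norm_num), ← Real.rpow_mul (by norm_num),
      show (16 : ℝ) = 2 ^ (4 : ℝ) by norm_num, ← Real.rpow_mul (by norm_num), mul_comm (j : ℝ)]
    norm_num
    ring
  rw [Real.norm_of_nonneg (by positivity), Real.norm_of_nonneg
    (Real.rpow_nonneg ((by positivity : (0 : ℝ) ≤ 2 ^ j / 16).trans h6) _), h7]
  gcongr

end Growth

/-! ### Consistency -/

section Consistency

variable {n k : ℕ}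

/-- The second eigenvalue. -/
def secondEigenvalue (k : ℕ) (a b : ℝ) : ℝ := (a - b) / k

theorem meanCycles_eq [NeZero k] (a b : ℝ) (m : ℕ) :
    meanCycles k a b m = avgDegree k a b ^ m + (k - 1) * secondEigenvalue k a b ^ m := by
  rw [meanCycles, trace_commMatrix_pow, avgDegree, secondEigenvalue, div_pow, div_pow, div_pow,
    one_pow]
  ring

/-- A deviation of T forces a deviation T / 2 of the number of cycles (Chebyshev) or at least T / 2
walks that are not cycles (Markov). -/
theorem expect_deviation_le [NeZero k] {m : ℕ} [NeZero m] (hm : 3 ≤ m) {a b C T : ℝ}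
    (ha0 : 0 ≤ a) (hb0 : 0 ≤ b) (ha : a ≤ C) (hb : b ≤ C) (hC : 1 ≤ C) (hn : C ≤ n) (hT : 0 < T) :
    expect n k a b (fun x =>
      if T ≤ |(closedNonbacktrackingCount x.2 m : ℝ) - meanCycles k a b m| then 1 else 0) ≤
      4 / T ^ 2 * (2 * m * meanCycles k a b m + (C * (2 * m)) ^ (2 * m) / n +
        2 * meanCycles k a b m ^ 2 * m ^ 2 / n) +
      2 / T * (∑ t ∈ Finset.Ico 2 (m / 2), meanCycles k a b (t + 1) + (C * m) ^ m / n) := by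
  set μ := meanCycles k a b m with hμ
  have h1 := expect_indicator_le (a := a) (b := b) (n := n) (k := k) (t := (T / 2) ^ 2)
    (by positivity) (f := fun x => (cycleCount m x.2 - μ) ^ 2) fun x => sq_nonneg _
  have h2 := expect_indicator_le (a := a) (b := b) (n := n) (k := k) (t := T / 2)
    (by positivity) (f := fun x => closedNonbacktrackingCount x.2 m - cycleCount m x.2)
    fun x => sub_nonneg.2 (cycleCount_le_closedNonbacktrackingCount hm x.2)
  have h3 := expect_cycleCount_sub_sq_le (k := k) hm ha0 hb0 ha hb hC hn
  have h4 := expect_closedNonbacktrackingCount_sub_le (k := k) (m := m) ha0 hb0 ha hb hC hn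
  have h5 : expect n k a b (fun x =>
      if T ≤ |(closedNonbacktrackingCount x.2 m : ℝ) - μ| then 1 else 0) ≤
      expect n k a b (fun x => if (T / 2) ^ 2 ≤ (cycleCount m x.2 - μ) ^ 2 then 1 else 0) +
      expect n k a b (fun x =>
        if T / 2 ≤ closedNonbacktrackingCount x.2 m - cycleCount m x.2 then 1 else 0) := by
    rw [← expect_add]
    refine expect_mono a b fun x => ?_
    have hle := cycleCount_le_closedNonbacktrackingCount hm x.2
    split_ifs with e1 e2 e3 e3 e2 e3 e3 <;> norm_num
    · push Not at e2 e3
      have e4 := abs_lt_of_sq_lt_sq e2 (by positivity)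
      have e5 := abs_add_le (closedNonbacktrackingCount x.2 m - cycleCount m x.2)
        (cycleCount m x.2 - μ)
      rw [sub_add_sub_cancel, abs_of_nonneg (sub_nonneg.2 hle)] at e5
      linarith
  refine h5.trans (add_le_add (h1.trans ?_) (h2.trans ?_))
  · rw [div_le_iff₀ (by positivity)]
    refine h3.trans_eq ?_
    field_simp
    ring
  · rw [div_le_iff₀ (by positivity)]
    refine h4.trans_eq ?_
    field_simp

-- At the scale T = δ |s|^m and with ρ = √d / |s|, the variance 2 m k d^m contributes a multiple of
-- m ρ^(2m), and the repeated cycles, at most m k (√d)^m in number on average, a multiple of m ρ^m.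
-- Everything with a factor 1 / n goes into (B M)^(2M) / n. This is where SNR > 1 enters: it means ρ
-- < 1.
set_option maxHeartbeats 1000000 in
theorem expect_deviation_le' [NeZero k] {m M : ℕ} [NeZero m] (hm : 3 ≤ m) (hmM : m ≤ M)
    {a b C d s δ B : ℝ} (ha0 : 0 ≤ a) (hb0 : 0 ≤ b) (ha : a ≤ C) (hb : b ≤ C) (hC : 1 ≤ C)
    (hn : C ≤ n) (hd : d = avgDegree k a b) (hs : s = secondEigenvalue k a b) (hδ : 0 < δ)
    (hd1 : 1 < d) (hsd : |s| ≤ d) (hs1 : 1 ≤ |s|) (hB : 2 * C * k * d ≤ B)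
    (hsnr : Real.sqrt d ≤ |s|) :
    expect n k a b (fun x =>
      if δ * |s| ^ m ≤ |(closedNonbacktrackingCount x.2 m : ℝ) - (d ^ m + (k - 1) * s ^ m)|
        then 1 else 0) ≤
      (8 * k / δ ^ 2 + 2 * k / δ) * (m * (Real.sqrt d / |s|) ^ m) +
        (8 / δ ^ 2 + 2 / δ) * ((B * M) ^ (2 * M) / n) := by
  have hk : (1 : ℝ) ≤ k := by exact_mod_cast NeZero.one_le
  have hn0 : (0 : ℝ) < n := by linarith
  have hs0 : 0 < |s| := by linarith
  have hm1 : (1 : ℝ) ≤ m := by exact_mod_cast (by omega : 1 ≤ m)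
  have hM1 : (m : ℝ) ≤ M := by exact_mod_cast hmM
  have hμ : ∀ l, meanCycles k a b l ≤ k * d ^ l := fun l => by
    rw [meanCycles_eq, ← hd, ← hs]
    have h1 : s ^ l ≤ d ^ l := by
      calc s ^ l ≤ |s ^ l| := le_abs_self _
        _ = |s| ^ l := abs_pow _ _
        _ ≤ d ^ l := by gcongr
    nlinarith
  have hμ0 := meanCycles_nonneg (k := k) ha0 hb0 m
  have hdev := expect_deviation_le (k := k) hm ha0 hb0 ha hb hC hn
    (T := δ * |s| ^ m) (by positivity)
  rw [meanCycles_eq, ← hd, ← hs] at hdev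
  refine hdev.trans ?_
  rw [hd, hs, ← meanCycles_eq, ← hd, ← hs]
  set μ := meanCycles k a b m with hμd
  set ρ := Real.sqrt d / |s| with hρ
  have hρ0 : 0 ≤ ρ := by positivity
  have hρ1 : ρ ≤ 1 := (div_le_one hs0).2 hsnr
  have hsq : Real.sqrt d ^ 2 = d := Real.sq_sqrt (by linarith)
  have hsq1 : 1 ≤ Real.sqrt d := Real.one_le_sqrt.2 hd1.le
  set X := (B * M) ^ (2 * M) with hX
  -- The bases that occur are 2 C, 2 k d and C. All of them are at most 2 C k d, which explains the
  -- assumption on `B`.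
  have hBM : ∀ y : ℝ, 0 ≤ y → y ≤ 2 * C * k * d → (y * m) ^ (2 * m) ≤ X := by
    intro y hy0 hy
    have h1 : (1 : ℝ) ≤ 2 * C * k * d := by
      have : (1 : ℝ) ≤ C * k := one_le_mul_of_one_le_of_one_le hC hk
      nlinarith
    have h2 : (1 : ℝ) ≤ B * M := by nlinarith
    calc (y * m) ^ (2 * m) ≤ (B * M) ^ (2 * m) := by
          refine pow_le_pow_left₀ (by positivity) ?_ _
          exact mul_le_mul (hy.trans hB) hM1 (by positivity) (by linarith)
      _ ≤ X := pow_le_pow_right₀ h2 (by omega)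
  have hCk : C ≤ C * (k * d) := le_mul_of_one_le_right (by linarith)
    (one_le_mul_of_one_le_of_one_le hk hd1.le)
  have hX1 : (C * (2 * m)) ^ (2 * m) ≤ X := by
    have := hBM (2 * C) (by linarith) (by linarith)
    rwa [mul_comm 2 C, mul_assoc] at this
  have hX2 : 2 * μ ^ 2 * m ^ 2 ≤ X := by
    have h1 : μ ^ 2 ≤ (k * d ^ m) ^ 2 := pow_le_pow_left₀ hμ0 (hμ m) 2
    have hkm : (1 : ℝ) ≤ 2 * k * m := by nlinarith
    calc 2 * μ ^ 2 * m ^ 2 ≤ 2 * (k * d ^ m) ^ 2 * m ^ 2 := by gcongr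
      _ ≤ (2 * k * m) ^ 2 * d ^ (2 * m) := by
          have : 0 ≤ (k * d ^ m) ^ 2 * (m : ℝ) ^ 2 := by positivity
          rw [pow_mul']
          linarith
      _ ≤ (2 * k * m) ^ (2 * m) * d ^ (2 * m) := by
          refine mul_le_mul_of_nonneg_right ?_ (by positivity)
          exact pow_le_pow_right₀ hkm (by omega)
      _ = (2 * k * d * m) ^ (2 * m) := by
          rw [← mul_pow]
          ring
      _ ≤ X := by
          refine hBM (2 * k * d) (by positivity) ?_
          have : 0 ≤ k * d := by positivity
          nlinarith
  have hX3 : (C * m) ^ m ≤ X := by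
    have h1 : (1 : ℝ) ≤ C * m := one_le_mul_of_one_le_of_one_le hC hm1
    exact (pow_le_pow_right₀ h1 (by omega : m ≤ 2 * m)).trans
      (hBM C (by linarith) (by linarith))
  have hX0 : 0 ≤ X := le_trans (by positivity) hX3
  -- Since t + 1 ≤ m / 2, one has d^(t + 1) ≤ (√d)^m.
  have hsum : ∑ t ∈ Finset.Ico 2 (m / 2), meanCycles k a b (t + 1) ≤ m * (k * Real.sqrt d ^ m) := by
    calc _ ≤ ∑ _t ∈ Finset.Ico 2 (m / 2), k * Real.sqrt d ^ m := by
          refine Finset.sum_le_sum fun t ht => (hμ _).trans ?_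
          refine mul_le_mul_of_nonneg_left ?_ (by positivity)
          conv_lhs => rw [← hsq, ← pow_mul]
          refine pow_le_pow_right₀ hsq1 ?_
          have := (Finset.mem_Ico.1 ht).2
          omega
      _ ≤ _ := by
          rw [Finset.sum_const, nsmul_eq_mul]
          refine mul_le_mul_of_nonneg_right ?_ (by positivity)
          rw [Nat.card_Ico]
          exact_mod_cast (by omega : m / 2 - 2 ≤ m)
  have hsm : (1 : ℝ) ≤ |s| ^ m := one_le_pow₀ hs1
  have hT1 : 4 / (δ * |s| ^ m) ^ 2 ≤ 4 / δ ^ 2 := by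
    refine div_le_div_of_nonneg_left (by norm_num) (by positivity) ?_
    refine pow_le_pow_left₀ hδ.le (le_mul_of_one_le_right hδ.le hsm) 2
  have hT2 : 2 / (δ * |s| ^ m) ≤ 2 / δ :=
    div_le_div_of_nonneg_left (by norm_num) hδ (le_mul_of_one_le_right hδ.le hsm)
  have hterm1 : 4 / (δ * |s| ^ m) ^ 2 * (2 * m * μ) ≤ 8 * k / δ ^ 2 * (m * ρ ^ m) := by
    calc _ ≤ 4 / (δ * |s| ^ m) ^ 2 * (2 * m * (k * d ^ m)) := by
          have := hμ m
          gcongr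
      _ = 8 * k / δ ^ 2 * (m * (ρ ^ m) ^ 2) := by
          rw [hρ, div_pow, div_pow, ← pow_mul, mul_comm m 2, pow_mul (Real.sqrt d), hsq]
          field_simp
          ring
      _ ≤ _ := by
          have h1 : (ρ ^ m) ^ 2 ≤ ρ ^ m := by
            have h2 : ρ ^ m ≤ 1 := pow_le_one₀ hρ0 hρ1
            have h3 : 0 ≤ ρ ^ m := by positivity
            nlinarith
          gcongr
  have hterm2 : 2 / (δ * |s| ^ m) * (m * (k * Real.sqrt d ^ m)) = 2 * k / δ * (m * ρ ^ m) := by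
    rw [hρ, div_pow]
    field_simp
  calc _ ≤ 4 / (δ * |s| ^ m) ^ 2 * (2 * m * μ) + 4 / δ ^ 2 * (X / n + X / n) +
        (2 / (δ * |s| ^ m) * (m * (k * Real.sqrt d ^ m)) + 2 / δ * (X / n)) := by
        rw [add_assoc (2 * m * μ), mul_add, mul_add (2 / (δ * |s| ^ m))]
        gcongr
    _ ≤ _ := by
        rw [hterm2]
        have h1 : 4 / δ ^ 2 * (X / n + X / n) = 8 / δ ^ 2 * (X / n) := by ring
        rw [h1]
        linarith

end Consistency

/-! ### Accuracy of the average degree and assembly of the consistency proof. -/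

section Consistency

variable {n k : ℕ}

/-- Taking the l-th power magnifies an error in d by at most the factor M (d + 1)^M. -/
theorem abs_pow_sub_pow_lt {x d η δ : ℝ} {l M : ℕ} (hd : 1 ≤ d) (hM : 1 ≤ M) (hlM : l ≤ M)
    (hη : η ≤ 1) (hηδ : η * (M * (d + 1) ^ M) ≤ δ) (h : |x - d| < η) :
    |x ^ l - d ^ l| < δ := by
  have h1 := abs_pow_sub_pow_le x d l
  have hx : |x| ≤ d + 1 := by
    have := abs_sub_abs_le_abs_sub x d
    rw [abs_of_nonneg (by linarith : (0 : ℝ) ≤ d)] at this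
    linarith
  have h2 : max |x| |d| ≤ d + 1 := max_le hx (by rw [abs_of_nonneg] <;> linarith)
  have h3 : max |x| |d| ^ (l - 1) ≤ (d + 1) ^ M :=
    (pow_le_pow_left₀ ((abs_nonneg _).trans (le_max_left _ _)) h2 _).trans
      (pow_le_pow_right₀ (by linarith) (by omega))
  have hM0 : (0 : ℝ) < M := by exact_mod_cast hM
  calc _ ≤ |x - d| * l * max |x| |d| ^ (l - 1) := h1
    _ ≤ |x - d| * M * (d + 1) ^ M := by
        have : (l : ℝ) ≤ M := by exact_mod_cast hlM
        gcongr
    _ < η * M * (d + 1) ^ M := by gcongr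
    _ ≤ δ := by rw [mul_assoc]; exact hηδ

/-- The sum of the degrees divided by `n` is close to the limiting average degree. -/
theorem expect_edge_deviation_le [NeZero k] {a b C η : ℝ} (ha0 : 0 ≤ a) (hb0 : 0 ≤ b)
    (ha : a ≤ C) (hb : b ≤ C) (hn : C ≤ n) (hn1 : 1 ≤ n) (hη : 0 < η)
    (hd : 1 ≤ avgDegree k a b) :
    expect n k a b (fun x =>
      if η ≤ |((2 * x.2.edgeSet.ncard : ℕ) : ℝ) / n - avgDegree k a b| then 1 else 0) ≤
      6 * avgDegree k a b ^ 2 / (n * η ^ 2) := by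
  have hn0 : (1 : ℝ) ≤ n := by exact_mod_cast hn1
  set d := avgDegree k a b with hdd
  have h1 := expect_indicator_le (a := a) (b := b) (n := n) (k := k) (t := η ^ 2)
    (by positivity) (f := fun x => ((2 * x.2.edgeFinset.card : ℝ) / n - d) ^ 2) fun x => sq_nonneg _
  have h2 := expect_edge_sub_sq_le (k := k) ha0 hb0 ha hb hn
  rw [← hdd] at h2
  have h3 : ∀ x : (Fin n → Fin k) × SimpleGraph (Fin n),
      (if η ≤ |((2 * x.2.edgeSet.ncard : ℕ) : ℝ) / n - d| then (1 : ℝ) else 0) =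
      if η ^ 2 ≤ ((2 * x.2.edgeFinset.card : ℝ) / n - d) ^ 2 then 1 else 0 := by
    intro x
    refine if_congr ?_ rfl rfl
    rw [Set.ncard_eq_toFinset_card', Nat.cast_mul, Nat.cast_two, sq_le_sq, abs_of_pos hη]
    rfl
  simp only [h3]
  refine h1.trans ?_
  rw [div_le_iff₀ (by positivity)]
  have h4 : 6 * d ^ 2 / (n * η ^ 2) * η ^ 2 = 4 * d ^ 2 / n + 2 * d ^ 2 / n := by
    field_simp
    ring
  rw [h4]
  refine h2.trans (add_le_add ?_ ?_)
  · gcongr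
    nlinarith
  · gcongr
    exact le_self_pow₀ hn0 (by norm_num)

/-- The union bound over the four bad events: one for the edges and one for each of the three
lengths. -/
theorem indicator_compl_le {P Q₀ Q₁ Q₂ Q₃ : Prop} (h : ¬ Q₀ → ¬ Q₁ → ¬ Q₂ → ¬ Q₃ → P) :
    1 - ((if Q₀ then (1 : ℝ) else 0) + (if Q₁ then 1 else 0) + (if Q₂ then 1 else 0) +
      (if Q₃ then 1 else 0)) ≤ if P then 1 else 0 := by
  by_cases hP : P
  · rw [if_pos hP]
    split_ifs <;> norm_num
  · rw [if_neg hP]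
    split_ifs with h0 h1 h2 h3
    any_goals norm_num
    exact hP (h ‹_› ‹_› ‹_› ‹_›)

/-- Above the threshold the second eigenvalue dominates the square root of the first one. -/
theorem eigenvalue_bounds [NeZero k] {a b : ℝ} (hk : 2 ≤ k) (ha0 : 0 ≤ a) (hb0 : 0 ≤ b)
    (h : 1 < snr k a b) : 1 < avgDegree k a b ∧ |secondEigenvalue k a b| ≤ avgDegree k a b ∧
      Real.sqrt (avgDegree k a b) < |secondEigenvalue k a b| := by
  have hk2 : (2 : ℝ) ≤ k := by exact_mod_cast hk
  have hk0 : (0 : ℝ) < k := by linarith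
  have hkb : 0 ≤ (k - 1) * b := mul_nonneg (by linarith) hb0
  -- If the denominator vanished, `snr` would be 0 by the convention for division by zero.
  have hpos : 0 < a + (k - 1) * b := by
    by_contra! h0
    have : a + (k - 1) * b = 0 := by linarith
    rw [snr, this] at h
    norm_num at h
  have hle : |secondEigenvalue k a b| ≤ avgDegree k a b := by
    rw [secondEigenvalue, avgDegree, abs_div, abs_of_pos hk0]
    refine div_le_div_of_nonneg_right (abs_le.2 ⟨?_, ?_⟩) hk0.le
    · nlinarith
    · nlinarith
  have hd0 : 0 < avgDegree k a b := div_pos hpos hk0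
  have hlt : avgDegree k a b < secondEigenvalue k a b ^ 2 := by
    rw [snr, lt_div_iff₀ (by positivity)] at h
    rw [avgDegree, secondEigenvalue, div_pow, div_lt_div_iff₀ hk0 (by positivity)]
    nlinarith
  -- d < s² ≤ d² gives d > 1.
  refine ⟨?_, hle, ?_⟩
  · rw [← sq_abs] at hlt
    have : |secondEigenvalue k a b| ^ 2 ≤ avgDegree k a b ^ 2 :=
      pow_le_pow_left₀ (abs_nonneg _) hle 2
    nlinarith
  · rw [Real.sqrt_lt' ((Real.sqrt_nonneg _).trans_lt (by
      rw [← Real.sqrt_sq_eq_abs]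
      exact Real.sqrt_lt_sqrt hd0.le hlt)), sq_abs]
    exact hlt

theorem estimator_isConsistentAt [NeZero k] {a b : ℝ} (hk : 2 ≤ k) (ha0 : 0 ≤ a) (hb0 : 0 ≤ b)
    (h : 1 < snr k a b) : IsConsistentAt estimator k a b := by
  intro ε hε
  obtain ⟨hd1, hsd, hds⟩ := eigenvalue_bounds hk ha0 hb0 h
  set d := avgDegree k a b with hd
  set s := secondEigenvalue k a b with hs
  have hk0 : (k : ℝ) ≠ 0 := by exact_mod_cast NeZero.ne k
  have hk1 : (1 : ℝ) ≤ k := by exact_mod_cast NeZero.one_le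
  have hsqrt1 : 1 < Real.sqrt d := Real.lt_sqrt_of_sq_lt (by simpa using hd1)
  have hs1 : 1 ≤ |s| := (hsqrt1.trans hds).le
  obtain ⟨δ, hδ, hclose⟩ := estimateOf_close hk ha0 hb0
    (show a = d + (k - 1) * s by rw [hd, hs, avgDegree, secondEigenvalue]; field_simp; ring)
    (show b = d - s by rw [hd, hs, avgDegree, secondEigenvalue]; field_simp; ring) hs1 hε
  set C := max (max a b) 1 with hC
  have ha : a ≤ C := (le_max_left _ _).trans (le_max_left _ _)
  have hb : b ≤ C := (le_max_right _ _).trans (le_max_left _ _)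
  have hC1 : 1 ≤ C := le_max_right _ _
  -- Large enough to dominate both 2 C k d, for the walks, and d + 1, for the powers of the average
  -- degree.
  set B := 2 * C * k * (d + 1) with hB
  set M : ℕ → ℕ := fun n => 4 * scale n with hM
  set X : ℕ → ℝ := fun n => (B * M n) ^ (2 * M n) / n with hX
  set ρ := Real.sqrt d / |s| with hρ
  have hρ0 : 0 ≤ ρ := by positivity
  have hρ1 : ρ < 1 := (div_lt_one (by linarith)).2 hds
  set δ' := min δ 1 with hδ'
  have hδ'0 : 0 < δ' := by positivity
  set K₁ := 8 * k / δ ^ 2 + 2 * k / δ with hK₁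
  set K₂ := 8 / δ ^ 2 + 2 / δ with hK₂
  set F : ℕ → ℝ := fun m => K₁ * (m * ρ ^ m) with hF
  set err : ℕ → ℝ := fun n => 6 * d ^ 2 / δ' ^ 2 * X n + (F (2 * scale n) + K₂ * X n) +
    (F (2 * scale n + 1) + K₂ * X n) + (F (4 * scale n) + K₂ * X n) with herr
  have hFlim : Tendsto F atTop (𝓝 0) := by
    have := (tendsto_self_mul_const_pow_of_lt_one hρ0 hρ1).const_mul K₁
    rwa [mul_zero] at this
  have hXlim : Tendsto X atTop (𝓝 0) := tendsto_scale_pow_div B (by positivity)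
  have hsc : Tendsto (fun n => 2 * scale n) atTop atTop :=
    tendsto_atTop_mono (fun n => by omega) tendsto_scale_atTop
  have hsc1 : Tendsto (fun n => 2 * scale n + 1) atTop atTop :=
    tendsto_atTop_mono (fun n => by omega) tendsto_scale_atTop
  have hsc2 : Tendsto (fun n => 4 * scale n) atTop atTop :=
    tendsto_atTop_mono (fun n => by omega) tendsto_scale_atTop
  have herrlim : Tendsto err atTop (𝓝 0) := by
    have := (((hXlim.const_mul (6 * d ^ 2 / δ' ^ 2)).add
      ((hFlim.comp hsc).add (hXlim.const_mul K₂))).add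
      ((hFlim.comp hsc1).add (hXlim.const_mul K₂))).add
      ((hFlim.comp hsc2).add (hXlim.const_mul K₂))
    simpa [herr, Function.comp_def] using this
  have hbound : ∀ᶠ n : ℕ in atTop, ENNReal.ofReal (1 - err n) ≤ (sbm n k a b).toOuterMeasure
      {x | |((estimator n x.2).a : ℝ) - a| < ε ∧ |((estimator n x.2).b : ℝ) - b| < ε ∧
        (estimator n x.2).k = k} := by
    filter_upwards [tendsto_natCast_atTop_atTop.eventually (eventually_ge_atTop C),
      eventually_ge_atTop 1, tendsto_scale_atTop.eventually (eventually_ge_atTop 2)]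
      with n hnC hn1 hj
    generalize hS : {x : (Fin n → Fin k) × SimpleGraph (Fin n) | |((estimator n x.2).a : ℝ) - a| < ε ∧
      |((estimator n x.2).b : ℝ) - b| < ε ∧ (estimator n x.2).k = k} = S
    rw [toOuterMeasure_eq]
    refine ENNReal.ofReal_le_ofReal ?_
    have hn0 : (0 : ℝ) < n := by exact_mod_cast hn1
    set j := scale n with hjd
    have hMn : M n = 4 * j := rfl
    have hM1 : (1 : ℝ) ≤ M n := by exact_mod_cast (by omega : 1 ≤ M n)
    have hdM : (1 : ℝ) ≤ (d + 1) ^ M n := one_le_pow₀ (by linarith)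
    -- The accuracy in d that makes all powers up to `M n` accurate to `δ`. It tends to 0 so slowly
    -- that 1 / (n η²) is still bounded by a multiple of `X n`.
    set η := δ' / (M n * (d + 1) ^ M n) with hη
    have hη0 : 0 < η := by positivity
    have hηδ' : η ≤ δ' := div_le_self hδ'0.le (one_le_mul_of_one_le_of_one_le hM1 hdM)
    have hη1 : η ≤ 1 := hηδ'.trans (min_le_right _ _)
    have hηδ : η ≤ δ := hηδ'.trans (min_le_left _ _)
    have hBd : 2 * C * k * d ≤ B := by
      rw [hB]
      gcongr
      linarith
    have hdev : ∀ l, 3 ≤ l → l ≤ M n → expect n k a b (fun x =>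
        if δ * |s| ^ l ≤ |(closedNonbacktrackingCount x.2 l : ℝ) - (d ^ l + (k - 1) * s ^ l)|
          then 1 else 0) ≤ F l + K₂ * X n := fun l hl hlM => by
      have : NeZero l := ⟨by omega⟩
      exact expect_deviation_le' hl hlM ha0 hb0 ha hb hC1 hnC hd hs hδ hd1 hsd hs1 hBd hds.le
    have hedge := expect_edge_deviation_le (k := k) ha0 hb0 ha hb hnC hn1 hη0 hd1.le
    have hedge' : 6 * d ^ 2 / (n * η ^ 2) ≤ 6 * d ^ 2 / δ' ^ 2 * X n := by
      have h1 : (M n * (d + 1) ^ M n) ^ 2 ≤ (B * M n) ^ (2 * M n) := by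
        have h2 : d + 1 ≤ B := by
          rw [hB]
          refine le_mul_of_one_le_left (by linarith) ?_
          have := one_le_mul_of_one_le_of_one_le hC1 hk1
          nlinarith
        calc _ = (M n : ℝ) ^ 2 * (d + 1) ^ (2 * M n) := by rw [mul_pow, ← pow_mul']
          _ ≤ (M n : ℝ) ^ (2 * M n) * B ^ (2 * M n) := by
              refine mul_le_mul (pow_le_pow_right₀ hM1 (by omega))
                (pow_le_pow_left₀ (by linarith) h2 _) (by positivity) (by positivity)
          _ = _ := by rw [← mul_pow, mul_comm]
      calc _ = 6 * d ^ 2 / δ' ^ 2 * ((M n * (d + 1) ^ M n) ^ 2 / n) := by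
            rw [hη]
            field_simp
        _ ≤ _ := by
            simp only [hX]
            gcongr
    have hpt : ∀ x : (Fin n → Fin k) × SimpleGraph (Fin n), 1 -
        ((if η ≤ |((2 * x.2.edgeSet.ncard : ℕ) : ℝ) / n - d| then (1 : ℝ) else 0) +
        (if δ * |s| ^ (2 * j) ≤ |(closedNonbacktrackingCount x.2 (2 * j) : ℝ) -
          (d ^ (2 * j) + (k - 1) * s ^ (2 * j))| then 1 else 0) +
        (if δ * |s| ^ (2 * j + 1) ≤ |(closedNonbacktrackingCount x.2 (2 * j + 1) : ℝ) -
          (d ^ (2 * j + 1) + (k - 1) * s ^ (2 * j + 1))| then 1 else 0) +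
        (if δ * |s| ^ (4 * j) ≤ |(closedNonbacktrackingCount x.2 (4 * j) : ℝ) -
          (d ^ (4 * j) + (k - 1) * s ^ (4 * j))| then 1 else 0)) ≤
        if x ∈ S then 1 else 0 := by
      intro x
      refine indicator_compl_le fun h0 h1 h2 h3 => ?_
      push Not at h0 h1 h2 h3
      rw [← hS]
      refine hclose n (2 * x.2.edgeSet.ncard) j (closedNonbacktrackingCount x.2) hn1
        (h0.trans_le hηδ) fun l hl => ⟨?_, ?_⟩
      · rcases hl with rfl | rfl | rfl <;> assumption
      · refine abs_pow_sub_pow_lt (M := M n) hd1.le (by omega) (by omega) hη1 ?_ h0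
        rw [hη, div_mul_cancel₀ _ (by positivity)]
        exact min_le_left _ _
    have hfin := expect_mono a b hpt
    simp only [sub_eq_add_neg (1 : ℝ)] at hfin
    rw [expect_add, expect_const] at hfin
    simp only [← neg_one_mul (_ + _ : ℝ)] at hfin
    rw [expect_const_mul, expect_add, expect_add, expect_add] at hfin
    have h1 := hdev (2 * j) (by omega) (by omega)
    have h2 := hdev (2 * j + 1) (by omega) (by omega)
    have h3 := hdev (4 * j) (by omega) (by omega)
    refine le_trans ?_ hfin
    have h4 := hedge.trans hedge'
    rw [herr]
    linarith
  refine tendsto_of_tendsto_of_tendsto_of_le_of_le' ?_ tendsto_const_nhds hbound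
    (Eventually.of_forall fun n => ?_)
  · have h1 := (tendsto_const_nhds (x := (1 : ℝ))).sub herrlim
    rw [sub_zero] at h1
    have h2 := ENNReal.tendsto_ofReal h1
    rwa [ENNReal.ofReal_one] at h2
  · rw [toOuterMeasure_eq, ← ENNReal.ofReal_one]
    refine ENNReal.ofReal_le_ofReal ?_
    calc _ ≤ expect n k a b (fun _ => 1) := expect_mono a b fun x => by
          split_ifs <;> norm_num
      _ = 1 := expect_const a b 1

end Consistency

/-- The lengths used are 2j, 2j + 1 and 4j with j = `scale n` ≥ 1, so 4j is the largest. -/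
theorem estimator_usesShortClosedWalks : UsesShortClosedWalks estimator := by
  refine ⟨fun n => 4 * scale n, tendsto_atTop_mono (fun n => by omega) tendsto_scale_atTop,
    scale_isLittleO, fun n G H hE hN => ?_⟩
  have h1 : 1 ≤ scale n := Nat.succ_pos _
  have e1 := hN (2 * scale n) (show _ ≤ 4 * scale n by omega)
  have e2 := hN (2 * scale n + 1) (show _ ≤ 4 * scale n by omega)
  have e3 := hN (4 * scale n) le_rfl
  simp only [estimator, estimateOf, hE, e1, e2, e3]

/-! ### Running times of programs -/

section Machine

/-- All the contents of the state have at most `S` binary digits. -/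
def State.Bdd (s : State) (S : ℕ) : Prop := (∀ i, (s.reg i).size ≤ S) ∧ ∀ x, (s.mem x).size ≤ S

theorem State.Bdd.mono {s : State} {S S' : ℕ} (h : s.Bdd S) (hS : S ≤ S') : s.Bdd S' :=
  ⟨fun i => (h.1 i).trans hS, fun x => (h.2 x).trans hS⟩

@[simp] theorem State.setReg_reg (s : State) (i x j : ℕ) :
    (s.setReg i x).reg j = if j = i then x else s.reg j := by
  simp [State.setReg, Function.update_apply]

@[simp] theorem State.setReg_mem (s : State) (i x : ℕ) : (s.setReg i x).mem = s.mem := rfl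

@[simp] theorem State.setMem_reg (s : State) (i x : ℕ) : (s.setMem i x).reg = s.reg := rfl

@[simp] theorem State.setMem_mem (s : State) (i x j : ℕ) :
    (s.setMem i x).mem j = if j = i then x else s.mem j := by
  simp [State.setMem, Function.update_apply]

theorem State.Bdd.setReg {s : State} {S : ℕ} (h : s.Bdd S) {i x : ℕ} (hx : x.size ≤ S) :
    (s.setReg i x).Bdd S := by
  refine ⟨fun j => ?_, h.2⟩
  rw [State.setReg_reg]
  split_ifs
  exacts [hx, h.1 j]

theorem State.Bdd.setMem {s : State} {S : ℕ} (h : s.Bdd S) {i x : ℕ} (hx : x.size ≤ S) :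
    (s.setMem i x).Bdd S := by
  refine ⟨h.1, fun j => ?_⟩
  rw [State.setMem_mem]
  split_ifs
  exacts [hx, h.2 j]

theorem size_mul_le (x y : ℕ) : (x * y).size ≤ x.size + y.size := by
  rw [Nat.size_le, pow_add]
  exact Nat.mul_lt_mul'' (Nat.lt_size_self x) (Nat.lt_size_self y)

theorem size_add_le {x y S : ℕ} (hx : x.size ≤ S) (hy : y.size ≤ S) : (x + y).size ≤ S + 1 := by
  rw [Nat.size_le] at *
  rw [pow_succ]
  omega

theorem ArithOp.size_eval_le (o : ArithOp) {x y S : ℕ} (hx : x.size ≤ S) (hy : y.size ≤ S) :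
    (o.eval x y).size ≤ S + y.size + 1 := by
  cases o with
  | add => exact (size_add_le hx hy).trans (by omega)
  | sub => exact (Nat.size_le_size (Nat.sub_le x y)).trans (by omega)
  | mul => exact (size_mul_le x y).trans (by omega)
  | div => exact (Nat.size_le_size (Nat.div_le_self x y)).trans (by omega)

theorem ArithOp.size_eval_le' {o : ArithOp} (ho : o ≠ .mul) {x y S : ℕ} (hx : x.size ≤ S)
    (hy : y.size ≤ S) : (o.eval x y).size ≤ S + 1 := by
  cases o with
  | add => exact size_add_le hx hy
  | sub => exact (Nat.size_le_size (Nat.sub_le x y)).trans (by omega)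
  | mul => exact absurd rfl ho
  | div => exact (Nat.size_le_size (Nat.div_le_self x y)).trans (by omega)

/-- The effect of a program without loops. -/
def Prog.step : Prog → State → State
  | .const i c, s => s.setReg i c
  | .arith o i j l, s => s.setReg i (o.eval (s.reg j) (s.reg l))
  | .load i j, s => s.setReg i (s.mem (s.reg j))
  | .store i j, s => s.setMem (s.reg i) (s.reg j)
  | .seq P Q, s => Q.step (P.step s)
  | .cond i P Q, s => if s.reg i ≠ 0 then P.step s else Q.step s
  | .loop _ _, s => s

/-- The program has no loops, and it multiplies only by numbers with at most `g` digits. -/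
def Prog.Ok (g : ℕ) : Prog → State → Prop
  | .const _ c, _ => c.size ≤ g
  | .arith .mul _ _ l, s => (s.reg l).size ≤ g
  | .arith _ _ _ _, _ => True
  | .load _ _, _ => True
  | .store _ _, _ => True
  | .seq P Q, s => P.Ok g s ∧ Q.Ok g (P.step s)
  | .cond i P Q, s => if s.reg i ≠ 0 then P.Ok g s else Q.Ok g s
  | .loop _ _, _ => False

/-- A bound for the number of steps of a program without loops. -/
def Prog.len : Prog → ℕ
  | .seq P Q => P.len + Q.len
  | .cond _ P Q => 1 + max P.len Q.len
  | _ => 1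

/-- `P` leads from `s` to `s'` in at most `T` steps, in each of which the numbers grow by at most
`g` digits. -/
def Runs (g : ℕ) (P : Prog) (s s' : State) (T : ℕ) : Prop :=
  ∀ S, s.Bdd S → ∃ t, Exec P s s' t ∧ t ≤ T * (1 + 2 * (S + T * g)) ∧ s'.Bdd (S + T * g)

/-- `P` leads from `s` to a state with the property `Q` in at most `T` steps, in each of which the
numbers grow by at most `g` digits. -/
def Reach (g : ℕ) (P : Prog) (s : State) (T : ℕ) (Q : State → Prop) : Prop :=
  ∃ s', Runs g P s s' T ∧ Q s'

variable {g : ℕ}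

/-- The time bound in `Runs` is superadditive, even though the second program starts with numbers of
S + T₁ g digits. This makes `Runs` composable. -/
theorem time_add_le (T₁ T₂ S g : ℕ) :
    T₁ * (1 + 2 * (S + T₁ * g)) + T₂ * (1 + 2 * (S + T₁ * g + T₂ * g)) ≤
      (T₁ + T₂) * (1 + 2 * (S + (T₁ + T₂) * g)) := by
  have h : 0 ≤ 2 * (T₁ * (T₂ * g)) := Nat.zero_le _
  nlinarith

theorem Runs.mono {P : Prog} {s s' : State} {T T' : ℕ} (h : Runs g P s s' T) (hT : T ≤ T') :
    Runs g P s s' T' := by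
  intro S hS
  obtain ⟨t, h1, h2, h3⟩ := h S hS
  have h4 : T * g ≤ T' * g := Nat.mul_le_mul_right g hT
  exact ⟨t, h1, h2.trans (Nat.mul_le_mul hT (by omega)), h3.mono (by omega)⟩

theorem Reach.mono {P : Prog} {s : State} {T T' : ℕ} {Q Q' : State → Prop}
    (h : Reach g P s T Q) (hT : T ≤ T') (hQ : ∀ s, Q s → Q' s) : Reach g P s T' Q' := by
  obtain ⟨s', h1, h2⟩ := h
  exact ⟨s', h1.mono hT, hQ s' h2⟩

theorem Runs.seq {P Q : Prog} {s s₁ s₂ : State} {T₁ T₂ : ℕ} (h₁ : Runs g P s s₁ T₁)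
    (h₂ : Runs g Q s₁ s₂ T₂) : Runs g (.seq P Q) s s₂ (T₁ + T₂) := by
  intro S hS
  obtain ⟨t, e1, e2, e3⟩ := h₁ S hS
  obtain ⟨t', f1, f2, f3⟩ := h₂ _ e3
  exact ⟨t + t', e1.seq f1, (add_le_add e2 f2).trans (time_add_le T₁ T₂ S g),
    f3.mono (by rw [add_mul, add_assoc])⟩

theorem Reach.seq {P Q : Prog} {s : State} {T₁ T₂ : ℕ} {R R' : State → Prop}
    (h₁ : Reach g P s T₁ R) (h₂ : ∀ s, R s → Reach g Q s T₂ R') :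
    Reach g (.seq P Q) s (T₁ + T₂) R' := by
  obtain ⟨s₁, e1, e2⟩ := h₁
  obtain ⟨s₂, f1, f2⟩ := h₂ s₁ e2
  exact ⟨s₂, e1.seq f1, f2⟩

/-- Multiplication by a number with at most g digits adds at most g digits, and the other operations
add at most one digit or write a short constant. Without this restriction repeated squaring could
double the number of digits in each step. -/
theorem Runs.step (hg : 1 ≤ g) (P : Prog) (s : State) (h : P.Ok g s) :
    Runs g P s (P.step s) P.len := by
  induction P generalizing s with
  | const i c =>
    intro S hS
    have hc : c.size ≤ g := h
    refine ⟨_, Exec.const s i c, ?_, (hS.mono (by omega)).setReg ?_⟩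
    · simp only [Prog.len]
      omega
    · simp only [Prog.len]
      omega
  | arith o i j l =>
    intro S hS
    have h1 := hS.1 j
    have h2 := hS.1 l
    have h3 : (o.eval (s.reg j) (s.reg l)).size ≤ S + 1 * g := by
      cases o with
      | mul =>
        have h4 : (s.reg l).size ≤ g := h
        exact (size_mul_le _ _).trans (by omega)
      | add => exact (ArithOp.size_eval_le' (by simp) h1 h2).trans (by omega)
      | sub => exact (ArithOp.size_eval_le' (by simp) h1 h2).trans (by omega)
      | div => exact (ArithOp.size_eval_le' (by simp) h1 h2).trans (by omega)
    refine ⟨_, Exec.arith s o i j l, ?_, (hS.mono (by omega)).setReg h3⟩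
    simp only [Prog.len]
    omega
  | load i j =>
    intro S hS
    have h1 := hS.1 j
    have h2 := hS.2 (s.reg j)
    refine ⟨_, Exec.load s i j, ?_, (hS.mono (by omega)).setReg (h2.trans (by omega))⟩
    simp only [Prog.len]
    omega
  | store i j =>
    intro S hS
    have h1 := hS.1 i
    have h2 := hS.1 j
    refine ⟨_, Exec.store s i j, ?_, (hS.mono (by omega)).setMem (h2.trans (by omega))⟩
    simp only [Prog.len]
    omega
  | seq P Q ihP ihQ => exact (ihP s h.1).seq (ihQ _ h.2)
  | cond i P Q ihP ihQ =>
    intro S hS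
    have h1 := hS.1 i
    by_cases hi : s.reg i ≠ 0
    · simp only [Prog.Ok, if_pos hi] at h
      obtain ⟨t, e1, e2, e3⟩ := (ihP s h).mono (le_max_left _ Q.len) S hS
      rw [Prog.step, if_pos hi]
      refine ⟨_, Exec.cond_true hi e1, ?_, e3.mono ?_⟩
      · simp only [Prog.len]
        have := time_add_le 1 (max P.len Q.len) S g
        nlinarith
      · simp only [Prog.len]
        nlinarith
    · simp only [Prog.Ok, if_neg hi] at h
      obtain ⟨t, e1, e2, e3⟩ := (ihQ s h).mono (le_max_right P.len _) S hS
      rw [Prog.step, if_neg hi]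
      refine ⟨_, Exec.cond_false (not_not.1 hi) e1, ?_, e3.mono ?_⟩
      · simp only [Prog.len]
        have := time_add_le 1 (max P.len Q.len) S g
        nlinarith
      · simp only [Prog.len]
        nlinarith
  | loop => exact absurd h id

theorem Reach.step (hg : 1 ≤ g) {P : Prog} {s : State} {Q : State → Prop} (h : P.Ok g s)
    (hQ : Q (P.step s)) : Reach g P s P.len Q :=
  ⟨_, Runs.step hg P s h, hQ⟩

theorem Runs.loop_step {i : ℕ} {P : Prog} {s s₁ s₂ : State} {T₁ T₂ : ℕ} (hi : s.reg i ≠ 0)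
    (h₁ : Runs g P s s₁ T₁) (h₂ : Runs g (.loop i P) s₁ s₂ T₂) :
    Runs g (.loop i P) s s₂ (T₁ + 1 + T₂) := by
  intro S hS
  have h0 := hS.1 i
  obtain ⟨t, e1, e2, e3⟩ := h₁ S hS
  obtain ⟨t', f1, f2, f3⟩ := h₂ _ e3
  refine ⟨_, Exec.loop_step hi e1 f1, ?_, f3.mono (by nlinarith)⟩
  have h1 := time_add_le T₁ T₂ S g
  have h2 := time_add_le 1 (T₁ + T₂) S g
  have h3 : T₁ + 1 + T₂ = 1 + (T₁ + T₂) := by omega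
  rw [h3]
  have h4 : (T₁ + T₂) * (1 + 2 * (S + (T₁ + T₂) * g)) ≤
      (T₁ + T₂) * (1 + 2 * (S + 1 * g + (T₁ + T₂) * g)) := Nat.mul_le_mul_left _ (by omega)
  omega

theorem Runs.loop_done {i : ℕ} {P : Prog} {s : State} (hi : s.reg i = 0) :
    Runs g (.loop i P) s s 1 := by
  intro S hS
  have h0 := hS.1 i
  exact ⟨_, Exec.loop_done hi, by omega, hS.mono (by omega)⟩

/-- The rule for loops with a known number of iterations. -/
theorem Reach.loop {i : ℕ} {P : Prog} {T : ℕ} (I : ℕ → State → Prop) (N : ℕ)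
    (hstep : ∀ j < N, ∀ s, I j s → s.reg i ≠ 0 ∧ Reach g P s T (I (j + 1)))
    (hdone : ∀ s, I N s → s.reg i = 0) {s : State} (h : I 0 s) :
    Reach g (.loop i P) s (N * (T + 1) + 1) (I N) := by
  -- Induction on the number `r` of remaining iterations. Each costs `T + 1` steps, one of them for
  -- the test.
  have key : ∀ r j, j + r = N → ∀ s, I j s → Reach g (.loop i P) s (r * (T + 1) + 1) (I N) := by
    intro r
    induction r with
    | zero =>
      intro j hj s hs
      obtain rfl : j = N := by omega
      exact ⟨s, (Runs.loop_done (hdone s hs)).mono (by omega), hs⟩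
    | succ r ih =>
      intro j hj s hs
      obtain ⟨h1, s₁, h2, h3⟩ := hstep j (by omega) s hs
      obtain ⟨s₂, h4, h5⟩ := ih (j + 1) (by omega) s₁ h3
      exact ⟨s₂, (h2.loop_step h1 h4).mono (by rw [add_mul]; omega), h5⟩
  exact key N 0 (by omega) s h

/-- The program has no loops. -/
def Prog.LoopFree : Prog → Prop
  | .seq P Q => P.LoopFree ∧ Q.LoopFree
  | .cond _ P Q => P.LoopFree ∧ Q.LoopFree
  | .loop _ _ => False
  | _ => True

/-- A program without loops takes time linear in the number of digits. -/
theorem Prog.LoopFree.exec {P : Prog} (h : P.LoopFree) : ∃ c, ∀ (s : State) (S : ℕ), s.Bdd S →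
    ∃ t, Exec P s (P.step s) t ∧ t ≤ c * (1 + S) ∧ (P.step s).Bdd (c * (1 + S)) := by
  induction P with
  | const i c =>
    refine ⟨1 + c.size, fun s S hS => ⟨_, Exec.const s i c, by nlinarith, ?_⟩⟩
    exact (hS.mono (by nlinarith)).setReg (by nlinarith)
  | arith o i j l =>
    refine ⟨2, fun s S hS => ⟨_, Exec.arith s o i j l, ?_, (hS.mono (by omega)).setReg ?_⟩⟩
    · have := hS.1 j
      have := hS.1 l
      omega
    · have := hS.1 l
      exact (o.size_eval_le (hS.1 j) (hS.1 l)).trans (by omega)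
  | load i j =>
    refine ⟨2, fun s S hS => ⟨_, Exec.load s i j, ?_, (hS.mono (by omega)).setReg ?_⟩⟩
    · have := hS.1 j
      have := hS.2 (s.reg j)
      omega
    · exact (hS.2 _).trans (by omega)
  | store i j =>
    refine ⟨2, fun s S hS => ⟨_, Exec.store s i j, ?_, (hS.mono (by omega)).setMem ?_⟩⟩
    · have := hS.1 i
      have := hS.1 j
      omega
    · exact (hS.1 _).trans (by omega)
  | seq P Q ihP ihQ =>
    obtain ⟨c, hc⟩ := ihP h.1
    obtain ⟨c', hc'⟩ := ihQ h.2
    -- The second program starts with numbers of up to c (1 + S) digits.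
    refine ⟨c + c' * (1 + c), fun s S hS => ?_⟩
    obtain ⟨t, e1, e2, e3⟩ := hc s S hS
    obtain ⟨t', f1, f2, f3⟩ := hc' _ _ e3
    have h1 : c' * (1 + c * (1 + S)) ≤ c' * (1 + c) * (1 + S) := by
      rw [mul_assoc]
      exact Nat.mul_le_mul_left _ (by nlinarith)
    refine ⟨_, e1.seq f1, ?_, f3.mono ?_⟩
    · rw [add_mul]
      omega
    · rw [add_mul]
      omega
  | cond i P Q ihP ihQ =>
    obtain ⟨c, hc⟩ := ihP h.1
    obtain ⟨c', hc'⟩ := ihQ h.2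
    refine ⟨1 + c + c', fun s S hS => ?_⟩
    have h0 := hS.1 i
    have e : (1 + c + c') * (1 + S) = 1 + S + c * (1 + S) + c' * (1 + S) := by ring
    rw [e]
    by_cases hi : s.reg i ≠ 0
    · obtain ⟨t, e1, e2, e3⟩ := hc s S hS
      rw [Prog.step, if_pos hi]
      exact ⟨_, Exec.cond_true hi e1, by omega, e3.mono (by omega)⟩
    · obtain ⟨t, e1, e2, e3⟩ := hc' s S hS
      rw [Prog.step, if_neg hi]
      exact ⟨_, Exec.cond_false (not_not.1 hi) e1, by omega, e3.mono (by omega)⟩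
  | loop => exact absurd h id

/-- The sequence of the programs in a list. -/
def Prog.all : List Prog → Prog
  -- The empty list does not occur in the programs below.
  | [] => .const 99 0
  | [P] => P
  | P :: l => .seq P (Prog.all l)

/-- The registers outside of `R` agree. -/
def Agree (R : List ℕ) (s s' : State) : Prop := ∀ i, i ∉ R → s'.reg i = s.reg i

end Machine

/-! ### The program -/

section Program

variable {g n : ℕ}

/-- The registers that hold constants. -/
def Consts (n : ℕ) (s : State) : Prop :=
  s.reg 0 = n ∧ s.reg 20 = 1 ∧ s.reg 21 = 2 ∧ s.reg 22 = n * n ∧ s.reg 23 = 0 ∧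
    s.reg 24 = n * n * (n * n)

/-- A frame rule: each subprogram comes with the list of the registers it may change, and the
constants survive if they are not in it. -/
theorem Consts.agree {R : List ℕ} {s s' : State} (h : Consts n s) (hA : Agree R s s')
    (hR : ∀ i ∈ [0, 20, 21, 22, 23, 24], i ∉ R) : Consts n s' := by
  obtain ⟨h1, h2, h3, h4, h5, h6⟩ := h
  refine ⟨?_, ?_, ?_, ?_, ?_, ?_⟩
  all_goals rw [hA _ (hR _ (by simp))]; assumption

theorem Agree.trans {R R' : List ℕ} {s s₁ s₂ : State} (h₁ : Agree R s s₁) (h₂ : Agree R' s₁ s₂)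
    (hR : R' ⊆ R) : Agree R s s₂ :=
  fun i hi => (h₂ i fun h => hi (hR h)).trans (h₁ i hi)

theorem Agree.mono {R R' : List ℕ} {s s' : State} (h : Agree R' s s') (hR : R' ⊆ R) :
    Agree R s s' := fun i hi => h i fun h' => hi (hR h')

/-- Compute the sum of the degrees. -/
def degreeBody : Prog := .all [.arith .sub 14 14 20, .load 15 14, .arith .add 13 13 15]

def degreeProg : Prog :=
  .seq (.all [.arith .add 14 22 23, .const 13 0]) (.loop 14 degreeBody)

theorem degreeProg_reach (hg : 1 ≤ g) {s : State} (hs : Consts n s) :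
    Reach g degreeProg s (2 + (n * n * (3 + 1) + 1)) fun s' => Agree [13, 14, 15] s s' ∧
      s'.mem = s.mem ∧ s'.reg 13 = ∑ x ∈ Finset.range (n * n), s.mem x := by
  refine Reach.seq (Reach.step hg (by simp [Prog.Ok, Prog.all]) rfl) ?_
  rintro s₁ rfl
  -- The address runs downwards from n² - 1, so the partial sums are in reversed order until the
  -- end.
  refine Reach.mono (Reach.loop (T := degreeBody.len) (fun j s' => Agree [13, 14, 15] s s' ∧
    s'.mem = s.mem ∧ s'.reg 14 = n * n - j ∧
      s'.reg 13 = ∑ x ∈ Finset.range j, s.mem (n * n - 1 - x)) (n * n) ?_ ?_ ?_) le_rfl ?_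
  · rintro j hj s' ⟨hA, hm, h14, h13⟩
    have hc := hs.agree hA (by decide)
    refine ⟨by omega, Reach.step hg (by simp [degreeBody, Prog.Ok, Prog.all]) ⟨?_, ?_, ?_, ?_⟩⟩
    · intro i hi
      have := hA i hi
      simp only [List.mem_cons, List.not_mem_nil, or_false, not_or] at hi
      simp [degreeBody, Prog.step, Prog.all, hi, this]
    · simp [degreeBody, Prog.step, Prog.all, hm]
    · simp [degreeBody, Prog.step, Prog.all, h14, hc.2.1, ArithOp.eval]
      omega
    · simp [degreeBody, Prog.step, Prog.all, h14, h13, hc.2.1, hm, ArithOp.eval,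
        Finset.sum_range_succ]
      congr 1
      omega
  · rintro s' ⟨_, _, h14, _⟩
    omega
  · refine ⟨?_, ?_, ?_, ?_⟩
    · intro i hi
      simp only [List.mem_cons, List.not_mem_nil, or_false, not_or] at hi
      simp [Prog.step, Prog.all, hi]
    · simp [Prog.step, Prog.all]
    · simp [Prog.step, Prog.all, hs.2.2.2.1, hs.2.2.2.2.1, ArithOp.eval]
    · simp [Prog.step, Prog.all]
  · rintro s' ⟨hA, hm, _, h13⟩
    exact ⟨hA, hm, h13.trans (Finset.sum_range_reflect s.mem (n * n))⟩

/-- Compute the number of binary digits. -/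
def sizeBody : Prog := .all [.arith .div 16 16 21, .arith .add 17 17 20]

def sizeProg : Prog := .seq (.const 17 0) (.loop 16 sizeBody)

/-- The number of digits is the number of halvings that lead to zero. -/
theorem sizeProg_reach (hg : 1 ≤ g) {s : State} (hs : Consts n s) :
    Reach g sizeProg s (1 + ((s.reg 16).size * (2 + 1) + 1)) fun s' => Agree [16, 17] s s' ∧
      s'.mem = s.mem ∧ s'.reg 17 = (s.reg 16).size := by
  refine Reach.seq (Reach.step hg (by simp [Prog.Ok]) rfl) ?_
  rintro s₁ rfl
  refine Reach.mono (Reach.loop (T := sizeBody.len) (fun j s' => Agree [16, 17] s s' ∧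
    s'.mem = s.mem ∧ s'.reg 16 = s.reg 16 / 2 ^ j ∧ s'.reg 17 = j) (s.reg 16).size
    ?_ ?_ ?_) le_rfl ?_
  · rintro j hj s' ⟨hA, hm, h16, h17⟩
    have hc := hs.agree hA (by decide)
    rw [Nat.lt_size] at hj
    refine ⟨?_, Reach.step hg (by simp [sizeBody, Prog.Ok, Prog.all]) ⟨?_, ?_, ?_, ?_⟩⟩
    · rw [h16]
      exact (Nat.div_pos hj (by positivity)).ne'
    · intro i hi
      have := hA i hi
      simp only [List.mem_cons, List.not_mem_nil, or_false, not_or] at hi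
      simp [sizeBody, Prog.step, Prog.all, hi, this]
    · simp [sizeBody, Prog.step, Prog.all, hm]
    · simp [sizeBody, Prog.step, Prog.all, h16, hc.2.2.1, ArithOp.eval, Nat.div_div_eq_div_mul,
        pow_succ]
    · simp [sizeBody, Prog.step, Prog.all, h17, hc.2.1, ArithOp.eval]
  · rintro s' ⟨_, _, h16, _⟩
    rw [h16]
    exact Nat.div_eq_of_lt (Nat.lt_size_self _)
  · refine ⟨?_, ?_, ?_, ?_⟩
    · intro i hi
      simp only [List.mem_cons, List.not_mem_nil, or_false, not_or] at hi
      simp [Prog.step, hi]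
    · simp [Prog.step]
    · simp [Prog.step]
    · simp [Prog.step]
  · rintro s' ⟨hA, hm, _, h17⟩
    exact ⟨hA, hm, h17⟩

/-- The numbers of nonbacktracking walks from the pair `e` to the pair `f`, where the pair `(u, v)`
of vertices is encoded by `u * n + v` and `A` is the adjacency matrix. -/
def walkTable (n : ℕ) (A : ℕ → ℕ) : ℕ → ℕ → ℕ → ℕ
  | 0, e, f => if e = f then 1 else 0
  -- The last pair is (f / n, f % n). The pair before it is (u, f / n), with u ≠ f % n because the
  -- walk does not backtrack.
  | t + 1, e, f => (∑ u ∈ Finset.range n, if u = f % n then 0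
      else walkTable n A t e (u * n + f / n)) * A f

/-- The entries of the table one after the other. -/
def walkCell (n : ℕ) (A : ℕ → ℕ) (x : ℕ) : ℕ :=
  walkTable n A (x / (n * n * (n * n))) (x / (n * n) % (n * n)) (x % (n * n))

theorem walkCell_mk (A : ℕ → ℕ) {t e f : ℕ} (he : e < n * n) (hf : f < n * n) :
    walkCell n A ((t * (n * n) + e) * (n * n) + f) = walkTable n A t e f := by
  have hN : 0 < n * n := by omega
  rw [walkCell, ← Nat.div_div_eq_div_mul]
  have h1 : ((t * (n * n) + e) * (n * n) + f) / (n * n) = t * (n * n) + e := by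
    rw [mul_comm, Nat.mul_add_div hN, Nat.div_eq_of_lt hf, add_zero]
  have h2 : ((t * (n * n) + e) * (n * n) + f) % (n * n) = f := by
    rw [mul_comm, Nat.mul_add_mod, Nat.mod_eq_of_lt hf]
  have h3 : (t * (n * n) + e) / (n * n) = t := by
    rw [mul_comm, Nat.mul_add_div hN, Nat.div_eq_of_lt he, add_zero]
  have h4 : (t * (n * n) + e) % (n * n) = e := by
    rw [mul_comm, Nat.mul_add_mod, Nat.mod_eq_of_lt he]
  rw [h1, h2, h3, h4]

/-- Fill the layer of the table that belongs to the walks of length zero. -/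
def baseBody : Prog := .all [.arith .div 28 26 22, .arith .mul 29 28 22, .arith .sub 29 26 29,
  -- Registers 28 and 29 hold e and f. The sum of the two truncated differences is |e - f|, and 1
  -- minus it, truncated, is the indicator of e = f.
  .arith .sub 35 28 29, .arith .sub 36 29 28, .arith .add 35 35 36, .arith .sub 35 20 35,
  .store 27 35, .arith .add 26 26 20, .arith .add 27 27 20, .arith .sub 25 25 20]

def baseProg : Prog :=
  .seq (.all [.const 26 0, .arith .add 25 24 23, .arith .add 27 22 23]) (.loop 25 baseBody)

/-- The table is filled up to the position `x`. -/
def Filled (n : ℕ) (A : ℕ → ℕ) (x : ℕ) (s : State) : Prop :=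
  s.reg 26 = x ∧ s.reg 27 = n * n + x ∧ (∀ y < n * n, s.mem y = A y) ∧
    ∀ y < x, s.mem (n * n + y) = walkCell n A y

theorem Filled.succ {A : ℕ → ℕ} {x : ℕ} {s s' : State} (h : Filled n A x s)
    (h26 : s'.reg 26 = x + 1) (h27 : s'.reg 27 = n * n + x + 1)
    (hm : ∀ y, s'.mem y = if y = n * n + x then walkCell n A x else s.mem y) :
    Filled n A (x + 1) s' := by
  refine ⟨h26, by omega, fun y hy => ?_, fun y hy => ?_⟩
  · rw [hm, if_neg (by omega), h.2.2.1 y hy]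
  · rw [hm]
    split_ifs with hyx
    · congr 1
      omega
    · exact h.2.2.2 y (by omega)

theorem baseProg_reach (hg : 1 ≤ g) {s : State} (hs : Consts n s) (hN : (n * n).size ≤ g)
    {A : ℕ → ℕ} (hA0 : ∀ y < n * n, s.mem y = A y) :
    Reach g baseProg s (3 + (n * n * (n * n) * (11 + 1) + 1)) fun s' =>
      Agree [25, 26, 27, 28, 29, 35, 36] s s' ∧ Filled n A (n * n * (n * n)) s' := by
  refine Reach.seq (Reach.step hg (by simp [Prog.Ok, Prog.all]) rfl) ?_
  rintro s₁ rfl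
  refine Reach.mono (Reach.loop (T := baseBody.len) (fun x s' =>
    Agree [25, 26, 27, 28, 29, 35, 36] s s' ∧ s'.reg 25 = n * n * (n * n) - x ∧ Filled n A x s')
    (n * n * (n * n)) ?_ ?_ ?_) le_rfl ?_
  · rintro x hx s' ⟨hA, h25, hF⟩
    obtain ⟨-, c20, -, c22, -, -⟩ := hs.agree hA (by decide)
    refine ⟨by omega, Reach.step hg ?_ ⟨?_, ?_, hF.succ ?_ ?_ ?_⟩⟩
    · simp [baseBody, Prog.Ok, Prog.all, Prog.step, c22, hN]
    · intro i hi
      have := hA i hi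
      simp only [List.mem_cons, List.not_mem_nil, or_false, not_or] at hi
      simp [baseBody, Prog.step, Prog.all, hi, this]
    · simp [baseBody, Prog.step, Prog.all, h25, c20, ArithOp.eval]
      omega
    · simp [baseBody, Prog.step, Prog.all, hF.1, c20, ArithOp.eval]
    · simp [baseBody, Prog.step, Prog.all, hF.2.1, c20, ArithOp.eval]
    · intro y
      simp only [baseBody, Prog.step, Prog.all, State.setReg_reg, State.setMem_reg,
        State.setReg_mem, State.setMem_mem, hF.1, hF.2.1, c20, c22, ArithOp.eval]
      norm_num
      have hN0 : 0 < n * n := Nat.pos_of_ne_zero fun h => by simp [h] at hx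
      have h1 : walkCell n A x = if x / (n * n) = x % (n * n) then 1 else 0 := by
        have h2 : x / (n * n) < n * n := (Nat.div_lt_iff_lt_mul hN0).2 hx
        rw [walkCell, Nat.div_eq_of_lt hx, Nat.mod_eq_of_lt h2]
        rfl
      have h3 : x - x / (n * n) * (n * n) = x % (n * n) := by
        have := Nat.div_add_mod' x (n * n)
        omega
      rw [h1, h3]
      split_ifs <;> omega
  · rintro s' ⟨_, h25, _⟩
    omega
  · refine ⟨?_, ?_, ?_, ?_, ?_, ?_⟩
    · intro i hi
      simp only [List.mem_cons, List.not_mem_nil, or_false, not_or] at hi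
      simp [Prog.step, Prog.all, hi]
    · simp [Prog.step, Prog.all, hs.2.2.2.2.1, hs.2.2.2.2.2, ArithOp.eval]
    · simp [Prog.step, Prog.all]
    · simp [Prog.step, Prog.all, hs.2.2.2.1, hs.2.2.2.2.1, ArithOp.eval]
    · simpa [Prog.step, Prog.all] using hA0
    · simp
  · rintro s' ⟨hA, _, hF⟩
    exact ⟨hA, hF⟩

/-- Sum over the first vertex of the last step but one. -/
def innerBody : Prog := .all [.arith .sub 39 39 20, .arith .sub 40 39 36, .arith .sub 41 36 39,
  .arith .add 40 40 41,
  .cond 40 (.all [.arith .mul 41 39 0, .arith .add 41 41 37, .load 41 41, .arith .add 38 38 41])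
    (.const 41 0)]

def innerProg : Prog :=
  .seq (.all [.const 38 0, .arith .add 39 0 23]) (.loop 39 innerBody)

theorem innerProg_reach (hg : 1 ≤ g) {s : State} (hs : Consts n s) (hN : n.size ≤ g) :
    Reach g innerProg s (2 + (n * (9 + 1) + 1)) fun s' =>
      Agree [38, 39, 40, 41] s s' ∧ s'.mem = s.mem ∧ s'.reg 38 =
        ∑ u ∈ Finset.range n, if u = s.reg 36 then 0 else s.mem (u * n + s.reg 37) := by
  refine Reach.seq (Reach.step hg (by simp [Prog.Ok, Prog.all]) rfl) ?_
  rintro s₁ rfl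
  refine Reach.mono (Reach.loop (T := innerBody.len) (fun j s' => Agree [38, 39, 40, 41] s s' ∧
    s'.mem = s.mem ∧ s'.reg 39 = n - j ∧ s'.reg 38 = ∑ u ∈ Finset.range j,
      if n - 1 - u = s.reg 36 then 0 else s.mem ((n - 1 - u) * n + s.reg 37)) n ?_ ?_ ?_) le_rfl ?_
  · rintro j hj s' ⟨hA, hm, h39, h38⟩
    obtain ⟨c0, c20, -, -, -, -⟩ := hs.agree hA (by decide)
    have h36 := hA 36 (by decide)
    have h37 := hA 37 (by decide)
    have hu : n - j - 1 = n - 1 - j := by omega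
    refine ⟨by omega, Reach.step hg ?_ ?_⟩
    · simp [innerBody, Prog.Ok, Prog.all, Prog.step, c0, hN, ArithOp.eval]
    by_cases hw : n - 1 - j = s.reg 36
    · have hz : n - 1 - j - s.reg 36 + (s.reg 36 - (n - 1 - j)) = 0 := by omega
      refine ⟨?_, ?_, ?_, ?_⟩
      · intro i hi
        have := hA i hi
        simp only [List.mem_cons, List.not_mem_nil, or_false, not_or] at hi
        simp [innerBody, Prog.step, Prog.all, hi, this, ArithOp.eval, h39, c20, h36, hu, hz]
      · simp [innerBody, Prog.step, Prog.all, hm, ArithOp.eval, h39, c20, h36, hu, hz]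
      · simp [innerBody, Prog.step, Prog.all, ArithOp.eval, h39, c20, h36, hu, hz]
        omega
      · simp [innerBody, Prog.step, Prog.all, ArithOp.eval, h39, c20, h36, hu, h38,
          Finset.sum_range_succ, hw]
    · have hz : ¬ (n - 1 - j - s.reg 36 + (s.reg 36 - (n - 1 - j)) = 0) := by omega
      refine ⟨?_, ?_, ?_, ?_⟩
      · intro i hi
        have := hA i hi
        simp only [List.mem_cons, List.not_mem_nil, or_false, not_or] at hi
        simp only [innerBody, Prog.step, Prog.all, ArithOp.eval, State.setReg_reg, h39, c20, h36,
          hu, Nat.reduceEqDiff, if_true, if_false, ne_eq, hz, not_false_eq_true]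
        simp [hi, this]
      · simp only [innerBody, Prog.step, Prog.all, ArithOp.eval, State.setReg_reg, h39, c20, h36,
          hu, Nat.reduceEqDiff, if_true, if_false, ne_eq, hz, not_false_eq_true]
        simp [hm]
      · simp only [innerBody, Prog.step, Prog.all, ArithOp.eval, State.setReg_reg, h39, c20, h36,
          hu, Nat.reduceEqDiff, if_true, if_false, ne_eq, hz, not_false_eq_true]
        omega
      · simp only [innerBody, Prog.step, Prog.all, ArithOp.eval, State.setReg_reg, h39, c20, h36,
          hu, Nat.reduceEqDiff, if_true, if_false, ne_eq, hz, not_false_eq_true]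
        simp [h38, hm, h37, c0, Finset.sum_range_succ, hw]
  · rintro s' ⟨_, _, h39, _⟩
    omega
  · refine ⟨?_, ?_, ?_, ?_⟩
    · intro i hi
      simp only [List.mem_cons, List.not_mem_nil, or_false, not_or] at hi
      simp [Prog.step, Prog.all, hi]
    · simp [Prog.step, Prog.all]
    · simp [Prog.step, Prog.all, hs.1, hs.2.2.2.2.1, ArithOp.eval]
    · simp [Prog.step, Prog.all]
  · rintro s' ⟨hA, hm, _, h38⟩
    exact ⟨hA, hm, h38.trans (Finset.sum_range_reflect
      (fun u => if u = s.reg 36 then 0 else s.mem (u * n + s.reg 37)) n)⟩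

end Program

/-! ### The table of walk numbers, its traces, and powers. -/

section Program

variable {g n : ℕ}

/-- Compute the next entry of the table. -/
def cellPre : Prog := .all [.arith .div 28 26 22, .arith .mul 29 28 22, .arith .sub 29 26 29,
  -- Registers 29, 35 and 36 hold f, f / n and f % n. Register 37 becomes the address, one layer
  -- below and in the same row e, of the pair (0, f / n); `innerBody` adds u n to it.
  .arith .div 35 29 0, .arith .mul 36 35 0, .arith .sub 36 29 36, .arith .sub 37 27 24,
  .arith .sub 37 37 29, .arith .add 37 37 35]

def cellPost : Prog := .all [.load 40 29, .arith .mul 38 38 40, .store 27 38,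
  .arith .add 26 26 20, .arith .add 27 27 20, .arith .sub 25 25 20]

def cellBody : Prog := .seq cellPre (.seq innerProg cellPost)

/-- Fill the table. -/
def tableProg : Prog := .seq (.arith .mul 25 19 24) (.loop 25 cellBody)

/-- The recursion of `walkTable` in terms of linear positions. The step to the previous layer
subtracts (n²)², the row e stays, and only the last digit in base n² changes, from f to u n + f / n.
-/
theorem walkCell_of_le {A : ℕ → ℕ} {x : ℕ} (hn : 0 < n) (hx : n * n * (n * n) ≤ x) :
    walkCell n A x = (∑ u ∈ Finset.range n, if u = x % (n * n) % n then 0 else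
      walkCell n A (x - n * n * (n * n) - x % (n * n) + (u * n + x % (n * n) / n))) *
        A (x % (n * n)) := by
  have hN : 0 < n * n := Nat.mul_pos hn hn
  obtain ⟨t, ht⟩ : ∃ t, x / (n * n) / (n * n) = t + 1 := by
    refine Nat.exists_eq_succ_of_ne_zero (Nat.div_pos ?_ hN).ne'
    rwa [Nat.le_div_iff_mul_le hN]
  set e := x / (n * n) % (n * n) with he
  set f := x % (n * n) with hf
  have he' : e < n * n := Nat.mod_lt _ hN
  have hf' : f < n * n := Nat.mod_lt _ hN
  have hx1 : x = ((t + 1) * (n * n) + e) * (n * n) + f := by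
    rw [← ht, he, hf, Nat.div_add_mod', Nat.div_add_mod']
  have hx2 : x - n * n * (n * n) - f = (t * (n * n) + e) * (n * n) := by
    have : ((t + 1) * (n * n) + e) * (n * n) = (t * (n * n) + e) * (n * n) + n * n * (n * n) := by
      ring
    omega
  rw [hx2]
  conv_lhs => rw [hx1, walkCell_mk A he' hf']
  rw [walkTable]
  congr 1
  refine Finset.sum_congr rfl fun u hu => ?_
  rw [walkCell_mk A he']
  have hu' := Finset.mem_range.1 hu
  have h1 : f / n < n := (Nat.div_lt_iff_lt_mul hn).2 hf'
  have h2 : (u + 1) * n ≤ n * n := Nat.mul_le_mul_right n hu'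
  rw [add_mul] at h2
  omega

/-- The large table entries are only added up and multiplied by entries of `A`, which have at most g
digits. So the numbers stay short although they may be exponential in the length of the walk. -/
theorem tableProg_reach (hg : 1 ≤ g) {s : State} (hs : Consts n s) (hN : (n * n).size ≤ g)
    (hN2 : (n * n * (n * n)).size ≤ g) (hn : n.size ≤ g)
    {A : ℕ → ℕ} (hA1 : ∀ y < n * n, (A y).size ≤ g) (hF : Filled n A (n * n * (n * n)) s) :
    Reach g tableProg s
      (1 + (s.reg 19 * (n * n * (n * n)) * (9 + (2 + (n * (9 + 1) + 1) + 6) + 1) + 1)) fun s' =>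
      Agree [25, 26, 27, 28, 29, 35, 36, 37, 38, 39, 40, 41] s s' ∧
        Filled n A (n * n * (n * n) + s.reg 19 * (n * n * (n * n))) s' := by
  refine Reach.seq (Reach.step hg (by simp [Prog.Ok, hs.2.2.2.2.2, hN2]) rfl) ?_
  rintro s₁ rfl
  refine Reach.mono (Reach.loop (fun i s' =>
    Agree [25, 26, 27, 28, 29, 35, 36, 37, 38, 39, 40, 41] s s' ∧
    s'.reg 25 = s.reg 19 * (n * n * (n * n)) - i ∧ Filled n A (n * n * (n * n) + i) s')
    (s.reg 19 * (n * n * (n * n))) ?_ ?_ ?_) le_rfl ?_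
  · rintro i hi s' ⟨hA, h25, hF⟩
    have hc := hs.agree hA (by decide)
    obtain ⟨c0, c20, -, c22, -, c24⟩ := hc
    have hn0 : 0 < n := Nat.pos_of_ne_zero fun h => by simp [h] at hi
    have hN0 : 0 < n * n := Nat.mul_pos hn0 hn0
    set x := n * n * (n * n) + i with hx
    have hxle : n * n * (n * n) ≤ x := by omega
    have hmod : x - x / (n * n) * (n * n) = x % (n * n) := by
      have := Nat.div_add_mod' x (n * n)
      omega
    have hmod' : x % (n * n) - x % (n * n) / n * n = x % (n * n) % n := by
      have := Nat.div_add_mod' (x % (n * n)) n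
      omega
    refine ⟨by omega, ?_⟩
    refine Reach.seq (Reach.step hg (by simp [cellPre, Prog.Ok, Prog.all, Prog.step, c22, hN, c0,
      hn]) (Q := fun s₂ => Agree [28, 29, 35, 36, 37] s' s₂ ∧ s₂.mem = s'.mem ∧
        s₂.reg 29 = x % (n * n) ∧ s₂.reg 36 = x % (n * n) % n ∧
        s₂.reg 37 = n * n + x - n * n * (n * n) - x % (n * n) + x % (n * n) / n)
      ⟨?_, ?_, ?_, ?_, ?_⟩) ?_
    · intro i hi
      simp only [List.mem_cons, List.not_mem_nil, or_false, not_or] at hi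
      simp [cellPre, Prog.step, Prog.all, hi]
    · simp [cellPre, Prog.step, Prog.all]
    · simp [cellPre, Prog.step, Prog.all, hF.1, c22, ArithOp.eval, hmod]
    · simp [cellPre, Prog.step, Prog.all, hF.1, c22, c0, ArithOp.eval, hmod, hmod']
    · simp [cellPre, Prog.step, Prog.all, hF.1, hF.2.1, c24, c22, c0, ArithOp.eval, hmod]
    rintro s₂ ⟨hA₂, hm₂, h29, h36, h37⟩
    have hA₂' := hA.trans hA₂ (by decide)
    have hc₂ := hs.agree hA₂' (by decide)
    refine Reach.seq (innerProg_reach hg hc₂ hn) ?_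
    rintro s₃ ⟨hA₃, hm₃, h38⟩
    have hA₃' := hA₂'.trans hA₃ (by decide)
    obtain ⟨-, d20, -, -, -, -⟩ := hs.agree hA₃' (by decide)
    have k25 : s₃.reg 25 = s.reg 19 * (n * n * (n * n)) - i := by
      rw [hA₃ 25 (by decide), hA₂ 25 (by decide), h25]
    have k26 : s₃.reg 26 = x := by rw [hA₃ 26 (by decide), hA₂ 26 (by decide), hF.1]
    have k27 : s₃.reg 27 = n * n + x := by rw [hA₃ 27 (by decide), hA₂ 27 (by decide), hF.2.1]
    have k29 : s₃.reg 29 = x % (n * n) := by rw [hA₃ 29 (by decide), h29]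
    have hf' : x % (n * n) < n * n := Nat.mod_lt _ hN0
    have hmem : s₃.mem (x % (n * n)) = A (x % (n * n)) := by
      rw [hm₃, hm₂]
      exact hF.2.2.1 _ hf'
    have k38 : s₃.reg 38 * A (x % (n * n)) = walkCell n A x := by
      rw [h38, walkCell_of_le hn0 hxle, h36, h37, hm₂]
      congr 1
      refine Finset.sum_congr rfl fun u hu => ?_
      have hu' := Finset.mem_range.1 hu
      have h1 : x % (n * n) / n < n := (Nat.div_lt_iff_lt_mul hn0).2 hf'
      have h2 : (u + 1) * n ≤ n * n := Nat.mul_le_mul_right n hu'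
      rw [add_mul] at h2
      -- These bounds ensure that no subtraction of addresses is truncated and that the entries read
      -- are already filled.
      have h3 : n * n ≤ n * n * (n * n) := Nat.le_mul_of_pos_left _ hN0
      have h4 : x % (n * n) ≤ i := by
        rw [hx, Nat.mul_add_mod]
        exact Nat.mod_le _ _
      split_ifs
      · rfl
      · rw [← hF.2.2.2 _ (by omega)]
        congr 1
        omega
    refine Reach.step hg ?_ ⟨?_, ?_, ?_⟩
    · simp [cellPost, Prog.Ok, Prog.all, Prog.step, k29, hmem, hA1 _ hf']
    · intro i hi
      have := hA₃' i hi
      simp only [List.mem_cons, List.not_mem_nil, or_false, not_or] at hi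
      simp [cellPost, Prog.step, Prog.all, hi, this]
    · simp [cellPost, Prog.step, Prog.all, k25, d20, ArithOp.eval]
      omega
    · refine hF.succ ?_ ?_ ?_
      · simp [cellPost, Prog.step, Prog.all, k26, d20, ArithOp.eval]
      · simp [cellPost, Prog.step, Prog.all, k27, d20, ArithOp.eval]
      · intro y
        simp [cellPost, Prog.step, Prog.all, k27, k29, hmem, k38, hm₃, hm₂, ArithOp.eval]
  · rintro s' ⟨_, h25, _⟩
    omega
  · refine ⟨?_, ?_, ?_⟩
    · intro i hi
      simp only [List.mem_cons, List.not_mem_nil, or_false, not_or] at hi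
      simp [Prog.step, hi]
    · simp [Prog.step, hs.2.2.2.2.2, ArithOp.eval]
    · simpa [Prog.step, Filled] using hF
  · rintro s' ⟨hA, _, hF⟩
    exact ⟨hA, hF⟩

/-- Read off the number of closed walks of the length in register `30`. -/
def traceBody : Prog := .all [.load 40 41, .arith .add 31 31 40, .arith .add 41 41 22,
  .arith .add 41 41 20, .arith .sub 42 42 20]

/-- Neighbouring diagonal entries of a layer are n² + 1 apart, so the address advances by registers
22 and 20. -/
def traceProg : Prog := .seq (.all [.arith .mul 41 30 24, .arith .add 41 41 22, .const 31 0,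
  .arith .add 42 22 23]) (.loop 42 traceBody)

theorem traceProg_reach (hg : 1 ≤ g) {s : State} (hs : Consts n s)
    (hN2 : (n * n * (n * n)).size ≤ g) {A : ℕ → ℕ} {x l : ℕ} (hl : s.reg 30 = l)
    (hF : ∀ y < x, s.mem (n * n + y) = walkCell n A y) (hx : (l + 1) * (n * n * (n * n)) ≤ x) :
    Reach g traceProg s (4 + (n * n * (5 + 1) + 1)) fun s' =>
      Agree [31, 40, 41, 42] s s' ∧ s'.mem = s.mem ∧
        s'.reg 31 = ∑ e ∈ Finset.range (n * n), walkTable n A l e e := by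
  refine Reach.seq (Reach.step hg (by simp [Prog.Ok, Prog.all, hs.2.2.2.2.2, hN2]) rfl) ?_
  rintro s₁ rfl
  refine Reach.mono (Reach.loop (T := traceBody.len) (fun j s' => Agree [31, 40, 41, 42] s s' ∧
    s'.mem = s.mem ∧ s'.reg 42 = n * n - j ∧
    s'.reg 41 = n * n + ((l * (n * n) + j) * (n * n) + j) ∧
    s'.reg 31 = ∑ e ∈ Finset.range j, walkTable n A l e e) (n * n) ?_ ?_ ?_) le_rfl ?_
  · rintro j hj s' ⟨hA, hm, h42, h41, h31⟩
    obtain ⟨-, c20, -, c22, -, -⟩ := hs.agree hA (by decide)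
    refine ⟨by omega, Reach.step hg (by simp [traceBody, Prog.Ok, Prog.all])
      ⟨?_, ?_, ?_, ?_, ?_⟩⟩
    · intro i hi
      have := hA i hi
      simp only [List.mem_cons, List.not_mem_nil, or_false, not_or] at hi
      simp [traceBody, Prog.step, Prog.all, hi, this]
    · simp [traceBody, Prog.step, Prog.all, hm]
    · simp [traceBody, Prog.step, Prog.all, h42, c20, ArithOp.eval]
      omega
    · simp [traceBody, Prog.step, Prog.all, h41, c20, c22, ArithOp.eval]
      ring
    · have hlt : (l * (n * n) + j) * (n * n) + j < x := by
        refine lt_of_lt_of_le ?_ hx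
        nlinarith
      simp [traceBody, Prog.step, Prog.all, h41, h31, hm, ArithOp.eval, Finset.sum_range_succ,
        hF _ hlt, walkCell_mk A hj hj]
  · rintro s' ⟨_, _, h42, _⟩
    omega
  · refine ⟨?_, ?_, ?_, ?_, ?_⟩
    · intro i hi
      simp only [List.mem_cons, List.not_mem_nil, or_false, not_or] at hi
      simp [Prog.step, Prog.all, hi]
    · simp [Prog.step, Prog.all]
    · simp [Prog.step, Prog.all, hs.2.2.2.1, hs.2.2.2.2.1, ArithOp.eval]
    · simp [Prog.step, Prog.all, hs.2.2.2.1, hs.2.2.2.2.2, hl, ArithOp.eval]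
      ring
    · simp [Prog.step, Prog.all]
  · rintro s' ⟨hA, hm, _, _, h31⟩
    exact ⟨hA, hm, h31⟩

/-- Compute the power of register `32` with the exponent in register `33`. -/
def powBody : Prog := .all [.arith .mul 34 34 32, .arith .sub 33 33 20]

def powProg : Prog := .seq (.const 34 1) (.loop 33 powBody)

/-- The growing power is the left factor of the product, so only the base has to be short. -/
theorem powProg_reach (hg : 1 ≤ g) {s : State} (hs : Consts n s) (h32 : (s.reg 32).size ≤ g) :
    Reach g powProg s (1 + (s.reg 33 * (2 + 1) + 1)) fun s' =>
      Agree [33, 34] s s' ∧ s'.mem = s.mem ∧ s'.reg 34 = s.reg 32 ^ s.reg 33 := by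
  refine Reach.seq (Reach.step hg (by simp [Prog.Ok, hg]) rfl) ?_
  rintro s₁ rfl
  refine Reach.mono (Reach.loop (T := powBody.len) (fun j s' => Agree [33, 34] s s' ∧
    s'.mem = s.mem ∧ s'.reg 33 = s.reg 33 - j ∧ s'.reg 34 = s.reg 32 ^ j) (s.reg 33)
    ?_ ?_ ?_) le_rfl ?_
  · rintro j hj s' ⟨hA, hm, h33, h34⟩
    obtain ⟨-, c20, -, -, -, -⟩ := hs.agree hA (by decide)
    have k32 := hA 32 (by decide)
    refine ⟨by omega, Reach.step hg (by simp [powBody, Prog.Ok, Prog.all, k32, h32])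
      ⟨?_, ?_, ?_, ?_⟩⟩
    · intro i hi
      have := hA i hi
      simp only [List.mem_cons, List.not_mem_nil, or_false, not_or] at hi
      simp [powBody, Prog.step, Prog.all, hi, this]
    · simp [powBody, Prog.step, Prog.all, hm]
    · simp [powBody, Prog.step, Prog.all, h33, c20, ArithOp.eval]
      omega
    · simp [powBody, Prog.step, Prog.all, h34, k32, ArithOp.eval, pow_succ]
  · rintro s' ⟨_, _, h33, _⟩
    omega
  · refine ⟨?_, ?_, ?_, ?_⟩
    · intro i hi
      simp only [List.mem_cons, List.not_mem_nil, or_false, not_or] at hi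
      simp [Prog.step, hi]
    · simp [Prog.step]
    · simp [Prog.step]
    · simp [Prog.step]
  · rintro s' ⟨hA, hm, _, h34⟩
    exact ⟨hA, hm, h34⟩

/-- Compute everything that is needed for the length in register `30`, and save it in the registers
`o`, `o + 1` and `o + 2`. -/
def lengthProg (o : ℕ) : Prog :=
  .seq traceProg (.seq (.all [.arith .add 32 0 23, .arith .add 33 30 23]) (.seq powProg
    (.seq (.all [.arith .add o 31 23, .arith .add (o + 1) 34 23, .arith .add 32 13 23,
      .arith .add 33 30 23]) (.seq powProg (.arith .add (o + 2) 34 23)))))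

/-- The condition 50 ≤ o keeps the saved results away from the working registers, so that the three
calls do not interfere. -/
theorem lengthProg_reach (hg : 1 ≤ g) {s : State} (hs : Consts n s) (hn : n.size ≤ g)
    (hN2 : (n * n * (n * n)).size ≤ g) {A : ℕ → ℕ} {x l o : ℕ} (hl : s.reg 30 = l)
    (hF : ∀ y < x, s.mem (n * n + y) = walkCell n A y) (hx : (l + 1) * (n * n * (n * n)) ≤ x)
    (h13 : (s.reg 13).size ≤ g) (ho : 50 ≤ o) :
    Reach g (lengthProg o) s ((4 + (n * n * (5 + 1) + 1)) + (2 + ((1 + (l * (2 + 1) + 1)) +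
      (4 + ((1 + (l * (2 + 1) + 1)) + 1))))) fun s' =>
      Agree [31, 32, 33, 34, 40, 41, 42, o, o + 1, o + 2] s s' ∧ s'.mem = s.mem ∧
        s'.reg o = (∑ e ∈ Finset.range (n * n), walkTable n A l e e) ∧
        s'.reg (o + 1) = n ^ l ∧ s'.reg (o + 2) = s.reg 13 ^ l := by
  refine Reach.seq (traceProg_reach hg hs hN2 hl hF hx) ?_
  rintro s₁ ⟨hA₁, hm₁, h31⟩
  have hc₁ := hs.agree hA₁ (by decide)
  refine Reach.seq (Reach.step hg (by simp [Prog.Ok, Prog.all]) rfl) ?_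
  rintro s₂ hs₂
  replace hs₂ := hs₂.symm
  have hA₂ : Agree [31, 32, 33, 40, 41, 42] s s₂ := by
    intro i hi
    simp only [List.mem_cons, List.not_mem_nil, or_false, not_or] at hi
    rw [← hA₁ i (by simp [hi]), hs₂]
    simp [Prog.step, Prog.all, hi]
  have hc₂ := hs.agree hA₂ (by decide)
  have h31₂ : s₂.reg 31 = s₁.reg 31 := by simp [hs₂, Prog.step, Prog.all]
  have h32₂ : s₂.reg 32 = n := by
    simp [hs₂, Prog.step, Prog.all, hc₁.1, hc₁.2.2.2.2.1, ArithOp.eval]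
  have h33₂ : s₂.reg 33 = l := by
    simp [hs₂, Prog.step, Prog.all, hA₁ 30 (by decide), hl, hc₁.2.2.2.2.1, ArithOp.eval]
  have hm₂ : s₂.mem = s.mem := by simp [hs₂, Prog.step, Prog.all, hm₁]
  refine Reach.seq ((powProg_reach hg hc₂ (by rwa [h32₂])).mono (by rw [h33₂]) fun _ h => h) ?_
  rintro s₃ ⟨hA₃, hm₃, h34⟩
  rw [h32₂, h33₂] at h34
  have hA₃' := hA₂.mono (R := [31, 32, 33, 34, 40, 41, 42]) (by decide) |>.trans hA₃ (by decide)
  have hc₃ := hs.agree hA₃' (by decide)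
  refine Reach.seq (Reach.step hg (by simp [Prog.Ok, Prog.all]) rfl) ?_
  rintro s₄ hs₄
  replace hs₄ := hs₄.symm
  have hA₄ : Agree [31, 32, 33, 34, 40, 41, 42, o, o + 1] s s₄ := by
    intro i hi
    simp only [List.mem_cons, List.not_mem_nil, or_false, not_or] at hi
    rw [← hA₃' i (by simp [hi]), hs₄]
    simp [Prog.step, Prog.all, hi]
  have hc₄ := hs.agree hA₄ (by simp; omega)
  have e1 : ¬ o = 32 := by omega
  have e2 : ¬ o = 33 := by omega
  have e3 : ¬ o = o + 1 := by omega
  have e4 : ¬ 13 = o := by omega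
  have e5 : ¬ 13 = o + 1 := by omega
  have e6 : ¬ 30 = o := by omega
  have e7 : ¬ 30 = o + 1 := by omega
  have e8 : ¬ 34 = o := by omega
  have e9 : ¬ 23 = o := by omega
  have e10 : ¬ 23 = o + 1 := by omega
  have e11 : ¬ o + 1 = 32 := by omega
  have e12 : ¬ o + 1 = 33 := by omega
  have ho₄ : s₄.reg o = s₁.reg 31 := by
    simp [hs₄, Prog.step, Prog.all, e1, e2, hc₃.2.2.2.2.1, hA₃ 31 (by decide), h31₂, ArithOp.eval]
  have ho₄' : s₄.reg (o + 1) = n ^ l := by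
    simp [hs₄, Prog.step, Prog.all, e8, e9, e11, e12, h34, hc₃.2.2.2.2.1, ArithOp.eval]
  have h32₄ : s₄.reg 32 = s.reg 13 := by
    simp [hs₄, Prog.step, Prog.all, e4, e5, e9, e10, hA₃' 13 (by decide), hc₃.2.2.2.2.1,
      ArithOp.eval]
  have h33₄ : s₄.reg 33 = l := by
    simp [hs₄, Prog.step, Prog.all, e6, e7, e9, e10, hA₃' 30 (by decide), hl, hc₃.2.2.2.2.1,
      ArithOp.eval]
  have hm₄ : s₄.mem = s.mem := by simp [hs₄, Prog.step, Prog.all, hm₃, hm₂]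
  refine Reach.seq ((powProg_reach hg hc₄ (by rwa [h32₄])).mono (by rw [h33₄]) fun _ h => h) ?_
  rintro s₅ ⟨hA₅, hm₅, h34₅⟩
  rw [h32₄, h33₄] at h34₅
  have hA₅' := hA₄.trans hA₅ (by simp)
  have hc₅ := hs.agree hA₅' (by simp; omega)
  refine Reach.step hg (by simp [Prog.Ok]) ⟨?_, ?_, ?_, ?_, ?_⟩
  · intro i hi
    simp only [List.mem_cons, List.not_mem_nil, or_false, not_or] at hi
    rw [← hA₅' i (by simp [hi])]
    simp [Prog.step, hi]
  · simp [Prog.step, hm₅, hm₄]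
  · have := hA₅ o (by simp; omega)
    simp [Prog.step, this, ho₄, h31]
  · have := hA₅ (o + 1) (by simp; omega)
    simp [Prog.step, this, ho₄']
  · simp [Prog.step, h34₅, hc₅.2.2.2.2.1, ArithOp.eval]

end Program

/-! ### The table contains the powers of the nonbacktracking matrix -/

section Decode

variable {n : ℕ}

theorem sum_range_sq (F : ℕ → ℕ) :
    ∑ x ∈ Finset.range (n * n), F x = ∑ e : Fin n × Fin n, F (e.1.val * n + e.2.val) := by
  rw [Finset.sum_range, ← finProdFinEquiv.sum_comp]
  refine Finset.sum_congr rfl fun e _ => ?_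
  congr 1
  simp only [finProdFinEquiv, Equiv.coe_fn_mk]
  ring

theorem encode_div (u v : Fin n) : (u.val * n + v.val) / n = u.val := by
  rw [mul_comm, Nat.mul_add_div (by have := u.2; omega), Nat.div_eq_of_lt v.2, add_zero]

theorem encode_mod (u v : Fin n) : (u.val * n + v.val) % n = v.val := by
  rw [mul_comm, Nat.mul_add_mod, Nat.mod_eq_of_lt v.2]

theorem encode_injective {u v u' v' : Fin n} (h : u.val * n + v.val = u'.val * n + v'.val) :
    u = u' ∧ v = v' := by
  have h1 := encode_div u v
  have h2 := encode_mod u v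
  rw [h] at h1 h2
  rw [encode_div] at h1
  rw [encode_mod] at h2
  exact ⟨Fin.ext h1.symm, Fin.ext h2.symm⟩

theorem inputState_mem (G : SimpleGraph (Fin n)) (u v : Fin n) :
    (inputState G).mem (u.val * n + v.val) = if G.Adj u v then 1 else 0 := by
  simp only [inputState]
  refine if_congr ⟨?_, fun h => ⟨u, v, rfl, h⟩⟩ rfl rfl
  rintro ⟨u', v', h, hadj⟩
  obtain ⟨rfl, rfl⟩ := encode_injective h
  exact hadj

/-- Both sides satisfy the same recursion on the last step: in the matrix product only the middle
pairs (u, f.1) contribute. -/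
theorem walkTable_eq (G : SimpleGraph (Fin n)) (t : ℕ) (e f : Fin n × Fin n) :
    walkTable n (inputState G).mem t (e.1.val * n + e.2.val) (f.1.val * n + f.2.val) =
      (nbMatrix G ^ t) e f := by
  induction t generalizing f with
  | zero =>
    rw [walkTable, pow_zero, Matrix.one_apply]
    refine if_congr ⟨fun h => ?_, fun h => by rw [h]⟩ rfl rfl
    exact Prod.ext (encode_injective h).1 (encode_injective h).2
  | succ t ih =>
    rw [walkTable, pow_succ, Matrix.mul_apply, Fintype.sum_prod_type, Finset.sum_range,
      Finset.sum_mul, encode_mod, encode_div, inputState_mem]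
    refine Finset.sum_congr rfl fun u _ => ?_
    rw [Finset.sum_eq_single f.1]
    · rw [← ih (u, f.1)]
      simp only [nbMatrix, Fin.ext_iff, true_and, ne_eq]
      split_ifs <;> simp_all
    · intro v _ hv
      simp [nbMatrix, hv]
    · simp

theorem sum_walkTable (G : SimpleGraph (Fin n)) (l : ℕ) [NeZero l] :
    ∑ x ∈ Finset.range (n * n), walkTable n (inputState G).mem l x x =
      closedNonbacktrackingCount G l := by
  rw [closedNonbacktrackingCount_eq_trace, sum_range_sq, Matrix.trace]
  exact Finset.sum_congr rfl fun e _ => walkTable_eq G l e e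

theorem sum_inputState_mem (G : SimpleGraph (Fin n)) :
    ∑ x ∈ Finset.range (n * n), (inputState G).mem x = 2 * G.edgeSet.ncard := by
  rw [sum_range_sq, Fintype.sum_prod_type, Set.ncard_eq_toFinset_card']
  have h := G.sum_degrees_eq_twice_card_edges
  rw [SimpleGraph.edgeFinset] at h
  rw [← h]
  refine Finset.sum_congr rfl fun u _ => ?_
  simp only [inputState_mem]
  rw [Finset.sum_boole, ← SimpleGraph.card_neighborFinset_eq_degree,
    SimpleGraph.neighborFinset_eq_filter, Nat.cast_id]

theorem inputState_mem_le (G : SimpleGraph (Fin n)) (x : ℕ) : (inputState G).mem x ≤ 1 := by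
  simp only [inputState]
  split_ifs <;> norm_num

end Decode

/-! ### Efficiency -/

section Efficiency

/-- `f` is bounded by a polynomial. -/
def PolyBdd (f : ℕ → ℕ) : Prop := ∃ c, ∀ n, f n ≤ c * (n + 1) ^ c

theorem PolyBdd.of_le {f h : ℕ → ℕ} (hh : PolyBdd h) (hle : ∀ n, f n ≤ h n) : PolyBdd f := by
  obtain ⟨c, hc⟩ := hh
  exact ⟨c, fun n => (hle n).trans (hc n)⟩

theorem PolyBdd.const (a : ℕ) : PolyBdd fun _ => a :=
  ⟨a, fun _ => Nat.le_mul_of_pos_right _ (by positivity)⟩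

theorem PolyBdd.id : PolyBdd fun n => n := ⟨1, fun n => by simp⟩

theorem PolyBdd.add {f h : ℕ → ℕ} (hf : PolyBdd f) (hh : PolyBdd h) :
    PolyBdd fun n => f n + h n := by
  obtain ⟨c, hc⟩ := hf
  obtain ⟨c', hc'⟩ := hh
  refine ⟨c + c', fun n => ?_⟩
  rw [add_mul]
  exact add_le_add
    ((hc n).trans (Nat.mul_le_mul_left _ (Nat.pow_le_pow_right (by omega) (by omega))))
    ((hc' n).trans (Nat.mul_le_mul_left _ (Nat.pow_le_pow_right (by omega) (by omega))))

theorem PolyBdd.mul {f h : ℕ → ℕ} (hf : PolyBdd f) (hh : PolyBdd h) :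
    PolyBdd fun n => f n * h n := by
  obtain ⟨c, hc⟩ := hf
  obtain ⟨c', hc'⟩ := hh
  -- One constant has to serve as factor, at least c c', and as exponent, at least c + c'.
  refine ⟨c * c' + c + c', fun n => ?_⟩
  calc f n * h n ≤ c * (n + 1) ^ c * (c' * (n + 1) ^ c') := Nat.mul_le_mul (hc n) (hc' n)
    _ = c * c' * (n + 1) ^ (c + c') := by rw [pow_add]; ring
    _ ≤ (c * c' + c + c') * (n + 1) ^ (c * c' + c + c') :=
        Nat.mul_le_mul (by omega) (Nat.pow_le_pow_right (by omega) (by omega))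

theorem size_le_self (n : ℕ) : n.size ≤ n := Nat.size_le.2 Nat.lt_two_pow_self

theorem scale_le (n : ℕ) : scale n ≤ n + 1 :=
  Nat.succ_le_succ ((size_le_self _).trans (size_le_self _))

/-- The first half of the program computes the numbers of edges and of closed walks, and powers. -/
def countProg : Prog :=
  .seq (.all [.const 20 1, .const 21 2, .const 23 0, .arith .mul 22 0 0, .arith .mul 24 22 22,
    .arith .add 16 0 23]) (.seq degreeProg (.seq sizeProg (.seq (.arith .add 16 17 23)
  (.seq sizeProg (.seq (.all [.arith .add 17 17 20, .arith .add 18 17 17, .arith .add 19 18 18])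
  (.seq baseProg (.seq tableProg (.seq (.arith .add 30 18 23) (.seq (lengthProg 50)
  (.seq (.arith .add 30 18 20) (.seq (lengthProg 53) (.seq (.arith .add 30 19 23)
  (lengthProg 56)))))))))))))

/-- A bound for the number of steps of `lengthProg`. -/
def lengthTime (n l : ℕ) : ℕ := (4 + (n * n * (5 + 1) + 1)) + (2 + ((1 + (l * (2 + 1) + 1)) +
  (4 + ((1 + (l * (2 + 1) + 1)) + 1))))

/-- A bound for the number of steps of `countProg`. -/
def countTime (n : ℕ) : ℕ :=
  6 + ((2 + (n * n * (3 + 1) + 1)) + ((1 + (n * (2 + 1) + 1)) + (1 + ((1 + (n * (2 + 1) + 1)) +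
    (3 + ((3 + (n * n * (n * n) * (11 + 1) + 1)) +
    ((1 + (4 * scale n * (n * n * (n * n)) * (9 + (2 + (n * (9 + 1) + 1) + 6) + 1) + 1)) +
    (1 + (lengthTime n (2 * scale n) + (1 + (lengthTime n (2 * scale n + 1) +
      (1 + lengthTime n (4 * scale n)))))))))))))

/-- The number of digits by which the numbers may grow in a step. -/
def growth (n : ℕ) : ℕ := n * n * (n * n) + n * n + n + 2

/-- The specifications of the parts are chained, with `Agree` carrying the other registers along.
`growth n` bounds the digits of everything that occurs as a right factor: n, n², n⁴, the entries of
the adjacency matrix and the sum of the degrees. -/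
theorem countProg_reach {n : ℕ} (G : SimpleGraph (Fin n)) :
    Reach (growth n) countProg (inputState G) (countTime n) fun s =>
      Consts n s ∧ s.reg 13 = 2 * G.edgeSet.ncard ∧
      s.reg 50 = closedNonbacktrackingCount G (2 * scale n) ∧ s.reg 51 = n ^ (2 * scale n) ∧
      s.reg 52 = (2 * G.edgeSet.ncard) ^ (2 * scale n) ∧
      s.reg 53 = closedNonbacktrackingCount G (2 * scale n + 1) ∧
      s.reg 54 = n ^ (2 * scale n + 1) ∧
      s.reg 55 = (2 * G.edgeSet.ncard) ^ (2 * scale n + 1) ∧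
      s.reg 56 = closedNonbacktrackingCount G (4 * scale n) ∧ s.reg 57 = n ^ (4 * scale n) ∧
      s.reg 58 = (2 * G.edgeSet.ncard) ^ (4 * scale n) := by
  set A := (inputState G).mem with hA
  set D := 2 * G.edgeSet.ncard with hD
  set j := scale n with hj
  have hj1 : 1 ≤ j := Nat.succ_pos _
  have hg : 1 ≤ growth n := by rw [growth]; omega
  have hn : n.size ≤ growth n := (size_le_self n).trans (by rw [growth]; omega)
  have hN : (n * n).size ≤ growth n := (size_le_self _).trans (by rw [growth]; omega)
  have hN2 : (n * n * (n * n)).size ≤ growth n := (size_le_self _).trans (by rw [growth]; omega)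
  have hA1 : ∀ y < n * n, (A y).size ≤ growth n := fun y _ =>
    (size_le_self _).trans ((inputState_mem_le G y).trans hg)
  have hDg : D.size ≤ growth n := by
    refine (size_le_self _).trans ?_
    rw [hD, ← sum_inputState_mem]
    refine (Finset.sum_le_card_nsmul _ _ 1 fun x _ => inputState_mem_le G x).trans ?_
    simp [growth]
    omega
  have h2g : (2 : ℕ).size ≤ growth n := (size_le_self 2).trans (by rw [growth]; omega)
  have i0 : (inputState G).reg 0 = n := by simp [inputState]
  refine Reach.seq (Reach.step hg (by simp [Prog.Ok, Prog.all, Prog.step, i0, hn, hN, h2g, hg,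
    ArithOp.eval]) (Q := fun s => Consts n s ∧ s.reg 16 = n ∧ s.mem = A) ?_) ?_
  · simp [Consts, Prog.step, Prog.all, i0, ArithOp.eval, hA]
  rintro s₁ ⟨hc₁, h16, hm₁⟩
  refine Reach.seq (degreeProg_reach hg hc₁) ?_
  rintro s₂ ⟨hA₂, hm₂, h13⟩
  have hc₂ := hc₁.agree hA₂ (by decide)
  rw [hm₁, hA, sum_inputState_mem, ← hD] at h13
  have h16₂ : s₂.reg 16 = n := (hA₂ 16 (by decide)).trans h16
  refine Reach.seq ((sizeProg_reach hg hc₂).mono (T' := 1 + (n * (2 + 1) + 1)) ?_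
    fun _ h => h) ?_
  · rw [h16₂]
    have := size_le_self n
    gcongr
  rintro s₃ ⟨hA₃, hm₃, h17⟩
  have hc₃ := hc₂.agree hA₃ (by decide)
  rw [h16₂] at h17
  refine Reach.seq (Reach.step hg (by simp [Prog.Ok]) (Q := fun s => Agree [16] s₃ s ∧
    s.reg 16 = n.size ∧ s.mem = A) ⟨?_, ?_, ?_⟩) ?_
  · intro i hi
    simp only [List.mem_cons, List.not_mem_nil, or_false] at hi
    simp [Prog.step, hi]
  · simp [Prog.step, h17, hc₃.2.2.2.2.1, ArithOp.eval]
  · simp [Prog.step, hm₃, hm₂, hm₁]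
  rintro s₄ ⟨hA₄, h16₄, hm₄⟩
  have hc₄ := hc₃.agree hA₄ (by decide)
  refine Reach.seq ((sizeProg_reach hg hc₄).mono (T' := 1 + (n * (2 + 1) + 1)) ?_
    fun _ h => h) ?_
  · rw [h16₄]
    have := (size_le_self n.size).trans (size_le_self n)
    gcongr
  rintro s₅ ⟨hA₅, hm₅, h17₅⟩
  have hc₅ := hc₄.agree hA₅ (by decide)
  rw [h16₄] at h17₅
  have h13₅ : s₅.reg 13 = D := by
    rw [hA₅ 13 (by decide), hA₄ 13 (by decide), hA₃ 13 (by decide), h13]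
  refine Reach.seq (Reach.step hg (by simp [Prog.Ok, Prog.all]) (Q := fun s =>
    Consts n s ∧ s.reg 13 = D ∧ s.reg 18 = 2 * j ∧ s.reg 19 = 4 * j ∧ s.mem = A) ?_) ?_
  · refine ⟨hc₅.agree (R := [17, 18, 19]) (fun i hi => ?_) (by decide), ?_, ?_, ?_, ?_⟩
    · simp only [List.mem_cons, List.not_mem_nil, or_false, not_or] at hi
      simp [Prog.step, Prog.all, hi]
    · simp [Prog.step, Prog.all, h13₅]
    · simp [Prog.step, Prog.all, h17₅, hc₅.2.1, ArithOp.eval, hj, scale]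
      omega
    · simp [Prog.step, Prog.all, h17₅, hc₅.2.1, ArithOp.eval, hj, scale]
      omega
    · simp [Prog.step, Prog.all, hm₅, hm₄]
  rintro s₆ ⟨hc₆, h13₆, h18₆, h19₆, hm₆⟩
  refine Reach.seq (baseProg_reach hg hc₆ hN (A := A) fun y _ => by rw [hm₆]) ?_
  rintro s₇ ⟨hA₇, hF₇⟩
  have hc₇ := hc₆.agree hA₇ (by decide)
  have h19₇ := (hA₇ 19 (by decide)).trans h19₆
  refine Reach.seq ((tableProg_reach hg hc₇ hN hN2 hn hA1 hF₇).mono (by rw [h19₇])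
    fun _ h => h) ?_
  rintro s₈ ⟨hA₈, hF₈⟩
  have hc₈ := hc₇.agree hA₈ (by decide)
  rw [h19₇] at hF₈
  have h13₈ : s₈.reg 13 = D := by rw [hA₈ 13 (by decide), hA₇ 13 (by decide), h13₆]
  have h18₈ : s₈.reg 18 = 2 * j := by rw [hA₈ 18 (by decide), hA₇ 18 (by decide), h18₆]
  have h19₈ : s₈.reg 19 = 4 * j := by rw [hA₈ 19 (by decide), h19₇]
  have hcell := hF₈.2.2.2
  have hx : ∀ l, l ≤ 4 * j → (l + 1) * (n * n * (n * n)) ≤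
      n * n * (n * n) + 4 * j * (n * n * (n * n)) := fun l hl => by
    have := Nat.mul_le_mul_right (n * n * (n * n)) hl
    rw [add_mul]
    omega
  have : NeZero (2 * j) := ⟨by omega⟩
  have : NeZero (4 * j) := ⟨by omega⟩
  refine Reach.seq (Reach.step hg (by simp [Prog.Ok]) (Q := fun s => Agree [30] s₈ s ∧
    s.reg 30 = 2 * j ∧ s.mem = s₈.mem) ⟨?_, ?_, ?_⟩) ?_
  · intro i hi
    simp only [List.mem_cons, List.not_mem_nil, or_false] at hi
    simp [Prog.step, hi]
  · simp [Prog.step, h18₈, hc₈.2.2.2.2.1, ArithOp.eval]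
  · simp [Prog.step]
  rintro s₉ ⟨hA₉, h30₉, hm₉⟩
  have hc₉ := hc₈.agree hA₉ (by decide)
  have h13₉ := (hA₉ 13 (by decide)).trans h13₈
  refine Reach.seq (lengthProg_reach hg hc₉ hn hN2 h30₉ (by rwa [hm₉]) (hx _ (by omega))
    (by rwa [h13₉]) (by norm_num)) ?_
  rintro s₁₀ ⟨hA₁₀, hm₁₀, h50, h51, h52⟩
  have hc₁₀ := hc₉.agree hA₁₀ (by decide)
  have h13₁₀ := (hA₁₀ 13 (by decide)).trans h13₉
  have h18₁₀ : s₁₀.reg 18 = 2 * j := by rw [hA₁₀ 18 (by decide), hA₉ 18 (by decide), h18₈]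
  have h19₁₀ : s₁₀.reg 19 = 4 * j := by rw [hA₁₀ 19 (by decide), hA₉ 19 (by decide), h19₈]
  rw [sum_walkTable] at h50
  rw [h13₉] at h52
  refine Reach.seq (Reach.step hg (by simp [Prog.Ok]) (Q := fun s => Agree [30] s₁₀ s ∧
    s.reg 30 = 2 * j + 1 ∧ s.mem = s₈.mem) ⟨?_, ?_, ?_⟩) ?_
  · intro i hi
    simp only [List.mem_cons, List.not_mem_nil, or_false] at hi
    simp [Prog.step, hi]
  · simp [Prog.step, h18₁₀, hc₁₀.2.1, ArithOp.eval]
  · simp [Prog.step, hm₁₀, hm₉]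
  rintro s₁₁ ⟨hA₁₁, h30₁₁, hm₁₁⟩
  have hc₁₁ := hc₁₀.agree hA₁₁ (by decide)
  have h13₁₁ := (hA₁₁ 13 (by decide)).trans h13₁₀
  refine Reach.seq (lengthProg_reach hg hc₁₁ hn hN2 h30₁₁ (by rwa [hm₁₁]) (hx _ (by omega))
    (by rwa [h13₁₁]) (by norm_num)) ?_
  rintro s₁₂ ⟨hA₁₂, hm₁₂, h53, h54, h55⟩
  have hc₁₂ := hc₁₁.agree hA₁₂ (by decide)
  have h13₁₂ := (hA₁₂ 13 (by decide)).trans h13₁₁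
  have h19₁₂ : s₁₂.reg 19 = 4 * j := by rw [hA₁₂ 19 (by decide), hA₁₁ 19 (by decide), h19₁₀]
  have k12 : ∀ i ∈ [50, 51, 52], s₁₂.reg i = s₁₀.reg i := fun i hi => by
    simp only [List.mem_cons, List.not_mem_nil, or_false] at hi
    rcases hi with rfl | rfl | rfl <;> rw [hA₁₂ _ (by decide), hA₁₁ _ (by decide)]
  rw [sum_walkTable] at h53
  rw [h13₁₁] at h55
  refine Reach.seq (Reach.step hg (by simp [Prog.Ok]) (Q := fun s => Agree [30] s₁₂ s ∧
    s.reg 30 = 4 * j ∧ s.mem = s₈.mem) ⟨?_, ?_, ?_⟩) ?_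
  · intro i hi
    simp only [List.mem_cons, List.not_mem_nil, or_false] at hi
    simp [Prog.step, hi]
  · simp [Prog.step, h19₁₂, hc₁₂.2.2.2.2.1, ArithOp.eval]
  · simp [Prog.step, hm₁₂, hm₁₁]
  rintro s₁₃ ⟨hA₁₃, h30₁₃, hm₁₃⟩
  have hc₁₃ := hc₁₂.agree hA₁₃ (by decide)
  have h13₁₃ := (hA₁₃ 13 (by decide)).trans h13₁₂
  refine (lengthProg_reach hg hc₁₃ hn hN2 h30₁₃ (by rwa [hm₁₃]) (hx _ le_rfl)
    (by rwa [h13₁₃]) (by norm_num) (o := 56)).mono le_rfl ?_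
  rintro s₁₄ ⟨hA₁₄, -, h56, h57, h58⟩
  rw [sum_walkTable] at h56
  rw [h13₁₃] at h58
  have k14 : ∀ i ∈ [50, 51, 52, 53, 54, 55], s₁₄.reg i = s₁₂.reg i := fun i hi => by
    simp only [List.mem_cons, List.not_mem_nil, or_false] at hi
    rcases hi with rfl | rfl | rfl | rfl | rfl | rfl <;>
      rw [hA₁₄ _ (by decide), hA₁₃ _ (by decide)]
  refine ⟨hc₁₃.agree hA₁₄ (by decide), (hA₁₄ 13 (by decide)).trans h13₁₃, ?_, ?_, ?_, ?_, ?_, ?_,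
    h56, h57, h58⟩
  · rw [k14 50 (by decide), k12 50 (by decide), h50]
  · rw [k14 51 (by decide), k12 51 (by decide), h51]
  · rw [k14 52 (by decide), k12 52 (by decide), h52]
  · rw [k14 53 (by decide), h53]
  · rw [k14 54 (by decide), h54]
  · rw [k14 55 (by decide), h55]

/-- The second half of the program computes the estimates. -/
def estimateProg : Prog := .all [.arith .mul 60 50 51, .arith .sub 60 60 52,
  .arith .mul 61 56 57, .arith .sub 61 61 58,
  .arith .mul 62 60 60, .arith .mul 62 21 62, .arith .add 62 62 61, .arith .mul 63 21 61,
  .arith .div 62 62 63, .arith .add 62 20 62,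
  .arith .mul 64 13 60, .arith .add 65 64 55, .arith .mul 66 53 54, .arith .sub 65 65 66,
  .arith .mul 66 62 64, .arith .sub 67 62 20, .arith .mul 67 67 65, .arith .sub 66 66 67,
  .arith .mul 67 0 60,
  .arith .add 1 66 23, .arith .add 2 67 23, .arith .add 3 65 23, .arith .add 4 67 23,
  .arith .add 0 62 23]

/-- Registers 60 and 61 hold the excesses at 2j and 4j, 62 the estimate of k, 65 and 66 the
numerators for b and a, and 67 in the end their common denominator. Register 0 is overwritten last,
since n is needed until then. -/
theorem estimateProg_output {n : ℕ} (G : SimpleGraph (Fin n)) {s : State} (hc : Consts n s)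
    (h13 : s.reg 13 = 2 * G.edgeSet.ncard)
    (h50 : s.reg 50 = closedNonbacktrackingCount G (2 * scale n))
    (h51 : s.reg 51 = n ^ (2 * scale n))
    (h52 : s.reg 52 = (2 * G.edgeSet.ncard) ^ (2 * scale n))
    (h53 : s.reg 53 = closedNonbacktrackingCount G (2 * scale n + 1))
    (h54 : s.reg 54 = n ^ (2 * scale n + 1))
    (h55 : s.reg 55 = (2 * G.edgeSet.ncard) ^ (2 * scale n + 1))
    (h56 : s.reg 56 = closedNonbacktrackingCount G (4 * scale n))
    (h57 : s.reg 57 = n ^ (4 * scale n))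
    (h58 : s.reg 58 = (2 * G.edgeSet.ncard) ^ (4 * scale n)) :
    (estimateProg.step s).output = estimator n G := by
  obtain ⟨c0, c20, c21, -, c23, -⟩ := hc
  simp [State.output, estimateProg, Prog.step, Prog.all, ArithOp.eval, estimator, estimateOf,
    kHat, excess, aNum, bNum, c0, c20, c21, c23, h13, h50, h51, h52, h53, h54, h55, h56, h57, h58]

theorem inputState_bdd {n : ℕ} (G : SimpleGraph (Fin n)) : (inputState G).Bdd (n + 1) := by
  refine ⟨fun i => (size_le_self _).trans ?_, fun x => (size_le_self _).trans ?_⟩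
  · simp only [inputState]
    split_ifs <;> omega
  · exact (inputState_mem_le G x).trans (by omega)

theorem polyBdd_scale : PolyBdd scale := (PolyBdd.id.add (PolyBdd.const 1)).of_le scale_le

theorem polyBdd_growth : PolyBdd growth := by
  unfold growth
  repeat' first
    | with_reducible exact PolyBdd.id
    | with_reducible exact PolyBdd.const _
    | with_reducible refine PolyBdd.add ?_ ?_
    | with_reducible refine PolyBdd.mul ?_ ?_

theorem polyBdd_countTime : PolyBdd countTime := by
  unfold countTime lengthTime
  repeat' first
    | with_reducible exact PolyBdd.id
    | with_reducible exact polyBdd_scale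
    | with_reducible exact PolyBdd.const _
    | with_reducible refine PolyBdd.add ?_ ?_
    | with_reducible refine PolyBdd.mul ?_ ?_

/-- After the counting phase all numbers have polynomially many digits, and the loop-free second
phase takes time linear in that number of digits. -/
theorem estimator_isEfficient : IsEfficient estimator := by
  obtain ⟨c, hc⟩ := Prog.LoopFree.exec (P := estimateProg)
    (by simp [estimateProg, Prog.all, Prog.LoopFree])
  have hpoly : PolyBdd fun n =>
      countTime n * (1 + 2 * ((n + 1) + countTime n * growth n)) +
        c * (1 + ((n + 1) + countTime n * growth n)) := by
    repeat' first
      | with_reducible exact PolyBdd.id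
      | with_reducible exact polyBdd_countTime
      | with_reducible exact polyBdd_growth
      | with_reducible exact PolyBdd.const _
      | with_reducible refine PolyBdd.add ?_ ?_
      | with_reducible refine PolyBdd.mul ?_ ?_
  obtain ⟨C, hC⟩ := hpoly
  refine ⟨.seq countProg estimateProg, C, fun n G => ?_⟩
  obtain ⟨s, hruns, hcs, h13, h50, h51, h52, h53, h54, h55, h56, h57, h58⟩ := countProg_reach G
  obtain ⟨t, h1, h2, h3⟩ := hruns _ (inputState_bdd G)
  obtain ⟨t', h4, h5, -⟩ := hc s _ h3
  exact ⟨_, _, h1.seq h4, (add_le_add h2 h5).trans (hC n),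
    estimateProg_output G hcs h13 h50 h51 h52 h53 h54 h55 h56 h57 h58⟩

end Efficiency

end SBM

end

theorem mainTheorem6 :
    ∃ est : SBM.Estimator, SBM.IsEfficient est ∧ SBM.UsesShortClosedWalks est ∧
      ∀ (k : ℕ) [NeZero k] (a b : ℝ), 2 ≤ k → 0 ≤ a → 0 ≤ b → 1 < SBM.snr k a b →
        SBM.IsConsistentAt est k a b :=
  ⟨SBM.estimator, SBM.estimator_isEfficient, SBM.estimator_usesShortClosedWalks,
    fun _ _ _ _ hk ha hb h => SBM.estimator_isConsistentAt hk ha hb h⟩
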